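/- Let $n\ge 2$, let $B=\{x\in\mathbb R^n:|x|<1\}$, let $|\cdot|$ denote Lebesgue measure on sets, and for $s\in(0,1)$ and measurable $E\subset\mathbb R^n$ let $$P_s(E)=\int_E\int_{E^c}\frac{dx\,dy}{|x-y|^{n+s}}\in[0,\infty].$$ For $u:\partial B\to\mathbb R$ put $$[u]_{\frac{1+s}{2}}^2=\iint_{\partial B\times\partial B}\frac{|u(x)-u(y)|^2}{|x-y|^{n+s}}\,d\mathcal H^{n-1}_x\,d\mathcal H^{n-1}_y .$$ There exist constants $\varepsilon_0\in(0,1/2)$ and $c_0>0$, depending only on $n$, with the following property. If $E\subset\mathbb R^n$ is a bounded open set whose boundary is $$\partial E=\{(1+u(x))\,x:\ x\in\partial B\}\qquad\text{for some }u\in C^1(\partial B),$$ and if $|E|=|B|$, $\int_E x\,dx=0$ and $\|u\|_{C^1(\partial B)}=\sup_{\partial B}|u|+\sup_{\partial B}|\nabla_\tau u|<\varepsilon_0$ (where $\nabla_\tau$ is the tangential gradient on $\partial B$), then for every $s\in(0,1)$ the quantities $P_s(E)$, $P_s(B)$ and $[u]_{\frac{1+s}{2}}^2$ are finite and $$P_s(E)-P_s(B)\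 \ge\ c_0\Big([u]_{\frac{1+s}{2}}^2+s\,P_s(B)\,\|u\|_{L^2(\partial B)}^2\Big).$$ -/

import Mathlib

open MeasureTheory Metric
open scoped ENNReal

noncomputable section

/-- The space `ℝⁿ` with its Euclidean norm and Lebesgue measure. -/
abbrev Rn (n : ℕ) : Type := EuclideanSpace ℝ (Fin n)

/-- The unit sphere `∂B` of `ℝⁿ`, as a type. -/
abbrev UnitSphere (n : ℕ) : Type := sphere (0 : Rn n) 1

/-- The surface measure of the unit sphere, normalized in the usual way, so that
integration in polar coordinates holds and the total mass is `n |B|`. -/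
abbrev surfaceMeasure (n : ℕ) : Measure (UnitSphere n) :=
  (volume : Measure (Rn n)).toSphere

/-- The `s`-perimeter `P_s(E) = ∫_E ∫_{Eᶜ} |x - y|^{-(n+s)} dy dx ∈ [0, ∞]`. -/
def sPerimeter {n : ℕ} (s : ℝ) (E : Set (Rn n)) : ℝ≥0∞ :=
  ∫⁻ x in E, ∫⁻ y in Eᶜ, ENNReal.ofReal (1 / ‖x - y‖ ^ ((n : ℝ) + s))

/-- The squared seminorm `[u]²` of `H^{(1+s)/2}(∂B)`, that is
`∬_{∂B × ∂B} |u(x) - u(y)|² / |x - y|^{n+s}`, with values in `[0, ∞]`. -/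
def sobolevSeminormSq {n : ℕ} (s : ℝ) (u : UnitSphere n → ℝ) : ℝ≥0∞ :=
  ∫⁻ x, ∫⁻ y, ENNReal.ofReal
    (|u x - u y| ^ 2 / ‖(x : Rn n) - (y : Rn n)‖ ^ ((n : ℝ) + s))
    ∂(surfaceMeasure n) ∂(surfaceMeasure n)

/-- The squared norm `‖u‖²` of `L²(∂B)`. -/
def sphereL2NormSq {n : ℕ} (u : UnitSphere n → ℝ) : ℝ :=
  ∫ x, u x ^ 2 ∂(surfaceMeasure n)

/-- The extension `z ↦ u(z / |z|)` of a function on the sphere to `ℝⁿ \ {0}`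
(with the value `0` at the origin). -/
def radialExtension {n : ℕ} (u : UnitSphere n → ℝ) (z : Rn n) : ℝ :=
  Function.extend (Subtype.val : UnitSphere n → Rn n) u 0 (‖z‖⁻¹ • z)

/-- `u ∈ C¹(∂B)`: the extension of `u` that is constant along rays is continuously
differentiable away from the origin. -/
def IsC1OnSphere {n : ℕ} (u : UnitSphere n → ℝ) : Prop :=
  ContDiffOn ℝ 1 (radialExtension u) {0}ᶜ

/-- The norm `sup |u| + sup |∇_τ u|` of `C¹(∂B)`, where `∇_τ` is the tangential gradient. At a
point of the sphere the derivative of the extension of `u` vanishes in the radial direction and is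
the differential of `u` on the tangent space, so its norm is that of the tangential gradient. -/
def sphereC1Norm {n : ℕ} (u : UnitSphere n → ℝ) : ℝ≥0∞ :=
  (⨆ x : UnitSphere n, ENNReal.ofReal |u x|) +
    ⨆ x : UnitSphere n, ENNReal.ofReal ‖fderiv ℝ (radialExtension u) (x : Rn n)‖

/-- `E` is a bounded open set with `∂E = {(1 + u(x)) x : x ∈ ∂B}` and `u ∈ C¹(∂B)`. -/
structure IsNearlySpherical {n : ℕ} (E : Set (Rn n)) (u : UnitSphere n → ℝ) : Prop where
  isOpen : IsOpen E
  isBounded : Bornology.IsBounded E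
  isC1 : IsC1OnSphere u
  frontier_eq : frontier E = Set.range fun x : UnitSphere n => (1 + u x) • (x : Rn n)

end

/-! Let σ be the total mass of ∂B and κ = P_s(B)/σ. In polar coordinates the interaction of E with
its complement becomes, for each pair of directions x, y, an integral over (0, 1+u(x)) × [1+u(y),
∞). Averaging with the pair y, x and cutting the rectangles at both radii leaves two diagonal terms,
which scale like (1+u)^(n-s), and an integral over the square whose sides run between 1+u(x) and
1+u(y). Hence P_s(E) = κ ∫ (1+u)^(n-s) + ½ ∬ (square term), which is `two_mul_sPerimeter`.

The volume constraint allows an affine function of (1+u)^n to be subtracted, so the first term minus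
P_s(B) is -½ s(n-s)κ‖u‖² up to a cubic error that keeps a factor s (`abs_powerDefect_add_le`). The
C¹ bound makes the square term comparable with [u]², with ratio close to one (`radialSquare_le`,
`le_radialSquare`). To leading order the deficit is ½([u]² - s(n-s)κ‖u‖²), and [u]² has to win by a
factor independent of s.

Two facts give this. Let L = `linearEnergy n s` be the Rayleigh quotient of the coordinate
functions. (a) s(n-s)κ ≤ L. A translated ball has the perimeter of B, so the same expansion applied
to B + t eᵢ vanishes; the order t² gives the inequality, and a fixed t gives the finiteness of L.
(b) [v]² ≥ (1+2/n) L‖v‖² for v orthogonal to the constants and the coordinates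
(`spectral_gap_sobolev`). Volume and barycenter make u orthogonal to these up to O(‖u‖²), which
lowers the factor to 1+1/n.

The gap (b) is proved without spherical harmonics. As |x-y|² = 2(1 - x·y), the kernel is a multiple
of (1 - x·y)^(-a) with a = (n+s)/2, the limit as r ↑ 1 of (1 - r x·y)^(-a), whose binomial series
has nonnegative coefficients. So it suffices to bound ∬ (x·y)^m v(x) v(y). Writing (x·y)^m = Σ
φ(x)φ(y) over monomials and replacing φ by φ - cΔφ gives a positive semidefinite kernel combining
the powers m, m-2, m-4. Its positivity, for a well chosen c, makes the suitably normalized even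
forms monotone in m (`powerForm_le_powerForm_add_two`). Schur's test as m → ∞ then yields the bound
attained by harmonics of degree two (`powerForm_even_le_of_mean_zero`). Odd powers reduce to even
ones applied to xᵢ v. Summing the series and letting r → 1 gives `spectral_gap_kernel`. -/

/-! ### Surface measure: invariance under isometries and polar coordinates. -/

section SphereMeasure

open Set Measure
open scoped Pointwise

variable {n : ℕ}

/-- The self-map of the unit sphere induced by a linear isometry of `ℝⁿ`. -/
noncomputable def sphereMap (e : Rn n ≃ₗᵢ[ℝ] Rn n) (x : UnitSphere n) : UnitSphere n :=
  ⟨e x, by simp⟩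

@[simp] lemma coe_sphereMap (e : Rn n ≃ₗᵢ[ℝ] Rn n) (x : UnitSphere n) :
    (sphereMap e x : Rn n) = e x := rfl

lemma continuous_sphereMap (e : Rn n ≃ₗᵢ[ℝ] Rn n) : Continuous (sphereMap e) :=
  (e.continuous.comp continuous_subtype_val).subtype_mk _

/-- The surface measure of a set is n times the volume of the cone over it, and a linear isometry
carries cones to cones and preserves volume. -/
lemma measurePreserving_sphereMap (e : Rn n ≃ₗᵢ[ℝ] Rn n) :
    MeasurePreserving (sphereMap e) (surfaceMeasure n) (surfaceMeasure n) := by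
  refine ⟨(continuous_sphereMap e).measurable, ?_⟩
  ext s hs
  rw [Measure.map_apply (continuous_sphereMap e).measurable hs,
    toSphere_apply' _ ((continuous_sphereMap e).measurable hs), toSphere_apply' _ hs]
  congr 1
  have : (Ioo (0 : ℝ) 1 • (Subtype.val '' (sphereMap e ⁻¹' s)) : Set (Rn n))
      = e ⁻¹' (Ioo (0 : ℝ) 1 • (Subtype.val '' s)) := by
    ext z
    constructor
    · rintro ⟨r, hr, _, ⟨x, hx, rfl⟩, rfl⟩
      exact ⟨r, hr, e x, ⟨sphereMap e x, hx, rfl⟩, by simp⟩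
    · rintro ⟨r, hr, _, ⟨x, hx, rfl⟩, h⟩
      refine ⟨r, hr, e.symm x, ⟨sphereMap e.symm x, ?_, rfl⟩, ?_⟩
      · have : sphereMap e (sphereMap e.symm x) = x := by ext1; simp
        simpa [this] using hx
      · apply e.injective
        simpa using h
  rw [this]
  exact e.measurePreserving.measure_preimage_equiv (f := e.toMeasurableEquiv) _

lemma measurableEmbedding_sphereMap (e : Rn n ≃ₗᵢ[ℝ] Rn n) :
    MeasurableEmbedding (sphereMap e) := by
  refine ((continuous_sphereMap e).isClosedEmbedding ?_).measurableEmbedding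
  intro x y h
  ext1
  exact e.injective (congrArg Subtype.val h)

/-- The group of linear isometries acts transitively on the sphere. -/
lemma exists_isometry_map_eq (x y : UnitSphere n) :
    ∃ e : Rn n ≃ₗᵢ[ℝ] Rn n, sphereMap e x = y := by
  refine ⟨Submodule.reflection (ℝ ∙ ((x : Rn n) - y))ᗮ, ?_⟩
  ext1
  exact Submodule.reflection_sub (by simp)

/-- Transitivity of the isometries makes integrals of invariant kernels independent of the pole;
this is what makes κ, L and the zonal moments well-defined constants. -/
lemma lintegral_sphere_const {F : Rn n → Rn n → ℝ≥0∞}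
    (hF : ∀ (e : Rn n ≃ₗᵢ[ℝ] Rn n) x y, F (e x) (e y) = F x y) (x x' : UnitSphere n) :
    ∫⁻ y, F x y ∂(surfaceMeasure n) = ∫⁻ y, F x' y ∂(surfaceMeasure n) := by
  obtain ⟨e, rfl⟩ := exists_isometry_map_eq x x'
  rw [← (measurePreserving_sphereMap e).lintegral_comp_emb (measurableEmbedding_sphereMap e)
    (fun y => F (sphereMap e x) y)]
  simp [hF]

lemma integral_sphere_const {F : Rn n → Rn n → ℝ}
    (hF : ∀ (e : Rn n ≃ₗᵢ[ℝ] Rn n) x y, F (e x) (e y) = F x y) (x x' : UnitSphere n) :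
    ∫ y : UnitSphere n, F x y ∂(surfaceMeasure n)
      = ∫ y : UnitSphere n, F x' y ∂(surfaceMeasure n) := by
  obtain ⟨e, rfl⟩ := exists_isometry_map_eq x x'
  rw [← (measurePreserving_sphereMap e).integral_comp (measurableEmbedding_sphereMap e)
    (fun y => F (sphereMap e x) y)]
  simp [hF]

lemma integral_sphere_neg (f : Rn n → ℝ) :
    ∫ y : UnitSphere n, f (-y) ∂(surfaceMeasure n) = ∫ y : UnitSphere n, f y ∂(surfaceMeasure n) := by
  rw [← (measurePreserving_sphereMap (LinearIsometryEquiv.neg ℝ)).integral_comp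
    (measurableEmbedding_sphereMap _) (fun y : UnitSphere n => f y)]
  simp

/-- Polar coordinates for the Lebesgue integral. -/
lemma lintegral_polar [NeZero n] {f : Rn n → ℝ≥0∞} (hf : Measurable f) :
    ∫⁻ z, f z = ∫⁻ x : UnitSphere n, ∫⁻ r in Ioi (0 : ℝ),
      ENNReal.ofReal (r ^ (n - 1)) * f (r • (x : Rn n)) ∂volume ∂(surfaceMeasure n) := by
  have : Nontrivial (Rn n) := inferInstance
  calc ∫⁻ z, f z = ∫⁻ z : ({(0)}ᶜ : Set (Rn n)), f z ∂(volume.comap Subtype.val) := by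
        rw [lintegral_subtype_comap (measurableSet_singleton _).compl f, restrict_compl_singleton]
    _ = ∫⁻ p : UnitSphere n × Ioi (0 : ℝ), f ((p.2 : ℝ) • (p.1 : Rn n))
          ∂((surfaceMeasure n).prod (volumeIoiPow (n - 1))) := by
        have := (volume : Measure (Rn n)).measurePreserving_homeomorphUnitSphereProd.symm
          (homeomorphUnitSphereProd (Rn n)).toMeasurableEquiv
        have := this.lintegral_comp_emb (MeasurableEquiv.measurableEmbedding _)
          (fun z : ({(0)}ᶜ : Set (Rn n)) => f z)
        rw [← this, finrank_euclideanSpace_fin]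
        rfl
    _ = ∫⁻ x : UnitSphere n, ∫⁻ r, f ((r : ℝ) • (x : Rn n)) ∂(volumeIoiPow (n - 1))
          ∂(surfaceMeasure n) := by
        rw [lintegral_prod]
        fun_prop
    _ = _ := by
        congr with x
        rw [volumeIoiPow, lintegral_withDensity_eq_lintegral_mul]
        · exact lintegral_subtype_comap measurableSet_Ioi
            (fun r : ℝ => ENNReal.ofReal (r ^ (n - 1)) * f (r • (x : Rn n)))
        · fun_prop
        · fun_prop

end SphereMeasure

/-! ### Laplacians of powers of the inner product. -/

section PolynomialLaplacian

open MvPolynomial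

variable {n : ℕ}

/-- The Laplacian on polynomials. -/
noncomputable def polyLaplacian : MvPolynomial (Fin n) ℝ →ₗ[ℝ] MvPolynomial (Fin n) ℝ :=
  ∑ i, (pderiv i).toLinearMap ∘ₗ (pderiv i).toLinearMap

lemma polyLaplacian_apply (p : MvPolynomial (Fin n) ℝ) :
    polyLaplacian p = ∑ i, pderiv i (pderiv i p) := by
  simp [polyLaplacian]

/-- The linear form `∑ yᵢ Xᵢ`. -/
noncomputable def linearPoly (y : Fin n → ℝ) : MvPolynomial (Fin n) ℝ := ∑ i, C (y i) * X i

lemma eval_linearPoly (x y : Fin n → ℝ) : eval x (linearPoly y) = ∑ i, y i * x i := by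
  simp [linearPoly]

lemma pderiv_linearPoly (y : Fin n → ℝ) (i : Fin n) : pderiv i (linearPoly y) = C (y i) := by
  simp [linearPoly, Pi.single_apply]

lemma polyLaplacian_linearPoly_pow (y : Fin n → ℝ) (d : ℕ) :
    polyLaplacian (linearPoly y ^ (d + 2))
      = C (((d : ℝ) + 2) * (d + 1) * ∑ i, y i ^ 2) * linearPoly y ^ d := by
  have h (i : Fin n) : pderiv i (pderiv i (linearPoly y ^ (d + 2)))
      = C (((d : ℝ) + 2) * (d + 1)) * linearPoly y ^ d * C (y i ^ 2) := by
    simp only [pderiv_pow, pderiv_linearPoly, Derivation.leibniz, smul_eq_mul, pderiv_C,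
      Derivation.map_natCast, map_mul, map_add, map_natCast, map_pow]
    push_cast
    simp only [map_ofNat, map_one]
    ring
  rw [polyLaplacian_apply, Finset.sum_congr rfl fun i _ => h i, ← Finset.mul_sum, ← map_sum]
  simp only [map_mul]
  ring

/-- The polynomial `∑ Xᵢ²`. -/
noncomputable def normSqPoly (n : ℕ) : MvPolynomial (Fin n) ℝ := ∑ i, X i ^ 2

lemma pderiv_normSqPoly (i : Fin n) : pderiv i (normSqPoly n) = 2 * X i := by
  simp [normSqPoly, Pi.single_apply]

/-- Applying Δ in x to (x·y)^(d+4) leaves a multiple of |y|²(x·y)^(d+2); this computes the further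
Laplacian in y. -/
lemma polyLaplacian_normSqPoly_mul (y : Fin n → ℝ) (d : ℕ) :
    polyLaplacian (normSqPoly n * linearPoly y ^ (d + 2))
      = C (2 * (n : ℝ) + 4 * (d + 2)) * linearPoly y ^ (d + 2)
        + C (((d : ℝ) + 2) * (d + 1) * ∑ i, y i ^ 2) * normSqPoly n * linearPoly y ^ d := by
  have h (i : Fin n) : pderiv i (pderiv i (normSqPoly n * linearPoly y ^ (d + 2)))
      = 2 * linearPoly y ^ (d + 2)
        + C (4 * ((d : ℝ) + 2)) * linearPoly y ^ (d + 1) * (C (y i) * X i)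
        + normSqPoly n * pderiv i (pderiv i (linearPoly y ^ (d + 2))) := by
    simp only [pderiv_pow, pderiv_linearPoly, Derivation.leibniz, smul_eq_mul, pderiv_C,
      Derivation.map_natCast, map_mul, map_add, map_natCast, pderiv_normSqPoly, pderiv_X_self,
      map_ofNat]
    have h2 : pderiv i (2 : MvPolynomial (Fin n) ℝ) = 0 := by
      exact_mod_cast Derivation.map_natCast (pderiv (R := ℝ) i) 2
    rw [h2]
    push_cast
    ring
  rw [polyLaplacian_apply, Finset.sum_congr rfl fun i _ => h i, Finset.sum_add_distrib,
    Finset.sum_add_distrib, ← Finset.mul_sum, ← Finset.mul_sum, ← Finset.mul_sum, ← polyLaplacian_apply,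
    polyLaplacian_linearPoly_pow, ← linearPoly]
  simp only [Finset.sum_const, Finset.card_univ, Fintype.card_fin, nsmul_eq_mul, map_mul, map_add,
    map_natCast, map_ofNat]
  ring

/-- The monomial `X_{f 0} ⋯ X_{f (m - 1)}`. -/
noncomputable def wordMonomial {m : ℕ} (f : Fin m → Fin n) : MvPolynomial (Fin n) ℝ := ∏ j, X (f j)

/-- Evaluated at x, this displays (x·y)^m as a sum of products φ(x)φ(y). Indexing by words instead
of exponents makes every coefficient equal to one. -/
lemma linearPoly_pow_eq_sum (y : Fin n → ℝ) (m : ℕ) :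
    linearPoly y ^ m = ∑ f : Fin m → Fin n, eval y (wordMonomial f) • wordMonomial f := by
  have : linearPoly y ^ m = ∏ _j : Fin m, ∑ i, C (y i) * X i := by
    simp [linearPoly]
  rw [this, Fintype.prod_sum]
  refine Finset.sum_congr rfl fun f _ => ?_
  simp [wordMonomial, Finset.prod_mul_distrib, smul_eq_C_mul]

lemma sum_eval_wordMonomial_laplacian (x y : Fin n → ℝ) (d : ℕ) :
    ∑ f : Fin (d + 2) → Fin n, eval y (wordMonomial f) * eval x (polyLaplacian (wordMonomial f))
      = ((d : ℝ) + 2) * (d + 1) * (∑ i, y i ^ 2) * (∑ i, y i * x i) ^ d := by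
  have h := congrArg (eval x ∘ polyLaplacian) (linearPoly_pow_eq_sum y (d + 2))
  simp only [Function.comp_apply, polyLaplacian_linearPoly_pow, map_sum, map_smul, smul_eval,
    map_mul, map_pow, eval_linearPoly, eval_C] at h
  exact h.symm

lemma sum_eval_laplacian_laplacian (x y : Fin n → ℝ) (d : ℕ) :
    ∑ f : Fin (d + 4) → Fin n,
        eval y (polyLaplacian (wordMonomial f)) * eval x (polyLaplacian (wordMonomial f))
      = ((d : ℝ) + 4) * (d + 3) * ((2 * n + 4 * (d + 2)) * (∑ i, x i * y i) ^ (d + 2)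
        + (d + 2) * (d + 1) * (∑ i, x i ^ 2) * (∑ i, y i ^ 2) * (∑ i, x i * y i) ^ d) := by
  -- With x frozen, the previous identity is one between polynomials in the second variable, so the
  -- Laplacian can be applied to it again.
  have h : ∑ f : Fin (d + 4) → Fin n, eval x (polyLaplacian (wordMonomial f)) • wordMonomial f
      = (((d : ℝ) + 4) * (d + 3)) • (normSqPoly n * linearPoly x ^ (d + 2)) := by
    apply MvPolynomial.funext
    intro z
    have := sum_eval_wordMonomial_laplacian x z (d + 2)
    simp only [map_sum, smul_eval, map_mul, map_pow, eval_linearPoly, normSqPoly, eval_X]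
    rw [Finset.sum_congr rfl fun f _ => mul_comm _ _, this]
    push_cast
    rw [Finset.sum_congr rfl fun i _ => mul_comm (z i) (x i)]
    ring
  have h' := congrArg (eval y ∘ polyLaplacian) h
  simp only [Function.comp_apply, polyLaplacian_normSqPoly_mul, map_smul] at h'
  simp only [map_sum, map_smul, smul_eval, map_mul, map_pow, eval_linearPoly, eval_C, map_add,
    normSqPoly, eval_X] at h'
  rw [Finset.sum_congr rfl fun f _ => mul_comm _ _, h']

/-- A positive definite combination of powers of the inner product on the unit sphere. -/
lemma sum_wordMonomial_sub_laplacian {x y : Fin n → ℝ} (hx : ∑ i, x i ^ 2 = 1)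
    (hy : ∑ i, y i ^ 2 = 1) (d : ℕ) (c : ℝ) :
    ∑ f : Fin (d + 4) → Fin n, eval x (wordMonomial f - c • polyLaplacian (wordMonomial f))
        * eval y (wordMonomial f - c • polyLaplacian (wordMonomial f))
      = (∑ i, x i * y i) ^ (d + 4)
        - 2 * c * (((d : ℝ) + 4) * (d + 3)) * (∑ i, x i * y i) ^ (d + 2)
        + c ^ 2 * (((d : ℝ) + 4) * (d + 3)) * ((2 * n + 4 * (d + 2)) * (∑ i, x i * y i) ^ (d + 2)
        + (d + 2) * (d + 1) * (∑ i, x i * y i) ^ d) := by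
  have h0 : ∑ f : Fin (d + 4) → Fin n, eval x (wordMonomial f) * eval y (wordMonomial f)
      = (∑ i, x i * y i) ^ (d + 4) := by
    have h := congrArg (eval y) (linearPoly_pow_eq_sum x (d + 4))
    simp only [map_pow, eval_linearPoly, map_sum, smul_eval] at h
    exact h.symm
  have hc : ∑ i, y i * x i = ∑ i, x i * y i := Finset.sum_congr rfl fun i _ => mul_comm _ _
  have h1 := sum_eval_wordMonomial_laplacian x y (d + 2)
  have h2 := sum_eval_wordMonomial_laplacian y x (d + 2)
  have h3 := sum_eval_laplacian_laplacian x y d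
  rw [hy, hc] at h1
  rw [hx] at h2
  rw [hx, hy] at h3
  -- Summed over f, this is K - cΔ_xK - cΔ_yK + c²Δ_xΔ_yK for K = (x·y)^(d+4), restricted to the
  -- sphere.
  have : ∀ f : Fin (d + 4) → Fin n, eval x (wordMonomial f - c • polyLaplacian (wordMonomial f))
        * eval y (wordMonomial f - c • polyLaplacian (wordMonomial f))
      = eval x (wordMonomial f) * eval y (wordMonomial f)
        - c * (eval y (wordMonomial f) * eval x (polyLaplacian (wordMonomial f)))
        - c * (eval x (wordMonomial f) * eval y (polyLaplacian (wordMonomial f)))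
        + c ^ 2 * (eval y (polyLaplacian (wordMonomial f))
          * eval x (polyLaplacian (wordMonomial f))) := by
    intro f
    simp only [map_sub, smul_eval]
    ring
  rw [Finset.sum_congr rfl fun f _ => this f, Finset.sum_add_distrib, Finset.sum_sub_distrib,
    Finset.sum_sub_distrib, ← Finset.mul_sum, ← Finset.mul_sum, ← Finset.mul_sum, h0, h1, h2, h3]
  push_cast
  ring

end PolynomialLaplacian

/-! ### Quadratic forms of the kernels (x·y)^m. -/

section Moments

variable {n : ℕ}

lemma integrable_sphere {f : UnitSphere n → ℝ} (hf : Continuous f) :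
    Integrable f (surfaceMeasure n) :=
  hf.integrable_of_hasCompactSupport (HasCompactSupport.of_compactSpace f)

lemma integrable_sphere_prod {f : UnitSphere n × UnitSphere n → ℝ} (hf : Continuous f) :
    Integrable f ((surfaceMeasure n).prod (surfaceMeasure n)) :=
  hf.integrable_of_hasCompactSupport (HasCompactSupport.of_compactSpace f)

lemma sphere_inner_eq (x y : Rn n) : inner ℝ x y = ∑ i, x i * y i := by
  simp [PiLp.inner_apply, mul_comm]

lemma sphere_sum_sq (x : UnitSphere n) : ∑ i, (x : Rn n) i ^ 2 = 1 := by
  have := EuclideanSpace.norm_sq_eq (x : Rn n)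
  simpa using this.symm

/-- The quadratic form of the kernel `(x · y)ᵐ` on the sphere. -/
noncomputable def powerForm (m : ℕ) (v : UnitSphere n → ℝ) : ℝ :=
  ∫ p : UnitSphere n × UnitSphere n, (inner ℝ (p.1 : Rn n) p.2) ^ m * (v p.1 * v p.2)
    ∂((surfaceMeasure n).prod (surfaceMeasure n))

lemma continuous_powerForm_integrand (m : ℕ) {v : UnitSphere n → ℝ} (hv : Continuous v) :
    Continuous fun p : UnitSphere n × UnitSphere n =>
      (inner ℝ (p.1 : Rn n) p.2) ^ m * (v p.1 * v p.2) := by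
  fun_prop

/-- The kernel of this combination is Σ ψ_f(x)ψ_f(y), so the form is the sum of the squares of ∫ ψ_f
v. -/
lemma powerForm_combination_nonneg {v : UnitSphere n → ℝ} (hv : Continuous v) (d : ℕ) (c : ℝ) :
    0 ≤ powerForm (d + 4) v
        - 2 * c * (((d : ℝ) + 4) * (d + 3)) * powerForm (d + 2) v
        + c ^ 2 * (((d : ℝ) + 4) * (d + 3)) * ((2 * n + 4 * (d + 2)) * powerForm (d + 2) v
        + (d + 2) * (d + 1) * powerForm d v) := by
  let ψ (f : Fin (d + 4) → Fin n) (x : UnitSphere n) : ℝ :=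
    MvPolynomial.eval (x : Rn n) (wordMonomial f - c • polyLaplacian (wordMonomial f))
  have hψ (f) : Continuous (ψ f) :=
    (MvPolynomial.continuous_eval _).comp (by fun_prop)
  have key : ∫ p : UnitSphere n × UnitSphere n, ∑ f, (ψ f p.1 * v p.1) * (ψ f p.2 * v p.2)
      ∂((surfaceMeasure n).prod (surfaceMeasure n))
      = ∑ f, (∫ x, ψ f x * v x ∂(surfaceMeasure n)) ^ 2 := by
    rw [integral_finsetSum]
    · refine Finset.sum_congr rfl fun f _ => ?_
      rw [integral_prod_mul (fun x => ψ f x * v x) (fun x => ψ f x * v x), sq]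
    · intro f _
      have := hψ f
      exact integrable_sphere_prod (by fun_prop)
  have hnn : 0 ≤ ∑ f, (∫ x, ψ f x * v x ∂(surfaceMeasure n)) ^ 2 := by positivity
  rw [← key] at hnn
  have hI (m : ℕ) := integrable_sphere_prod (continuous_powerForm_integrand (n := n) m hv)
  refine hnn.trans_eq ?_
  simp only [powerForm]
  rw [← integral_const_mul, ← integral_const_mul, ← integral_const_mul,
    ← integral_add ((hI _).const_mul _) ((hI _).const_mul _), ← integral_const_mul,
    ← integral_sub (hI _) ((hI _).const_mul _), ← integral_add]
  · refine integral_congr_ae (Filter.Eventually.of_forall fun p => ?_)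
    have := sum_wordMonomial_sub_laplacian (sphere_sum_sq p.1) (sphere_sum_sq p.2) d c
    simp only [sphere_inner_eq]
    rw [Finset.sum_congr rfl fun f _ =>
      show ψ f p.1 * v p.1 * (ψ f p.2 * v p.2) = (v p.1 * v p.2) * (ψ f p.1 * ψ f p.2) by ring,
      ← Finset.mul_sum, this]
    ring
  · exact (hI _).sub ((hI _).const_mul _)
  · exact (((hI _).const_mul _).add ((hI _).const_mul _)).const_mul _

lemma powerForm_zero (v : UnitSphere n → ℝ) :
    powerForm 0 v = (∫ x, v x ∂(surfaceMeasure n)) ^ 2 := by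
  simp only [powerForm, pow_zero, one_mul]
  rw [integral_prod_mul, sq]

/-- Comparison of consecutive even power forms on functions with zero mean. -/
lemma powerForm_le_powerForm_add_two {v : UnitSphere n → ℝ} (hv : Continuous v)
    (h0 : ∫ x, v x ∂(surfaceMeasure n) = 0) (j : ℕ) :
    (2 * (j : ℝ) + 2) * (2 * j + 1) * powerForm (2 * j) v
      ≤ (2 * j) * (2 * j + 2 + n) * powerForm (2 * j + 2) v := by
  -- The mean enters only at j = 0, where the form is (∫ v)² = 0.
  induction j with
  | zero => simp [powerForm_zero, h0]
  | succ j ih =>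
    have hp : (0 : ℝ) < (2 * j + 2) * (2 * j + 4 + n) := by positivity
    -- Once the inductive hypothesis has absorbed the power 2j, the form of power 2j+2 has a
    -- coefficient proportional to -2c + c²(2j+2)(2j+4+n); this c minimizes it.
    have h := powerForm_combination_nonneg hv (2 * j) (1 / ((2 * j + 2) * (2 * j + 4 + n)))
    push_cast at h ⊢
    rw [show 2 * (j + 1) + 2 = 2 * j + 4 by ring, show 2 * (j + 1) = 2 * j + 2 by ring]
    set c := 1 / ((2 * (j : ℝ) + 2) * (2 * j + 4 + n)) with hc
    have hc0 : 0 < c := by positivity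
    have hc1 : c * ((2 * (j : ℝ) + 2) * (2 * j + 4 + n)) = 1 := by
      rw [hc]; field_simp
    set M := powerForm (2 * j + 2) v
    set M4 := powerForm (2 * j + 4) v
    have h2 : 0 ≤ M4 - 2 * c * ((2 * (j : ℝ) + 4) * (2 * j + 3)) * M
        + c ^ 2 * ((2 * (j : ℝ) + 4) * (2 * j + 3))
          * ((2 * n + 4 * (2 * j + 2)) * M + (2 * j) * (2 * j + 2 + n) * M) := by
      refine h.trans ?_
      gcongr
    have h3 : 0 ≤ M4 - c * ((2 * (j : ℝ) + 4) * (2 * j + 3)) * M := by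
      refine h2.trans_eq ?_
      linear_combination (c * ((2 * (j : ℝ) + 4) * (2 * j + 3)) * M) * hc1
    have h4 := mul_nonneg hp.le h3
    have h5 : (2 * (j : ℝ) + 2) * (2 * j + 4 + n) * (M4 - c * ((2 * (j : ℝ) + 4) * (2 * j + 3)) * M)
        = (2 * (j : ℝ) + 2) * (2 * j + 4 + n) * M4 - ((2 * (j : ℝ) + 4) * (2 * j + 3)) * M := by
      linear_combination (-((2 * (j : ℝ) + 4) * (2 * j + 3)) * M) * hc1
    rw [h5] at h4
    linear_combination h4

/-- The sum Σ xᵢyᵢ supplies one more factor x·y, so bounds for even powers on xᵢ v become bounds for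
odd powers on v. -/
lemma sum_powerForm_coord_mul {v : UnitSphere n → ℝ} (hv : Continuous v) (m : ℕ) :
    ∑ i, powerForm m (fun x => (x : Rn n) i * v x) = powerForm (m + 1) v := by
  simp only [powerForm]
  rw [← integral_finsetSum]
  · congr with p
    rw [pow_succ]
    conv_rhs => rw [mul_assoc]; enter [2]; rw [sphere_inner_eq]
    rw [← Finset.mul_sum, Finset.sum_mul]
    congr 1
    refine Finset.sum_congr rfl fun i _ => by ring
  · intro i _
    exact integrable_sphere_prod (by fun_prop)

lemma sum_sphereL2NormSq_coord_mul {v : UnitSphere n → ℝ} (hv : Continuous v) :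
    ∑ i, sphereL2NormSq (fun x => (x : Rn n) i * v x) = sphereL2NormSq v := by
  simp only [sphereL2NormSq]
  rw [← integral_finsetSum]
  · congr with x
    simp only [mul_pow, ← Finset.sum_mul, sphere_sum_sq, one_mul]
  · intro i _
    exact integrable_sphere (by fun_prop)

end Moments

/-! ### Moments of the sphere and the sharp bounds for the power forms. -/

section ZonalMoments

variable {n : ℕ} [NeZero n]

/-- The moments `∫ (e · y)ᵐ dσ(y)` of the surface measure, for any unit vector `e`. -/
noncomputable def zonalMoment (n : ℕ) [NeZero n] (m : ℕ) : ℝ :=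
  ∫ y : UnitSphere n, ((y : Rn n) 0) ^ m ∂(surfaceMeasure n)

instance : Nonempty (UnitSphere n) := ⟨⟨EuclideanSpace.single 0 1, by simp⟩⟩

lemma integral_inner_pow (x : UnitSphere n) (m : ℕ) :
    ∫ y : UnitSphere n, (inner ℝ (x : Rn n) y) ^ m ∂(surfaceMeasure n) = zonalMoment n m := by
  rw [integral_sphere_const (F := fun x y => (inner ℝ x y) ^ m) (by simp) x
    ⟨EuclideanSpace.single 0 1, by simp⟩]
  simp [zonalMoment, EuclideanSpace.inner_single_left]

lemma zonalMoment_odd (j : ℕ) : zonalMoment n (2 * j + 1) = 0 := by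
  have h := integral_sphere_neg (fun y : Rn n => (y 0) ^ (2 * j + 1))
  simp only [PiLp.neg_apply, Odd.neg_pow ⟨j, rfl⟩, integral_neg] at h
  simp only [zonalMoment]
  linarith

lemma integral_inner_pow_even (z : Rn n) (hz : z ≠ 0) (j : ℕ) :
    ∫ y : UnitSphere n, (inner ℝ z (y : Rn n)) ^ (2 * j) ∂(surfaceMeasure n)
      = (‖z‖ ^ 2) ^ j * zonalMoment n (2 * j) := by
  have hz' : ‖z‖ ≠ 0 := norm_ne_zero_iff.2 hz
  rw [← integral_inner_pow ⟨‖z‖⁻¹ • z, by simp [norm_smul, hz']⟩, ← integral_const_mul]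
  congr with y
  rw [real_inner_smul_left, mul_pow, ← pow_mul, ← mul_assoc, ← mul_pow, mul_inv_cancel₀ hz']
  simp

/-- Integrating (y₀ + τ yᵢ)^(2j+2) gives (1+τ²)^(j+1) times the moment, by rotation invariance; the
coefficients of τ² are compared. -/
lemma integral_coord_pow_mul_sq (j : ℕ) (i : Fin n) (hi : i ≠ 0) :
    (2 * (j : ℝ) + 1) * ∫ y : UnitSphere n, (y : Rn n) 0 ^ (2 * j) * (y : Rn n) i ^ 2
      ∂(surfaceMeasure n) = zonalMoment n (2 * j + 2) := by
  open Polynomial in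
  have key : (∑ k ∈ Finset.range (2 * j + 2 + 1), C (∫ y : UnitSphere n,
        (y : Rn n) i ^ k * (y : Rn n) 0 ^ (2 * j + 2 - k) * ((2 * j + 2).choose k : ℝ)
          ∂(surfaceMeasure n)) * X ^ k : ℝ[X])
      = C (zonalMoment n (2 * j + 2)) * expand ℝ 2 ((1 + X) ^ (j + 1)) := by
    apply Polynomial.funext
    intro τ
    have h := integral_inner_pow_even
      (EuclideanSpace.single (0 : Fin n) (1 : ℝ) + τ • EuclideanSpace.single i (1 : ℝ)) (by
        intro h0
        have := congrArg (fun z : Rn n => z 0) h0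
        simp [hi.symm] at this) (j + 1)
    have hnorm : ‖EuclideanSpace.single (0 : Fin n) (1 : ℝ)
        + τ • EuclideanSpace.single i (1 : ℝ)‖ ^ 2 = 1 + τ ^ 2 := by
      rw [@norm_add_sq_real]
      simp [norm_smul, EuclideanSpace.inner_single_left, inner_smul_right, hi]
    rw [hnorm, mul_add, mul_one] at h
    have hl : ∀ y : UnitSphere n, inner ℝ (EuclideanSpace.single (0 : Fin n) (1 : ℝ)
        + τ • EuclideanSpace.single i (1 : ℝ)) (y : Rn n) = τ * (y : Rn n) i + (y : Rn n) 0 := by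
      intro y
      simp [inner_add_left, inner_smul_left, EuclideanSpace.inner_single_left, add_comm]
    simp only [hl, add_pow (τ * _)] at h
    rw [integral_finsetSum] at h
    · simp only [eval_finsetSum, eval_mul, eval_C, eval_pow, eval_X, expand_eval, eval_add,
        eval_one]
      rw [mul_comm (zonalMoment n _), ← h]
      refine Finset.sum_congr rfl fun k _ => ?_
      rw [← integral_mul_const]
      congr with y
      ring
    · intro k _
      exact integrable_sphere (by fun_prop)
  have h2 := congrArg (fun p => Polynomial.coeff p 2) key
  have hexp : (Polynomial.expand ℝ 2 ((1 + Polynomial.X) ^ (j + 1))).coeff 2 = (j : ℝ) + 1 := by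
    have := Polynomial.coeff_expand_mul (R := ℝ) (p := 2) (by norm_num)
      ((1 + Polynomial.X) ^ (j + 1)) 1
    rw [one_mul] at this
    rw [this, Polynomial.coeff_one_add_X_pow]
    simp
  simp only [Polynomial.finsetSum_coeff, Polynomial.coeff_C_mul, hexp, Polynomial.coeff_X_pow]
    at h2
  rw [Finset.sum_eq_single 2 (by intro b _ hb; simp [hb.symm]) (by intro h; simp at h)] at h2
  simp only [if_true, mul_one] at h2
  have hch : (((2 * j + 2).choose 2 : ℕ) : ℝ) = (2 * j + 1) * (j + 1) := by
    rw [Nat.cast_choose_two]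
    push_cast
    ring
  rw [integral_mul_const, hch, Nat.add_sub_cancel] at h2
  have hj : (j : ℝ) + 1 ≠ 0 := by positivity
  apply mul_right_cancel₀ hj
  rw [← h2]
  have : ∀ y : UnitSphere n, (y : Rn n) 0 ^ (2 * j) * (y : Rn n) i ^ 2
      = (y : Rn n) i ^ 2 * (y : Rn n) 0 ^ (2 * j) := fun y => mul_comm _ _
  simp only [this]
  ring

/-- Since |y|² = 1, the integrals of y₀^(2j) yᵢ² sum over i to the moment of order 2j; each term
with i ≠ 0 is a fixed multiple of the moment of order 2j+2. -/
lemma zonalMoment_rec (j : ℕ) :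
    ((n : ℝ) + 2 * j) * zonalMoment n (2 * j + 2) = (2 * j + 1) * zonalMoment n (2 * j) := by
  have h1 : ∑ i : Fin n, ∫ y : UnitSphere n, (y : Rn n) 0 ^ (2 * j) * (y : Rn n) i ^ 2
      ∂(surfaceMeasure n) = zonalMoment n (2 * j) := by
    rw [← integral_finsetSum]
    · simp only [← Finset.mul_sum, sphere_sum_sq, mul_one]
      rfl
    · intro i _
      exact integrable_sphere (by fun_prop)
  rw [← Finset.add_sum_erase _ _ (Finset.mem_univ (0 : Fin n))] at h1
  have h2 : ∫ y : UnitSphere n, (y : Rn n) 0 ^ (2 * j) * (y : Rn n) 0 ^ 2 ∂(surfaceMeasure n)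
      = zonalMoment n (2 * j + 2) := by
    simp only [← pow_add]
    rfl
  have hj : (2 * (j : ℝ) + 1) ≠ 0 := by positivity
  have h3 : ∑ i ∈ Finset.univ.erase (0 : Fin n), ∫ y : UnitSphere n,
      (y : Rn n) 0 ^ (2 * j) * (y : Rn n) i ^ 2 ∂(surfaceMeasure n)
      = ((n : ℝ) - 1) * (zonalMoment n (2 * j + 2) / (2 * j + 1)) := by
    rw [Finset.sum_congr rfl fun i hi => show _ = zonalMoment n (2 * j + 2) / (2 * j + 1) by
      rw [← integral_coord_pow_mul_sq j i (Finset.ne_of_mem_erase hi)]; field_simp]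
    rw [Finset.sum_const, Finset.card_erase_of_mem (Finset.mem_univ _), nsmul_eq_mul,
      Finset.card_univ, Fintype.card_fin, Nat.cast_sub (NeZero.one_le), Nat.cast_one]
  rw [h2, h3] at h1
  rw [← h1]
  field_simp
  ring

lemma zonalMoment_zero : zonalMoment n 0 = (surfaceMeasure n).real Set.univ := by
  simp [zonalMoment]

lemma surfaceMeasure_real_univ_pos : 0 < (surfaceMeasure n).real Set.univ := by
  have : Nontrivial (Rn n) := inferInstance
  exact measureReal_univ_pos

lemma zonalMoment_even_pos (j : ℕ) : 0 < zonalMoment n (2 * j) := by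
  induction j with
  | zero => simpa [zonalMoment_zero] using surfaceMeasure_real_univ_pos
  | succ j ih =>
    have h := zonalMoment_rec (n := n) j
    have hn : (0 : ℝ) < n := by exact_mod_cast NeZero.pos n
    have : 0 < ((n : ℝ) + 2 * j) * zonalMoment n (2 * j + 2) := by rw [h]; positivity
    exact pos_of_mul_pos_right this (by positivity)

/-- Schur's test: the kernel is nonnegative and its integral in either variable is the zonal moment.
-/
lemma powerForm_even_le {v : UnitSphere n → ℝ} (hv : Continuous v) (j : ℕ) :
    powerForm (2 * j) v ≤ zonalMoment n (2 * j) * sphereL2NormSq v := by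
  have h1 : ∀ p : UnitSphere n × UnitSphere n,
      (inner ℝ (p.1 : Rn n) p.2) ^ (2 * j) * (v p.1 * v p.2)
      ≤ (inner ℝ (p.1 : Rn n) p.2) ^ (2 * j) * (v p.1 ^ 2) / 2
        + (inner ℝ (p.1 : Rn n) p.2) ^ (2 * j) * (v p.2 ^ 2) / 2 := by
    intro p
    have : 0 ≤ (inner ℝ (p.1 : Rn n) p.2) ^ (2 * j) := (even_two_mul j).pow_nonneg _
    nlinarith [sq_nonneg (v p.1 - v p.2)]
  have i1 : Integrable (fun p : UnitSphere n × UnitSphere n =>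
      (inner ℝ (p.1 : Rn n) p.2) ^ (2 * j) * (v p.1 ^ 2) / 2)
      ((surfaceMeasure n).prod (surfaceMeasure n)) := integrable_sphere_prod (by fun_prop)
  have i2 : Integrable (fun p : UnitSphere n × UnitSphere n =>
      (inner ℝ (p.1 : Rn n) p.2) ^ (2 * j) * (v p.2 ^ 2) / 2)
      ((surfaceMeasure n).prod (surfaceMeasure n)) := integrable_sphere_prod (by fun_prop)
  have h2 := integral_mono (integrable_sphere_prod (continuous_powerForm_integrand (2 * j) hv))
    (i1.add i2) h1
  refine h2.trans_eq ?_
  simp only [Pi.add_apply]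
  rw [integral_add i1 i2, integral_prod _ i1, integral_prod_symm _ i2]
  have e1 : ∀ x : UnitSphere n, ∫ y : UnitSphere n,
      (inner ℝ (x : Rn n) y) ^ (2 * j) * (v x ^ 2) / 2 ∂(surfaceMeasure n)
      = zonalMoment n (2 * j) / 2 * v x ^ 2 := by
    intro x
    rw [integral_div, integral_mul_const, integral_inner_pow]
    ring
  have e2 : ∀ x : UnitSphere n, ∫ y : UnitSphere n,
      (inner ℝ (y : Rn n) x) ^ (2 * j) * (v x ^ 2) / 2 ∂(surfaceMeasure n)
      = zonalMoment n (2 * j) / 2 * v x ^ 2 := by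
    intro x
    simp only [real_inner_comm (x : Rn n)]
    exact e1 x
  simp only [e1, e2, integral_const_mul, sphereL2NormSq]
  ring

/-- The sharp bound for the even power forms on functions with zero mean. -/
lemma powerForm_even_le_of_mean_zero {v : UnitSphere n → ℝ} (hv : Continuous v)
    (h0 : ∫ x, v x ∂(surfaceMeasure n) = 0) (j : ℕ) :
    powerForm (2 * j) v ≤ zonalMoment n (2 * j) * (2 * j / (2 * j + n)) * sphereL2NormSq v := by
  have hn : (0 : ℝ) < n := by exact_mod_cast NeZero.pos n
  rcases Nat.eq_zero_or_pos j with rfl | hj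
  · simp [powerForm_zero, h0]
  have hj' : (0 : ℝ) < j := by exact_mod_cast hj
  have hA := fun k => zonalMoment_even_pos (n := n) k
  -- This sequence satisfies the comparison of consecutive even forms with equality (up to a factor
  -- it is the form on a harmonic of degree two). Hence the form of power 2k divided by b k is
  -- nondecreasing for k ≥ 1.
  set b : ℕ → ℝ := fun k => zonalMoment n (2 * k) * (2 * k / (2 * k + n)) with hb
  have hbpos : ∀ k, 0 < k → 0 < b k := by
    intro k hk
    have : (0 : ℝ) < k := by exact_mod_cast hk
    have := hA k
    positivity
  have hmono : ∀ k, j ≤ k → powerForm (2 * j) v * b k ≤ powerForm (2 * k) v * b j := by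
    intro k hk
    induction k, hk using Nat.le_induction with
    | base => exact le_rfl
    | succ k hk ih =>
      have hk0 : 0 < k := hj.trans_le hk
      have hk' : (0 : ℝ) < k := by exact_mod_cast hk0
      have h1 := powerForm_le_powerForm_add_two hv h0 k
      have h2 : b (k + 1) * (2 * k * (2 * k + 2 + n)) = b k * ((2 * k + 2) * (2 * k + 1)) := by
        have hr := zonalMoment_rec (n := n) k
        simp only [hb]
        rw [show 2 * (k + 1) = 2 * k + 2 by ring]
        push_cast
        have : (2 * ((k : ℝ) + 1) + n) ≠ 0 := by positivity
        field_simp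
        linear_combination hr
      rw [show 2 * (k + 1) = 2 * k + 2 by ring]
      have hp : (0 : ℝ) < 2 * k * (2 * k + 2 + n) := by positivity
      refine le_of_mul_le_mul_right ?_ hp
      calc powerForm (2 * j) v * b (k + 1) * (2 * k * (2 * k + 2 + n))
          = powerForm (2 * j) v * b k * ((2 * k + 2) * (2 * k + 1)) := by
            rw [mul_assoc, h2, ← mul_assoc]
        _ ≤ powerForm (2 * k) v * b j * ((2 * k + 2) * (2 * k + 1)) := by gcongr
        _ = b j * ((2 * k + 2) * (2 * k + 1) * powerForm (2 * k) v) := by ring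
        _ ≤ b j * (2 * k * (2 * k + 2 + n) * powerForm (2 * k + 2) v) := by
            have := (hbpos j hj).le
            gcongr
        _ = _ := by ring
  -- Schur's bound at a large power 2k exceeds the desired one only by the factor (2k+n)/(2k), which
  -- tends to one.
  have hlim : ∀ k, j ≤ k → powerForm (2 * j) v * (2 * k / (2 * k + n)) ≤ b j * sphereL2NormSq v := by
    intro k hk
    have h1 := hmono k hk
    have h2 := powerForm_even_le hv k
    have h3 : powerForm (2 * k) v * b j ≤ zonalMoment n (2 * k) * sphereL2NormSq v * b j := by
      have := (hbpos j hj).le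
      gcongr
    refine le_of_mul_le_mul_left ?_ (hA k)
    calc _ = powerForm (2 * j) v * b k := by simp only [hb]; ring
      _ ≤ _ := h1.trans h3
      _ = _ := by ring
  have ht : Filter.Tendsto (fun k : ℕ => powerForm (2 * j) v * (2 * (k : ℝ) / (2 * k + n)))
      Filter.atTop (nhds (powerForm (2 * j) v * 1)) := by
    refine Filter.Tendsto.const_mul _ ?_
    have := tendsto_natCast_div_add_atTop (n / 2 : ℝ)
    refine this.congr fun k => ?_
    by_cases hk : (k : ℝ) = 0
    · simp [hk]
    have : (0 : ℝ) < k := lt_of_le_of_ne (by positivity) (Ne.symm hk)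
    field_simp
  rw [mul_one] at ht
  refine le_of_tendsto ht ?_
  filter_upwards [Filter.eventually_ge_atTop j] with k hk using hlim k hk

/-- Orthogonality of v to the coordinates says exactly that each xᵢ v has mean zero, so the even
bound applies to it. On a coordinate function the factor would be (2j+1)/(2j+n); the drop to
2j/(2j+n) is the gap. -/
lemma powerForm_odd_le {v : UnitSphere n → ℝ} (hv : Continuous v)
    (h1 : ∀ i, ∫ x : UnitSphere n, (x : Rn n) i * v x ∂(surfaceMeasure n) = 0) (j : ℕ) :
    powerForm (2 * j + 1) v
      ≤ zonalMoment n (2 * j) * (2 * j / (2 * j + n)) * sphereL2NormSq v := by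
  rw [← sum_powerForm_coord_mul hv, ← sum_sphereL2NormSq_coord_mul hv, Finset.mul_sum]
  exact Finset.sum_le_sum fun i _ => powerForm_even_le_of_mean_zero (by fun_prop) (h1 i) j

end ZonalMoments

/-! ### The binomial series of (1 - t)^(-a). -/

section BinomialKernel

/-- The coefficients of the power series of `(1 - t)⁻ᵃ`. -/
noncomputable def binomialCoeff (a : ℝ) (m : ℕ) : ℝ := ∏ k ∈ Finset.range m, (a + k) / (k + 1)

lemma binomialCoeff_succ (a : ℝ) (m : ℕ) :
    (m + 1) * binomialCoeff a (m + 1) = (a + m) * binomialCoeff a m := by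
  rw [binomialCoeff, Finset.prod_range_succ, ← binomialCoeff]
  have : (m : ℝ) + 1 ≠ 0 := by positivity
  field_simp

lemma binomialCoeff_nonneg {a : ℝ} (ha : 0 ≤ a) (m : ℕ) : 0 ≤ binomialCoeff a m :=
  Finset.prod_nonneg fun k _ => by positivity

lemma binomialCoeff_eq_choose (a : ℝ) (m : ℕ) :
    binomialCoeff a m = Ring.choose (a + m - 1) m := by
  rw [← Ring.multichoose_eq]
  have h : ∀ k : ℕ, (k.factorial : ℝ) * Ring.multichoose a k = (ascPochhammer ℝ k).eval a := by
    intro k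
    rw [← nsmul_eq_mul, Ring.factorial_nsmul_multichoose_eq_ascPochhammer,
      Polynomial.ascPochhammer_smeval_eq_eval]
  have h2 : ∀ k : ℕ, (k.factorial : ℝ) * binomialCoeff a k = (ascPochhammer ℝ k).eval a := by
    intro k
    induction k with
    | zero => simp [binomialCoeff]
    | succ k ih =>
      rw [ascPochhammer_succ_eval, ← ih, Nat.factorial_succ]
      push_cast
      linear_combination (k.factorial : ℝ) * binomialCoeff_succ a k
  have := (h2 m).trans (h m).symm
  exact mul_left_cancel₀ (by positivity) this

lemma hasSum_binomialCoeff (a : ℝ) {t : ℝ} (ht : |t| < 1) :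
    HasSum (fun m => binomialCoeff a m * t ^ m) (1 / (1 - t) ^ a) := by
  have h := (Real.one_div_one_sub_rpow_hasFPowerSeriesOnBall_zero a).hasSum (y := t) (by
    simpa [enorm_eq_nnnorm] using! ht)
  simpa [binomialCoeff_eq_choose, mul_comm] using h

end BinomialKernel

/-! ### Series expansion of the regularized kernel and splitting by parity. -/

section KernelSums

variable {n : ℕ}

lemma abs_inner_sphere_le (x y : UnitSphere n) : |inner ℝ (x : Rn n) (y : Rn n)| ≤ 1 := by
  simpa using abs_real_inner_le_norm (x : Rn n) (y : Rn n)

lemma one_sub_mul_inner_pos {r : ℝ} (hr0 : 0 ≤ r) (hr : r < 1) (x y : UnitSphere n) :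
    0 < 1 - r * inner ℝ (x : Rn n) (y : Rn n) := by
  have := (abs_le.1 (abs_inner_sphere_le x y)).2
  nlinarith

lemma continuous_kernel {a r : ℝ} (hr0 : 0 ≤ r) (hr : r < 1) :
    Continuous fun p : UnitSphere n × UnitSphere n =>
      1 / (1 - r * inner ℝ (p.1 : Rn n) (p.2 : Rn n)) ^ a := by
  have h : ∀ p : UnitSphere n × UnitSphere n, 1 - r * inner ℝ (p.1 : Rn n) (p.2 : Rn n) ≠ 0 :=
    fun p => (one_sub_mul_inner_pos hr0 hr _ _).ne'
  refine Continuous.div continuous_const (Continuous.rpow_const (by fun_prop) fun p => .inl (h p))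
    fun p => ?_
  exact (Real.rpow_pos_of_pos (one_sub_mul_inner_pos hr0 hr _ _) _).ne'

lemma hasSum_kernel {a r : ℝ} (hr0 : 0 ≤ r) (hr : r < 1) (x y : UnitSphere n) :
    HasSum (fun m => binomialCoeff a m * r ^ m * (inner ℝ (x : Rn n) (y : Rn n)) ^ m)
      (1 / (1 - r * inner ℝ (x : Rn n) (y : Rn n)) ^ a) := by
  have h : |r * inner ℝ (x : Rn n) (y : Rn n)| < 1 := by
    rw [abs_mul, abs_of_nonneg hr0]
    nlinarith [abs_inner_sphere_le x y, abs_nonneg (inner ℝ (x : Rn n) (y : Rn n))]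
  simpa [mul_pow, mul_assoc] using hasSum_binomialCoeff a h

/-- Termwise integration of the binomial series of the kernel. -/
lemma hasSum_integral_kernel {α : Type*} [MeasurableSpace α] {μ : Measure α} [IsFiniteMeasure μ]
    {a r C : ℝ} (ha : 0 ≤ a) (hr0 : 0 ≤ r) (hr : r < 1) {X Y : α → UnitSphere n} {g : α → ℝ}
    (hm : ∀ m : ℕ, AEStronglyMeasurable
      (fun p => (inner ℝ (X p : Rn n) (Y p : Rn n)) ^ m * g p) μ)
    (hg : ∀ p, |g p| ≤ C) :
    HasSum (fun m => binomialCoeff a m * r ^ m *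
        ∫ p, (inner ℝ (X p : Rn n) (Y p : Rn n)) ^ m * g p ∂μ)
      (∫ p, 1 / (1 - r * inner ℝ (X p : Rn n) (Y p : Rn n)) ^ a * g p ∂μ) := by
  have hb : ∀ m p, ‖(inner ℝ (X p : Rn n) (Y p : Rn n)) ^ m * g p‖ ≤ C := by
    intro m p
    rw [norm_mul, norm_pow, Real.norm_eq_abs, Real.norm_eq_abs]
    have h1 := pow_le_one₀ (n := m) (abs_nonneg _) (abs_inner_sphere_le (X p) (Y p))
    calc _ ≤ 1 * |g p| := by gcongr
      _ ≤ C := by rw [one_mul]; exact hg p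
  have hi : ∀ m, Integrable (fun p => (inner ℝ (X p : Rn n) (Y p : Rn n)) ^ m * g p) μ :=
    fun m => Integrable.of_bound (hm m) C (Filter.Eventually.of_forall (hb m))
  have hs : Summable fun m => binomialCoeff a m * r ^ m :=
    (hasSum_binomialCoeff a (t := r) (by rwa [abs_of_nonneg hr0])).summable
  have h := hasSum_integral_of_summable_integral_norm (μ := μ)
    (F := fun m p => binomialCoeff a m * r ^ m *
      ((inner ℝ (X p : Rn n) (Y p : Rn n)) ^ m * g p)) (fun m => (hi m).const_mul _) ?_
  · simp only [integral_const_mul] at h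
    have e : ∫ p, 1 / (1 - r * inner ℝ (X p : Rn n) (Y p : Rn n)) ^ a * g p ∂μ
        = ∫ p, ∑' m, binomialCoeff a m * r ^ m *
          ((inner ℝ (X p : Rn n) (Y p : Rn n)) ^ m * g p) ∂μ := by
      congr with p
      have := ((hasSum_kernel (a := a) hr0 hr (X p) (Y p)).mul_right (g p)).tsum_eq
      simp only [← mul_assoc]
      exact this.symm
    rw [e]
    exact h
  · refine Summable.of_nonneg_of_le (fun m => by positivity) (fun m => ?_)
      (hs.mul_right (C * μ.real Set.univ))
    simp only [norm_mul (binomialCoeff a m * r ^ m)]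
    rw [integral_const_mul, Real.norm_of_nonneg (mul_nonneg (binomialCoeff_nonneg ha m)
      (pow_nonneg hr0 m))]
    have := binomialCoeff_nonneg ha m
    gcongr
    refine (integral_mono (hi m).norm (integrable_const C) (hb m)).trans_eq ?_
    simp [mul_comm]

/-- The quadratic form of the kernel `(1 - r x · y)⁻ᵃ`. -/
noncomputable def kernelForm (a r : ℝ) (v : UnitSphere n → ℝ) : ℝ :=
  ∫ p : UnitSphere n × UnitSphere n,
    1 / (1 - r * inner ℝ (p.1 : Rn n) (p.2 : Rn n)) ^ a * (v p.1 * v p.2)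
      ∂((surfaceMeasure n).prod (surfaceMeasure n))

lemma exists_bound_sphere {v : UnitSphere n → ℝ} (hv : Continuous v) :
    ∃ C, 0 ≤ C ∧ ∀ x, |v x| ≤ C := by
  obtain ⟨C, hC⟩ := (isCompact_range hv).isBounded.exists_norm_le
  exact ⟨max C 0, le_max_right _ _, fun x => (hC _ ⟨x, rfl⟩).trans (le_max_left _ _)⟩

lemma hasSum_kernelForm {a r : ℝ} (ha : 0 ≤ a) (hr0 : 0 ≤ r) (hr : r < 1) {v : UnitSphere n → ℝ}
    (hv : Continuous v) :
    HasSum (fun m => binomialCoeff a m * r ^ m * powerForm m v) (kernelForm a r v) := by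
  obtain ⟨C, hC0, hC⟩ := exists_bound_sphere hv
  refine hasSum_integral_kernel (C := C * C) ha hr0 hr (fun m => ?_) fun p => ?_
  · exact (continuous_powerForm_integrand m hv).aestronglyMeasurable
  · rw [abs_mul]
    exact mul_le_mul (hC _) (hC _) (abs_nonneg _) hC0

/-- The part of `v` whose parity is that of `m`. -/
noncomputable def parityPart (m : ℕ) (v : UnitSphere n → ℝ) (x : UnitSphere n) : ℝ :=
  (v x + (-1) ^ m * v (-x)) / 2

lemma continuous_parityPart (m : ℕ) {v : UnitSphere n → ℝ} (hv : Continuous v) :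
    Continuous (parityPart m v) := by
  unfold parityPart
  fun_prop

lemma measurePreserving_neg_sphere :
    MeasurePreserving (fun x : UnitSphere n => -x) (surfaceMeasure n) (surfaceMeasure n) := by
  convert measurePreserving_sphereMap (LinearIsometryEquiv.neg ℝ (E := Rn n)) using 1
  ext x
  simp

lemma measurableEmbedding_neg_sphere : MeasurableEmbedding (fun x : UnitSphere n => -x) := by
  convert measurableEmbedding_sphereMap (LinearIsometryEquiv.neg ℝ (E := Rn n)) using 1
  ext x
  simp

lemma integral_comp_neg_sphere (f : UnitSphere n → ℝ) :
    ∫ x, f (-x) ∂(surfaceMeasure n) = ∫ x, f x ∂(surfaceMeasure n) :=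
  measurePreserving_neg_sphere.integral_comp measurableEmbedding_neg_sphere f

/-- The kernel (x·y)^m has the parity of m in each variable, so it sees only that part of v. Thus
even and odd powers are charged to separate parts of the norm instead of both to all of it. -/
lemma powerForm_parityPart (m : ℕ) {v : UnitSphere n → ℝ} (hv : Continuous v) :
    powerForm m (parityPart m v) = powerForm m v := by
  let k (x y : UnitSphere n) : ℝ := (inner ℝ (x : Rn n) (y : Rn n)) ^ m
  have hk : Continuous fun p : UnitSphere n × UnitSphere n => k p.1 p.2 := by
    simp only [k]; fun_prop
  have hk1 (x y) : k (-x) y = (-1) ^ m * k x y := by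
    simp only [k, coe_neg_sphere, inner_neg_left]; rw [neg_pow]
  have hk2 (x y) : k x (-y) = (-1) ^ m * k x y := by
    simp only [k, coe_neg_sphere, inner_neg_right]; rw [neg_pow]
  have hs : ((-1 : ℝ) ^ m) * (-1) ^ m = 1 := by rw [← mul_pow]; simp
  have iI (f : UnitSphere n × UnitSphere n → ℝ) (hf : Continuous f) := integrable_sphere_prod hf
  have e0 : powerForm m v = ∫ x, ∫ y, k x y * (v x * v y) ∂(surfaceMeasure n) ∂(surfaceMeasure n) :=
    integral_prod _ (iI _ (by fun_prop))
  have e1 : ∫ p : UnitSphere n × UnitSphere n, k p.1 p.2 * (v p.1 * ((-1) ^ m * v (-p.2)))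
      ∂((surfaceMeasure n).prod (surfaceMeasure n)) = powerForm m v := by
    rw [integral_prod _ (iI _ (by fun_prop)), e0]
    congr with x
    rw [← integral_comp_neg_sphere]
    congr with y
    simp only [neg_neg, hk2]
    linear_combination (k x y * v x * v y) * hs
  have e2 : ∫ p : UnitSphere n × UnitSphere n, k p.1 p.2 * ((-1) ^ m * v (-p.1) * v p.2)
      ∂((surfaceMeasure n).prod (surfaceMeasure n)) = powerForm m v := by
    rw [integral_prod _ (iI _ (by fun_prop)), e0, ← integral_comp_neg_sphere]
    congr with x
    congr with y
    simp only [neg_neg, hk1]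
    linear_combination (k x y * v x * v y) * hs
  have e3 : ∫ p : UnitSphere n × UnitSphere n,
      k p.1 p.2 * ((-1) ^ m * v (-p.1) * ((-1) ^ m * v (-p.2)))
      ∂((surfaceMeasure n).prod (surfaceMeasure n)) = powerForm m v := by
    rw [integral_prod _ (iI _ (by fun_prop)), e0, ← integral_comp_neg_sphere]
    congr with x
    rw [← integral_comp_neg_sphere]
    congr with y
    simp only [neg_neg, hk1, hk2]
    linear_combination (k x y * v x * v y) * (hs * ((-1) ^ m * (-1) ^ m) + hs)
  have e4 : powerForm m v = ∫ p : UnitSphere n × UnitSphere n, k p.1 p.2 * (v p.1 * v p.2)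
      ∂((surfaceMeasure n).prod (surfaceMeasure n)) := rfl
  have e5 : powerForm m (parityPart m v) = ∫ p : UnitSphere n × UnitSphere n,
      (((k p.1 p.2 * (v p.1 * v p.2) + k p.1 p.2 * (v p.1 * ((-1) ^ m * v (-p.2))))
        + k p.1 p.2 * ((-1) ^ m * v (-p.1) * v p.2))
        + k p.1 p.2 * ((-1) ^ m * v (-p.1) * ((-1) ^ m * v (-p.2)))) / 4
      ∂((surfaceMeasure n).prod (surfaceMeasure n)) := by
    simp only [powerForm]
    congr with p
    simp only [parityPart, k]
    ring
  rw [e5, integral_div, integral_add (iI _ (by fun_prop)) (iI _ (by fun_prop)),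
    integral_add (iI _ (by fun_prop)) (iI _ (by fun_prop)),
    integral_add (iI _ (by fun_prop)) (iI _ (by fun_prop)), e1, e2, e3, ← e4]
  ring

lemma sphereL2NormSq_parityPart {v : UnitSphere n → ℝ} (hv : Continuous v) :
    sphereL2NormSq (parityPart 0 v) + sphereL2NormSq (parityPart 1 v) = sphereL2NormSq v := by
  have h0 := continuous_parityPart 0 hv
  have h1 := continuous_parityPart 1 hv
  have hn := integral_comp_neg_sphere (fun x => v x ^ 2)
  simp only [sphereL2NormSq]
  rw [← integral_add (integrable_sphere (by fun_prop)) (integrable_sphere (by fun_prop))]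
  have : ∀ x, parityPart 0 v x ^ 2 + parityPart 1 v x ^ 2 = v x ^ 2 / 2 + v (-x) ^ 2 / 2 := by
    intro x
    simp only [parityPart]
    ring
  simp only [this]
  rw [integral_add (integrable_sphere (by fun_prop)) (integrable_sphere (by fun_prop)),
    integral_div, integral_div, hn]
  ring

lemma powerForm_even_le_parityPart [NeZero n] {v : UnitSphere n → ℝ} (hv : Continuous v)
    (h0 : ∫ x, v x ∂(surfaceMeasure n) = 0) (j : ℕ) :
    powerForm (2 * j) v
      ≤ zonalMoment n (2 * j) * (2 * j / (2 * j + n)) * sphereL2NormSq (parityPart 0 v) := by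
  have h : parityPart (2 * j) v = parityPart 0 v := by
    ext x; simp [parityPart]
  rw [← powerForm_parityPart _ hv, h]
  refine powerForm_even_le_of_mean_zero (continuous_parityPart 0 hv) ?_ j
  simp only [parityPart, pow_zero, one_mul]
  rw [integral_div, integral_add (integrable_sphere hv) (integrable_sphere (by fun_prop)),
    integral_comp_neg_sphere v, h0]
  simp

lemma powerForm_odd_le_parityPart [NeZero n] {v : UnitSphere n → ℝ} (hv : Continuous v)
    (h1 : ∀ i, ∫ x : UnitSphere n, (x : Rn n) i * v x ∂(surfaceMeasure n) = 0) (j : ℕ) :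
    powerForm (2 * j + 1) v
      ≤ zonalMoment n (2 * j) * (2 * j / (2 * j + n)) * sphereL2NormSq (parityPart 1 v) := by
  have h : parityPart (2 * j + 1) v = parityPart 1 v := by
    ext x; simp [parityPart, pow_succ]
  rw [← powerForm_parityPart _ hv, h]
  refine powerForm_odd_le (continuous_parityPart 1 hv) (fun i => ?_) j
  have hneg := integral_comp_neg_sphere (fun x : UnitSphere n => (x : Rn n) i * v x)
  have : ∀ x : UnitSphere n, (x : Rn n) i * parityPart 1 v x
      = ((x : Rn n) i * v x + ((-x : UnitSphere n) : Rn n) i * v (-x)) / 2 := by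
    intro x
    simp [parityPart]
    ring
  simp only [this]
  rw [integral_div, integral_add (integrable_sphere (by fun_prop)) (integrable_sphere (by fun_prop)),
    hneg, h1]
  simp

end KernelSums

/-! ### Spectral gap for the kernel (1 - x·y)^(-a). -/

section SpectralGap

variable {n : ℕ}

lemma integral_sq_sub_kernel {a r : ℝ} (hr0 : 0 ≤ r) (hr : r < 1) (e : UnitSphere n)
    {v : UnitSphere n → ℝ} (hv : Continuous v) :
    ∫ p : UnitSphere n × UnitSphere n,
      (v p.1 - v p.2) ^ 2 / (1 - r * inner ℝ (p.1 : Rn n) (p.2 : Rn n)) ^ a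
        ∂((surfaceMeasure n).prod (surfaceMeasure n))
      = 2 * ((∫ y : UnitSphere n, 1 / (1 - r * inner ℝ (e : Rn n) (y : Rn n)) ^ a
          ∂(surfaceMeasure n)) * sphereL2NormSq v - kernelForm a r v) := by
  let k (x y : UnitSphere n) : ℝ := 1 / (1 - r * inner ℝ (x : Rn n) (y : Rn n)) ^ a
  have hk : Continuous fun p : UnitSphere n × UnitSphere n => k p.1 p.2 := continuous_kernel hr0 hr
  have hconst : ∀ x, ∫ y, k x y ∂(surfaceMeasure n) = ∫ y, k e y ∂(surfaceMeasure n) := fun x =>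
    integral_sphere_const (F := fun x y => 1 / (1 - r * inner ℝ x y) ^ a) (by simp) x e
  have hsymm : ∀ x y, k x y = k y x := fun x y => by simp only [k, real_inner_comm]
  have i1 : Integrable (fun p : UnitSphere n × UnitSphere n => k p.1 p.2 * v p.1 ^ 2)
      ((surfaceMeasure n).prod (surfaceMeasure n)) := integrable_sphere_prod (by fun_prop)
  have i2 : Integrable (fun p : UnitSphere n × UnitSphere n => k p.1 p.2 * v p.2 ^ 2)
      ((surfaceMeasure n).prod (surfaceMeasure n)) := integrable_sphere_prod (by fun_prop)
  have i3 : Integrable (fun p : UnitSphere n × UnitSphere n => k p.1 p.2 * (v p.1 * v p.2))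
      ((surfaceMeasure n).prod (surfaceMeasure n)) := integrable_sphere_prod (by fun_prop)
  have e1 : ∫ p : UnitSphere n × UnitSphere n, k p.1 p.2 * v p.1 ^ 2
      ∂((surfaceMeasure n).prod (surfaceMeasure n))
      = (∫ y, k e y ∂(surfaceMeasure n)) * sphereL2NormSq v := by
    rw [integral_prod _ i1]
    simp only [integral_mul_const, hconst, integral_const_mul, sphereL2NormSq]
  have e2 : ∫ p : UnitSphere n × UnitSphere n, k p.1 p.2 * v p.2 ^ 2
      ∂((surfaceMeasure n).prod (surfaceMeasure n))
      = (∫ y, k e y ∂(surfaceMeasure n)) * sphereL2NormSq v := by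
    rw [integral_prod_symm _ i2]
    simp only [integral_mul_const, sphereL2NormSq]
    rw [← integral_const_mul]
    congr with x
    rw [← hconst x]
    simp only [hsymm x]
  have : ∀ p : UnitSphere n × UnitSphere n,
      (v p.1 - v p.2) ^ 2 / (1 - r * inner ℝ (p.1 : Rn n) (p.2 : Rn n)) ^ a
      = (k p.1 p.2 * v p.1 ^ 2 + k p.1 p.2 * v p.2 ^ 2) - 2 * (k p.1 p.2 * (v p.1 * v p.2)) := by
    intro p
    simp only [k]
    ring
  simp only [this]
  rw [integral_sub (by exact i1.add i2) (i3.const_mul 2), integral_add i1 i2, integral_const_mul, e1, e2]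
  simp only [k, kernelForm]
  ring

/-- Here k and p are the values of the kernel on constants and on coordinate functions. Write k = Σ
αⱼ over the even powers and D = Σ αⱼ/(2j+n). The factors 2j/(2j+n) on even powers sum to k - nD. On
odd powers they fall short of the factors (2j+1)/(2j+n), which sum to p, by at least rD in total.
The first conclusion keeps D from being small: once (1-r)k is negligible it reads D ≥ (k-p)/(n-ra).
-/
lemma kernelForm_le_of_orthogonal [NeZero n] {a r : ℝ} (ha : 1 ≤ a) (hr0 : 0 ≤ r) (hr : r < 1)
    (e : UnitSphere n) {v : UnitSphere n → ℝ} (hv : Continuous v)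
    (h0 : ∫ x, v x ∂(surfaceMeasure n) = 0)
    (h1 : ∀ i, ∫ x : UnitSphere n, (x : Rn n) i * v x ∂(surfaceMeasure n) = 0)
    {k p : ℝ} (hk : k = ∫ y : UnitSphere n, 1 / (1 - r * inner ℝ (e : Rn n) (y : Rn n)) ^ a
          ∂(surfaceMeasure n))
    (hp : p = ∫ y : UnitSphere n, 1 / (1 - r * inner ℝ (e : Rn n) (y : Rn n)) ^ a
          * inner ℝ (e : Rn n) (y : Rn n) ∂(surfaceMeasure n)) :
    ∃ D : ℝ, k - p ≤ (n - r * a) * D + (1 - r) * k ∧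
      kernelForm a r v ≤ (k - n * D) * sphereL2NormSq (parityPart 0 v)
        + (p - r * D) * sphereL2NormSq (parityPart 1 v) := by
  have hn : (0 : ℝ) < n := by exact_mod_cast NeZero.pos n
  have ha0 : 0 ≤ a := by linarith
  have hA := fun j => zonalMoment_even_pos (n := n) j
  have hc := fun m => binomialCoeff_nonneg ha0 m
  have hsk : HasSum (fun m => binomialCoeff a m * r ^ m * zonalMoment n m) k := by
    have := hasSum_integral_kernel (μ := surfaceMeasure n) (X := fun _ => e) (Y := fun y => y)
      (g := fun _ => 1) (C := 1) ha0 hr0 hr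
      (fun m => (by fun_prop : Continuous _).aestronglyMeasurable) (by simp)
    simpa only [mul_one, integral_inner_pow, ← hk] using this
  have hsp : HasSum (fun m => binomialCoeff a m * r ^ m * zonalMoment n (m + 1)) p := by
    have := hasSum_integral_kernel (μ := surfaceMeasure n) (X := fun _ => e) (Y := fun y => y)
      (g := fun y : UnitSphere n => inner ℝ (e : Rn n) (y : Rn n)) (C := 1) ha0 hr0 hr
      (fun m => (by fun_prop : Continuous _).aestronglyMeasurable)
      (fun y => abs_inner_sphere_le e y)
    simpa only [← pow_succ, integral_inner_pow, ← hp] using this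
  obtain ⟨α, hα⟩ : ∃ α : ℕ → ℝ, ∀ j, α j =
    binomialCoeff a (2 * j) * r ^ (2 * j) * zonalMoment n (2 * j) := ⟨_, fun _ => rfl⟩
  obtain ⟨β, hβ⟩ : ∃ β : ℕ → ℝ, ∀ j, β j =
    binomialCoeff a (2 * j + 1) * r ^ (2 * j + 1) * zonalMoment n (2 * j) := ⟨_, fun _ => rfl⟩
  have hα0 : ∀ j, 0 ≤ α j := fun j => by
    rw [hα]; have := hc (2 * j); have := (hA j).le; positivity
  have hβ0 : ∀ j, 0 ≤ β j := fun j => by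
    rw [hβ]; have := hc (2 * j + 1); have := (hA j).le; positivity
  have hαβ : ∀ j : ℕ, (2 * (j : ℝ) + 1) * β j = r * (a + 2 * j) * α j := by
    intro j
    have := binomialCoeff_succ a (2 * j)
    push_cast at this
    rw [hα, hβ, pow_succ]
    linear_combination (r ^ (2 * j) * r * zonalMoment n (2 * j)) * this
  -- By the recursion of the binomial coefficients, βⱼ/αⱼ = r(a+2j)/(2j+1) where αⱼ ≠ 0; this is
  -- where a ≥ 1 enters.
  have hαβ' : ∀ j, r * α j ≤ β j := by
    intro j
    have h2 : (0 : ℝ) < 2 * j + 1 := by positivity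
    refine le_of_mul_le_mul_left ?_ h2
    rw [hαβ]
    have := mul_nonneg hr0 (hα0 j)
    nlinarith
  have hden : ∀ j : ℕ, (0 : ℝ) < 2 * j + n := fun j => by positivity
  have sα : HasSum α k := by
    have := ((mul_right_injective₀ (two_ne_zero (α := ℕ))).hasSum_iff
      (f := fun m => binomialCoeff a m * r ^ m * zonalMoment n m) (a := k) ?_).2 hsk
    · exact this.congr_fun fun j => hα j
    intro m hm
    obtain ⟨j, rfl | rfl⟩ := m.even_or_odd'
    · exact absurd ⟨j, rfl⟩ hm
    · rw [zonalMoment_odd, mul_zero]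
  have sp : HasSum (fun j : ℕ => β j * ((2 * j + 1) / (2 * j + n))) p := by
    have hinj : Function.Injective fun j : ℕ => 2 * j + 1 := fun i j h => by
      simpa using h
    have := (hinj.hasSum_iff (f := fun m => binomialCoeff a m * r ^ m * zonalMoment n (m + 1))
      (a := p) ?_).2 hsp
    · convert this using 2 with j
      have hr := zonalMoment_rec (n := n) j
      have := hden j
      rw [Function.comp_apply, hβ]
      field_simp
      rw [show 2 * j + 1 + 1 = 2 * j + 2 by ring]
      linear_combination -(binomialCoeff a (2 * j + 1) * r ^ (2 * j + 1)) * hr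
    · intro m hm
      obtain ⟨j, rfl | rfl⟩ := m.even_or_odd'
      · rw [zonalMoment_odd, mul_zero]
      · exact absurd ⟨j, rfl⟩ hm
  have sD : Summable fun j : ℕ => α j / (2 * j + n) := by
    refine Summable.of_nonneg_of_le (fun j => div_nonneg (hα0 j) (hden j).le) (fun j => ?_)
      sα.summable
    refine div_le_self (hα0 j) ?_
    have : (1 : ℝ) ≤ n := by exact_mod_cast NeZero.one_le
    have : (0 : ℝ) ≤ j := by positivity
    linarith
  refine ⟨∑' j, α j / (2 * j + n), ?_, ?_⟩
  · refine hasSum_le (fun j => ?_) (sα.sub sp)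
      ((sD.hasSum.mul_left (n - r * a)).add (sα.mul_left (1 - r)))
    have h2 : β j * ((2 * j + 1) / (2 * j + n)) = r * (a + 2 * j) * α j / (2 * j + n) := by
      rw [← hαβ]; ring
    rw [h2, ← sub_nonneg]
    have hd := hden j
    have : (n - r * a) * (α j / (2 * j + n)) + (1 - r) * α j
        - (α j - r * (a + 2 * j) * α j / (2 * j + n)) = (1 - r) * n * α j / (2 * j + n) := by
      field_simp
      ring
    rw [this]
    have := hα0 j
    have : 0 ≤ 1 - r := by linarith
    positivity
  · have hF := hasSum_kernelForm ha0 hr0 hr hv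
    have hinj0 : Function.Injective fun j : ℕ => 2 * j := mul_right_injective₀ two_ne_zero
    have hinj1 : Function.Injective fun j : ℕ => 2 * j + 1 := fun i j h => by simpa using h
    have sE := (hF.summable.comp_injective hinj0).hasSum
    have sO := (hF.summable.comp_injective hinj1).hasSum
    rw [hF.unique (sE.even_add_odd sO)]
    have N0 : 0 ≤ sphereL2NormSq (parityPart 0 v) := integral_nonneg fun x => sq_nonneg _
    have N1 : 0 ≤ sphereL2NormSq (parityPart 1 v) := integral_nonneg fun x => sq_nonneg _
    refine add_le_add ?_ ?_
    · refine hasSum_le (fun j => ?_) sE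
        ((sα.sub (sD.hasSum.mul_left (n : ℝ))).mul_right _)
      have h2 := powerForm_even_le_parityPart hv h0 j
      have h3 := mul_nonneg (hc (2 * j)) (pow_nonneg hr0 (2 * j))
      have hd := hden j
      refine (mul_le_mul_of_nonneg_left h2 h3).trans_eq ?_
      rw [hα]
      field_simp
      ring
    · refine hasSum_le (fun j => ?_) sO ((sp.sub (sD.hasSum.mul_left r)).mul_right _)
      have h2 := powerForm_odd_le_parityPart hv h1 j
      have h3 := mul_nonneg (hc (2 * j + 1)) (pow_nonneg hr0 (2 * j + 1))
      have hd := hden j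
      refine (mul_le_mul_of_nonneg_left h2 h3).trans ?_
      rw [← mul_assoc]
      refine mul_le_mul_of_nonneg_right ?_ N1
      have : binomialCoeff a (2 * j + 1) * r ^ (2 * j + 1)
          * (zonalMoment n (2 * j) * (2 * j / (2 * j + n))) = β j * (2 * j / (2 * j + n)) := by
        rw [hβ]; ring
      rw [this, ← sub_nonneg]
      have : β j * ((2 * j + 1) / (2 * j + n)) - r * (α j / (2 * j + n))
          - β j * (2 * j / (2 * j + n)) = (β j - r * α j) / (2 * j + n) := by
        field_simp
        ring
      rw [this]
      exact div_nonneg (sub_nonneg.2 (hαβ' j)) hd.le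

/-- The cone over a point lies in a line, which is null in dimension at least two. -/
lemma surfaceMeasure_singleton (hn : 2 ≤ n) (x : UnitSphere n) : surfaceMeasure n {x} = 0 := by
  open scoped Pointwise in
  rw [Measure.toSphere_apply' _ (measurableSet_singleton x)]
  have hsub : Set.Ioo (0 : ℝ) 1 • (Subtype.val '' ({x} : Set (UnitSphere n)))
      ⊆ ((ℝ ∙ (x : Rn n) : Submodule ℝ (Rn n)) : Set (Rn n)) := by
    rintro _ ⟨r, -, _, ⟨y, rfl, rfl⟩, rfl⟩
    exact Submodule.smul_mem _ _ (Submodule.mem_span_singleton_self _)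
  have h0 : volume ((ℝ ∙ (x : Rn n) : Submodule ℝ (Rn n)) : Set (Rn n)) = 0 := by
    refine Measure.addHaar_submodule _ _ fun h => ?_
    have h2 := finrank_span_singleton (K := ℝ) (v := (x : Rn n)) (by
      intro h
      have := x.2
      simp [h] at this)
    rw [h, finrank_top, finrank_euclideanSpace_fin] at h2
    omega
  rw [measure_mono_null hsub h0, mul_zero]

lemma inner_lt_one_of_ne {x y : UnitSphere n} (h : x ≠ y) : inner ℝ (x : Rn n) (y : Rn n) < 1 := by
  refine lt_of_le_of_ne (abs_le.1 (abs_inner_sphere_le x y)).2 fun h1 => h ?_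
  ext1
  exact (inner_eq_one_iff_of_norm_eq_one (by simp) (by simp)).1 h1

/-- Because 1 - rt ≥ (1-t)/2 for t ≥ -1, one majorant serves all r in dominated convergence as r ↑
1. -/
lemma kernel_le {a r t : ℝ} (ha : 0 ≤ a) (hr0 : 0 ≤ r) (hr : r < 1) (ht : -1 ≤ t) (ht1 : t < 1) :
    1 / (1 - r * t) ^ a ≤ 2 ^ a * (1 / (1 - t) ^ a) := by
  have h1 : 0 < 1 - t := by linarith
  have h2 : (1 - t) / 2 ≤ 1 - r * t := by nlinarith
  calc 1 / (1 - r * t) ^ a ≤ 1 / ((1 - t) / 2) ^ a := by gcongr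
    _ = _ := by
      rw [Real.div_rpow h1.le (by norm_num)]
      field_simp

open Filter Topology

lemma tendsto_kernel {a t : ℝ} (ht1 : t < 1) :
    Tendsto (fun r : ℝ => 1 / (1 - r * t) ^ a) (𝓝[<] 1) (𝓝 (1 / (1 - t) ^ a)) := by
  have h1 : 0 < 1 - t := by linarith
  have : ContinuousAt (fun r : ℝ => 1 / (1 - r * t) ^ a) 1 := by
    refine ContinuousAt.div continuousAt_const (ContinuousAt.rpow_const (by fun_prop)
      (.inl (by simpa using h1.ne'))) ?_
    simpa using (Real.rpow_pos_of_pos h1 a).ne'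
  simpa using this.tendsto.mono_left nhdsWithin_le_nhds

lemma eventually_mem_Ioo : ∀ᶠ r : ℝ in 𝓝[<] 1, 0 < r ∧ r < 1 := Ioo_mem_nhdsLT one_pos

lemma tendsto_integral_sq_sub_kernel {a : ℝ} (ha : 0 ≤ a) {v : UnitSphere n → ℝ}
    (hv : Continuous v)
    (hI : Integrable (fun p : UnitSphere n × UnitSphere n =>
      (v p.1 - v p.2) ^ 2 / (1 - inner ℝ (p.1 : Rn n) (p.2 : Rn n)) ^ a)
      ((surfaceMeasure n).prod (surfaceMeasure n))) :
    Tendsto (fun r : ℝ => ∫ p : UnitSphere n × UnitSphere n,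
      (v p.1 - v p.2) ^ 2 / (1 - r * inner ℝ (p.1 : Rn n) (p.2 : Rn n)) ^ a
        ∂((surfaceMeasure n).prod (surfaceMeasure n))) (𝓝[<] 1)
      (𝓝 (∫ p : UnitSphere n × UnitSphere n,
      (v p.1 - v p.2) ^ 2 / (1 - inner ℝ (p.1 : Rn n) (p.2 : Rn n)) ^ a
        ∂((surfaceMeasure n).prod (surfaceMeasure n)))) := by
  refine tendsto_integral_filter_of_dominated_convergence _ ?_ ?_ (hI.const_mul (2 ^ a)) ?_
  · filter_upwards [eventually_mem_Ioo] with r hr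
    have := continuous_kernel (n := n) (a := a) hr.1.le hr.2
    have h2 : Continuous fun p : UnitSphere n × UnitSphere n => (v p.1 - v p.2) ^ 2
      * (1 / (1 - r * inner ℝ (p.1 : Rn n) (p.2 : Rn n)) ^ a) := by fun_prop
    simpa only [mul_one_div] using h2.aestronglyMeasurable
  · filter_upwards [eventually_mem_Ioo] with r hr
    refine Eventually.of_forall fun p => ?_
    by_cases h : p.1 = p.2
    · simp [h]
    have ht := inner_lt_one_of_ne h
    have hk := kernel_le ha hr.1.le hr.2 (abs_le.1 (abs_inner_sphere_le p.1 p.2)).1 ht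
    have hpos := one_sub_mul_inner_pos hr.1.le hr.2 p.1 p.2
    rw [Real.norm_of_nonneg (div_nonneg (sq_nonneg _) (Real.rpow_nonneg hpos.le _)),
      ← mul_one_div, ← mul_one_div _ ((1 - inner ℝ (p.1 : Rn n) (p.2 : Rn n)) ^ a), mul_left_comm]
    exact mul_le_mul_of_nonneg_left hk (sq_nonneg _)
  · refine Eventually.of_forall fun p => ?_
    by_cases h : p.1 = p.2
    · simp [h]
    simpa only [mul_one_div] using
      (tendsto_kernel (a := a) (inner_lt_one_of_ne h)).const_mul ((v p.1 - v p.2) ^ 2)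

lemma continuous_kernel_right {a r : ℝ} (hr0 : 0 ≤ r) (hr : r < 1) (e : UnitSphere n) :
    Continuous fun y : UnitSphere n => 1 / (1 - r * inner ℝ (e : Rn n) (y : Rn n)) ^ a := by
  have h := (continuous_kernel (n := n) (a := a) hr0 hr).comp
    (Continuous.prodMk_right e)
  exact h

lemma tendsto_integral_one_sub_kernel {a : ℝ} (ha : 0 ≤ a) (e : UnitSphere n)
    (hI : Integrable (fun y : UnitSphere n => (1 - inner ℝ (e : Rn n) (y : Rn n))
      * (1 / (1 - inner ℝ (e : Rn n) (y : Rn n)) ^ a)) (surfaceMeasure n)) :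
    Tendsto (fun r : ℝ => ∫ y : UnitSphere n, (1 - inner ℝ (e : Rn n) (y : Rn n))
      * (1 / (1 - r * inner ℝ (e : Rn n) (y : Rn n)) ^ a) ∂(surfaceMeasure n)) (𝓝[<] 1)
      (𝓝 (∫ y : UnitSphere n, (1 - inner ℝ (e : Rn n) (y : Rn n))
      * (1 / (1 - inner ℝ (e : Rn n) (y : Rn n)) ^ a) ∂(surfaceMeasure n))) := by
  refine tendsto_integral_filter_of_dominated_convergence _ ?_ ?_ (hI.const_mul (2 ^ a)) ?_
  · filter_upwards [eventually_mem_Ioo] with r hr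
    exact (by fun_prop : Continuous fun y : UnitSphere n =>
      1 - inner ℝ (e : Rn n) (y : Rn n)).aestronglyMeasurable.mul
      (continuous_kernel_right hr.1.le hr.2 e).aestronglyMeasurable
  · filter_upwards [eventually_mem_Ioo] with r hr
    refine Eventually.of_forall fun y => ?_
    by_cases h : e = y
    · simp [h]
    have ht := inner_lt_one_of_ne h
    have hk := kernel_le ha hr.1.le hr.2 (abs_le.1 (abs_inner_sphere_le e y)).1 ht
    have hpos := one_sub_mul_inner_pos hr.1.le hr.2 e y
    have h1 : 0 ≤ 1 - inner ℝ (e : Rn n) (y : Rn n) := by linarith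
    rw [Real.norm_of_nonneg (mul_nonneg h1 (by positivity)), mul_left_comm]
    gcongr
  · refine Eventually.of_forall fun y => ?_
    by_cases h : e = y
    · simp [h]
    exact (tendsto_kernel (a := a) (inner_lt_one_of_ne h)).const_mul _

/-- The integral alone may diverge as r ↑ 1. The factor 1-r ≤ 1-rt lowers the exponent to a-1, for
which the kernel has an integrable majorant, and the integrand tends to zero off the pole. -/
lemma tendsto_one_sub_mul_integral_kernel (hn : 2 ≤ n) {a : ℝ} (ha : 1 ≤ a) (e : UnitSphere n)
    (hI : Integrable (fun y : UnitSphere n => (1 - inner ℝ (e : Rn n) (y : Rn n))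
      * (1 / (1 - inner ℝ (e : Rn n) (y : Rn n)) ^ a)) (surfaceMeasure n)) :
    Tendsto (fun r : ℝ => (1 - r) * ∫ y : UnitSphere n,
      1 / (1 - r * inner ℝ (e : Rn n) (y : Rn n)) ^ a ∂(surfaceMeasure n)) (𝓝[<] 1) (𝓝 0) := by
  have hne : ∀ᵐ y ∂(surfaceMeasure n), e ≠ y := by
    have : {y | ¬ e ≠ y} = {e} := by ext y; simp [eq_comm]
    rw [ae_iff, this]
    exact surfaceMeasure_singleton hn e
  have key : Tendsto (fun r : ℝ => ∫ y : UnitSphere n,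
      (1 - r) * (1 / (1 - r * inner ℝ (e : Rn n) (y : Rn n)) ^ a) ∂(surfaceMeasure n)) (𝓝[<] 1)
      (𝓝 (∫ _ : UnitSphere n, 0 ∂(surfaceMeasure n))) := by
    refine tendsto_integral_filter_of_dominated_convergence _ ?_ ?_ (hI.const_mul (2 ^ (a - 1))) ?_
    · filter_upwards [eventually_mem_Ioo] with r hr
      exact (continuous_kernel_right hr.1.le hr.2 e).aestronglyMeasurable.const_mul _
    · filter_upwards [eventually_mem_Ioo] with r hr
      filter_upwards [hne] with y h
      have ht := inner_lt_one_of_ne h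
      set t := inner ℝ (e : Rn n) (y : Rn n)
      have ht' : -1 ≤ t := (abs_le.1 (abs_inner_sphere_le e y)).1
      have hk := kernel_le (a := a - 1) (by linarith) hr.1.le hr.2 ht' ht
      have hpos : 0 < 1 - r * t := one_sub_mul_inner_pos hr.1.le hr.2 e y
      have h1 : 0 < 1 - t := by linarith
      have h2 : 1 - r ≤ 1 - r * t := by nlinarith [hr.1]
      have e1 : ∀ z : ℝ, 0 < z → z * (1 / z ^ a) = 1 / z ^ (a - 1) := by
        intro z hz
        rw [Real.rpow_sub_one hz.ne']
        field_simp
      rw [Real.norm_of_nonneg (mul_nonneg (by linarith [hr.2]) (by positivity)), e1 _ h1]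
      refine le_trans ?_ hk
      rw [← e1 _ hpos]
      gcongr
    · filter_upwards [hne] with y h
      have h1 := tendsto_kernel (a := a) (inner_lt_one_of_ne h)
      have h2 : Tendsto (fun r : ℝ => 1 - r) (𝓝[<] 1) (𝓝 0) := by
        have : Tendsto (fun r : ℝ => 1 - r) (𝓝 1) (𝓝 (1 - 1)) := by
          exact (continuous_const.sub continuous_id).tendsto _
        simpa using this.mono_left nhdsWithin_le_nhds
      simpa using h2.mul h1
  simpa [integral_const_mul] using key

/-- Spectral gap for functions orthogonal to the affine functions. -/
lemma spectral_gap_kernel [NeZero n] (hn : 2 ≤ n) {a : ℝ} (ha : 1 ≤ a) (han : a < n) (han' : (n : ℝ) ≤ 2 * a)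
    (e : UnitSphere n) {v : UnitSphere n → ℝ} (hv : Continuous v)
    (h0 : ∫ x, v x ∂(surfaceMeasure n) = 0)
    (h1 : ∀ i, ∫ x : UnitSphere n, (x : Rn n) i * v x ∂(surfaceMeasure n) = 0)
    (hQ : Integrable (fun p : UnitSphere n × UnitSphere n =>
      (v p.1 - v p.2) ^ 2 / (1 - inner ℝ (p.1 : Rn n) (p.2 : Rn n)) ^ a)
      ((surfaceMeasure n).prod (surfaceMeasure n)))
    (hI : Integrable (fun y : UnitSphere n => (1 - inner ℝ (e : Rn n) (y : Rn n))
      * (1 / (1 - inner ℝ (e : Rn n) (y : Rn n)) ^ a)) (surfaceMeasure n)) :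
    2 * (1 + 2 / n) * (∫ y : UnitSphere n, (1 - inner ℝ (e : Rn n) (y : Rn n))
      * (1 / (1 - inner ℝ (e : Rn n) (y : Rn n)) ^ a) ∂(surfaceMeasure n)) * sphereL2NormSq v
      ≤ ∫ p : UnitSphere n × UnitSphere n,
      (v p.1 - v p.2) ^ 2 / (1 - inner ℝ (p.1 : Rn n) (p.2 : Rn n)) ^ a
        ∂((surfaceMeasure n).prod (surfaceMeasure n)) := by
  have hn0 : (0 : ℝ) < n := by exact_mod_cast NeZero.pos n
  obtain ⟨ℓ, hℓ⟩ : ∃ ℓ, ℓ = ∫ y : UnitSphere n, (1 - inner ℝ (e : Rn n) (y : Rn n))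
      * (1 / (1 - inner ℝ (e : Rn n) (y : Rn n)) ^ a) ∂(surfaceMeasure n) := ⟨_, rfl⟩
  rw [← hℓ]
  have hℓ0 : 0 ≤ ℓ := hℓ ▸ integral_nonneg fun y => by
    have := (abs_le.1 (abs_inner_sphere_le e y)).2
    have : 0 ≤ 1 - inner ℝ (e : Rn n) (y : Rn n) := by linarith
    positivity
  have hN := sphereL2NormSq_parityPart hv
  have hN0 : 0 ≤ sphereL2NormSq (parityPart 0 v) := integral_nonneg fun x => sq_nonneg _
  have hN1 : 0 ≤ sphereL2NormSq (parityPart 1 v) := integral_nonneg fun x => sq_nonneg _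
  have hle1 := fun r (hr : 0 < r ∧ r < 1) =>
    kernelForm_le_of_orthogonal (a := a) ha hr.1.le hr.2 e hv h0 h1 rfl rfl
  generalize sphereL2NormSq (parityPart 0 v) = N0 at *
  generalize sphereL2NormSq (parityPart 1 v) = N1 at *
  obtain ⟨k, hk⟩ : ∃ k : ℝ → ℝ, ∀ r, k r = ∫ y : UnitSphere n,
    1 / (1 - r * inner ℝ (e : Rn n) (y : Rn n)) ^ a ∂(surfaceMeasure n) := ⟨_, fun _ => rfl⟩
  obtain ⟨l, hl⟩ : ∃ l : ℝ → ℝ, ∀ r, l r = ∫ y : UnitSphere n,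
    (1 - inner ℝ (e : Rn n) (y : Rn n)) * (1 / (1 - r * inner ℝ (e : Rn n) (y : Rn n)) ^ a)
      ∂(surfaceMeasure n) := ⟨_, fun _ => rfl⟩
  -- A lower bound for the number D of `kernelForm_le_of_orthogonal`. Unlike D, it has a visible
  -- limit as r ↑ 1, namely ℓ/(n-a).
  obtain ⟨L, hL⟩ : ∃ L : ℝ → ℝ, ∀ r, L r = (l r - (1 - r) * k r) / (n - r * a) :=
    ⟨_, fun _ => rfl⟩
  have tl : Tendsto l (𝓝[<] 1) (𝓝 ℓ) :=
    hℓ ▸ (tendsto_integral_one_sub_kernel (by linarith) e hI).congr fun r => (hl r).symm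
  have tk : Tendsto (fun r => (1 - r) * k r) (𝓝[<] 1) (𝓝 0) :=
    (tendsto_one_sub_mul_integral_kernel hn ha e hI).congr fun r => by rw [hk]
  have tid : Tendsto (fun r : ℝ => r) (𝓝[<] 1) (𝓝 1) := tendsto_id.mono_left nhdsWithin_le_nhds
  have tL : Tendsto L (𝓝[<] 1) (𝓝 ((ℓ - 0) / (n - 1 * a))) :=
    ((tl.sub tk).div (tendsto_const_nhds.sub (tid.mul_const a)) (by linarith)).congr
      fun r => (hL r).symm
  have hle : ∀ᶠ r in 𝓝[<] (1 : ℝ), 2 * (n * L r * N0 + (l r + r * L r) * N1)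
      ≤ ∫ p : UnitSphere n × UnitSphere n,
      (v p.1 - v p.2) ^ 2 / (1 - r * inner ℝ (p.1 : Rn n) (p.2 : Rn n)) ^ a
        ∂((surfaceMeasure n).prod (surfaceMeasure n)) := by
    filter_upwards [eventually_mem_Ioo] with r hr
    rw [integral_sq_sub_kernel hr.1.le hr.2 e hv]
    obtain ⟨D, hD1, hD2⟩ := hle1 r hr
    rw [← hk] at hD1 hD2 ⊢
    obtain ⟨p, hp⟩ : ∃ p, p = ∫ y : UnitSphere n, 1 / (1 - r * inner ℝ (e : Rn n) (y : Rn n)) ^ a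
          * inner ℝ (e : Rn n) (y : Rn n) ∂(surfaceMeasure n) := ⟨_, rfl⟩
    rw [← hp] at hD1 hD2
    have hlkp : l r = k r - p := by
      have i1 : Integrable (fun y : UnitSphere n =>
          1 / (1 - r * inner ℝ (e : Rn n) (y : Rn n)) ^ a) (surfaceMeasure n) :=
        integrable_sphere (continuous_kernel_right hr.1.le hr.2 e)
      have i2 : Integrable (fun y : UnitSphere n =>
          1 / (1 - r * inner ℝ (e : Rn n) (y : Rn n)) ^ a * inner ℝ (e : Rn n) (y : Rn n))
          (surfaceMeasure n) :=
        integrable_sphere ((continuous_kernel_right hr.1.le hr.2 e).mul (by fun_prop))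
      rw [hl, hk, hp, ← integral_sub i1 i2]
      congr with y
      ring
    have hden : 0 < n - r * a := by nlinarith [hr.1, hr.2]
    have hLD : L r ≤ D := by
      rw [hL, div_le_iff₀ hden, hlkp]
      linarith
    rw [← hN, hlkp]
    have e1 : n * L r * N0 ≤ n * D * N0 := by gcongr
    have e2 : r * L r * N1 ≤ r * D * N1 := by
      have := hr.1.le
      gcongr
    linarith
  have hlim := le_of_tendsto_of_tendsto
    ((((tL.const_mul (n : ℝ)).mul_const N0).add ((tl.add (tid.mul tL)).mul_const N1)).const_mul 2)
    (tendsto_integral_sq_sub_kernel (by linarith) hv hQ) hle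
  refine le_trans ?_ hlim
  rw [← hN]
  have hna : 0 < n - a := by linarith
  -- In the limit the even part of v gains nX and the odd part ℓ + X, with X = ℓ/(n-a) ≥ 2ℓ/n
  -- because n ≤ 2a. Both are at least (1+2/n)ℓ when n ≥ 2.
  have hX : 2 / n * ℓ ≤ (ℓ - 0) / (n - 1 * a) := by
    rw [sub_zero, one_mul, div_mul_eq_mul_div]
    rw [div_le_div_iff₀ hn0 hna]
    nlinarith
  have hn2 : (2 : ℝ) ≤ n := by exact_mod_cast hn
  have h2n : 2 / (n : ℝ) ≤ 1 := by rw [div_le_one hn0]; exact hn2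
  generalize (ℓ - 0) / (n - 1 * a) = X at *
  have e1 : (1 + 2 / n) * ℓ ≤ n * X := by
    calc (1 + 2 / n) * ℓ ≤ 2 * ℓ := by nlinarith
      _ = n * (2 / n * ℓ) := by field_simp
      _ ≤ n * X := by gcongr
  have e2 : (1 + 2 / n) * ℓ ≤ ℓ + 1 * X := by linarith
  nlinarith [mul_le_mul_of_nonneg_right e1 hN0, mul_le_mul_of_nonneg_right e2 hN1]

end SpectralGap

/-! ### The perimeter in polar coordinates and its symmetrization. -/

section RadialKernel

open Set

variable {n : ℕ}

/-- The kernel of the `s`-perimeter in polar coordinates. -/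
noncomputable def radialKernel (s : ℝ) (x y : Rn n) (r ρ : ℝ) : ℝ≥0∞ :=
  ENNReal.ofReal (r ^ (n - 1)) *
    (ENNReal.ofReal (ρ ^ (n - 1)) * ENNReal.ofReal (1 / ‖r • x - ρ • y‖ ^ ((n : ℝ) + s)))

/-- The integral of the radial kernel over a rectangle. -/
noncomputable def radialIntegral (s : ℝ) (x y : Rn n) (A B : Set ℝ) : ℝ≥0∞ :=
  ∫⁻ r in A, ∫⁻ ρ in B, radialKernel s x y r ρ

lemma measurable_radialKernel (s : ℝ) :
    Measurable fun p : (Rn n × Rn n) × ℝ × ℝ => radialKernel s p.1.1 p.1.2 p.2.1 p.2.2 := by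
  unfold radialKernel
  fun_prop

lemma measurable_radialKernel_comp (s : ℝ) {α : Type*} [MeasurableSpace α] {f g : α → Rn n}
    {r ρ : α → ℝ} (hf : Measurable f) (hg : Measurable g) (hr : Measurable r) (hρ : Measurable ρ) :
    Measurable fun p => radialKernel s (f p) (g p) (r p) (ρ p) :=
  (measurable_radialKernel s).comp ((hf.prodMk hg).prodMk (hr.prodMk hρ))

lemma measurable_lintegral_set {α : Type*} [MeasurableSpace α] {f : α → ℝ → ℝ≥0∞}
    (hf : Measurable (Function.uncurry f)) {A : α → Set ℝ}
    (hA : MeasurableSet {p : α × ℝ | p.2 ∈ A p.1}) :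
    Measurable fun p => ∫⁻ r in A p, f p r := by
  have h : ∀ p, MeasurableSet (A p) := fun p => measurable_prodMk_left hA
  have e : (fun p => ∫⁻ r in A p, f p r)
      = fun p => ∫⁻ r, {p : α × ℝ | p.2 ∈ A p.1}.indicator (Function.uncurry f) (p, r) := by
    ext p
    rw [← lintegral_indicator (h p)]
    rfl
  rw [e]
  exact (hf.indicator hA).lintegral_prod_right'

lemma measurable_radialIntegral (s : ℝ) {α : Type*} [MeasurableSpace α] {f g : α → Rn n}
    (hf : Measurable f) (hg : Measurable g) {A B : α → Set ℝ}
    (hA : MeasurableSet {p : α × ℝ | p.2 ∈ A p.1}) (hB : MeasurableSet {p : α × ℝ | p.2 ∈ B p.1}) :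
    Measurable fun p => radialIntegral s (f p) (g p) (A p) (B p) := by
  refine measurable_lintegral_set (f := fun p r => ∫⁻ ρ in B p, radialKernel s (f p) (g p) r ρ)
    ?_ hA
  refine measurable_lintegral_set (α := α × ℝ)
    (f := fun q ρ => radialKernel s (f q.1) (g q.1) q.2 ρ) (A := fun q => B q.1) ?_ ?_
  · exact measurable_radialKernel_comp s (by fun_prop) (by fun_prop) (by fun_prop) (by fun_prop)
  · have : Measurable fun q : (α × ℝ) × ℝ => (q.1.1, q.2) := by fun_prop
    exact this hB

/-- The `s`-perimeter of a star-shaped set with radial function `R`, in polar coordinates. -/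
lemma sPerimeter_eq_lintegral_radialIntegral [NeZero n] (s : ℝ) {E : Set (Rn n)}
    (hE : MeasurableSet E) {R : UnitSphere n → ℝ} (hR : Measurable R) (hR0 : ∀ x, 0 < R x)
    (hER : ∀ (x : UnitSphere n) (r : ℝ), 0 < r → (r • (x : Rn n) ∈ E ↔ r < R x)) :
    sPerimeter s E = ∫⁻ x : UnitSphere n, ∫⁻ y : UnitSphere n,
      radialIntegral s (x : Rn n) y (Ioo 0 (R x)) (Ici (R y))
        ∂(surfaceMeasure n) ∂(surfaceMeasure n) := by
  let k (z w : Rn n) : ℝ≥0∞ := ENNReal.ofReal (1 / ‖z - w‖ ^ ((n : ℝ) + s))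
  have hk : Measurable (Function.uncurry k) := by
    simp only [k, Function.uncurry_def]
    fun_prop
  have hinner : ∀ z, ∫⁻ w in Eᶜ, k z w = ∫⁻ y : UnitSphere n, ∫⁻ ρ in Ici (R y),
      ENNReal.ofReal (ρ ^ (n - 1)) * k z (ρ • (y : Rn n)) ∂volume ∂(surfaceMeasure n) := by
    intro z
    rw [← lintegral_indicator hE.compl,
      lintegral_polar ((hk.of_uncurry_left (x := z)).indicator hE.compl)]
    congr with y
    have hsub : Ici (R y) ⊆ Ioi 0 := fun ρ hρ => (hR0 y).trans_le hρ
    rw [← inter_eq_left.2 hsub, ← setLIntegral_indicator measurableSet_Ici]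
    refine setLIntegral_congr_fun measurableSet_Ioi fun ρ hρ => ?_
    by_cases h : R y ≤ ρ
    · rw [indicator_of_mem (show ρ ∈ Ici (R y) from h), indicator_of_mem]
      simp only [mem_compl_iff, hER y ρ hρ, not_lt, h]
    · rw [indicator_of_notMem (show ρ ∉ Ici (R y) from h), indicator_of_notMem, mul_zero]
      simp only [mem_compl_iff, hER y ρ hρ, not_not]
      exact not_le.1 h
  have hmeas : Measurable fun z => ∫⁻ w in Eᶜ, k z w := hk.lintegral_prod_right'
  have houter : sPerimeter s E = ∫⁻ x : UnitSphere n, ∫⁻ r in Ioo 0 (R x),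
      ENNReal.ofReal (r ^ (n - 1)) * (∫⁻ w in Eᶜ, k (r • (x : Rn n)) w)
        ∂volume ∂(surfaceMeasure n) := by
    rw [sPerimeter, ← lintegral_indicator hE, lintegral_polar (hmeas.indicator hE)]
    congr with x
    have hI : Ioo 0 (R x) = Iio (R x) ∩ Ioi 0 := by ext; simp [and_comm]
    rw [hI, ← setLIntegral_indicator measurableSet_Iio]
    refine setLIntegral_congr_fun measurableSet_Ioi fun r hr => ?_
    by_cases h : r < R x
    · rw [indicator_of_mem (show r ∈ Iio (R x) from h), indicator_of_mem]
      rwa [hER x r hr]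
    · rw [indicator_of_notMem (show r ∉ Iio (R x) from h), indicator_of_notMem, mul_zero]
      rwa [hER x r hr]
  rw [houter]
  congr with x
  have hswap := lintegral_lintegral_swap (μ := volume.restrict (Ioo 0 (R x)))
    (ν := surfaceMeasure n)
    (f := fun r y => ∫⁻ ρ in Ici (R y), radialKernel s (x : Rn n) y r ρ) (by
      refine Measurable.aemeasurable ?_
      refine measurable_lintegral_set (α := ℝ × UnitSphere n)
        (f := fun q ρ => radialKernel s (x : Rn n) q.2 q.1 ρ) (A := fun q => Ici (R q.2)) ?_ ?_
      · exact measurable_radialKernel_comp s (by fun_prop) (by fun_prop) (by fun_prop)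
          (by fun_prop)
      · exact measurableSet_le (f := fun p : (ℝ × UnitSphere n) × ℝ => R p.1.2) (by fun_prop)
          measurable_snd)
  simp only [radialIntegral]
  rw [← hswap]
  congr with r
  rw [hinner, ← lintegral_const_mul' _ _ ENNReal.ofReal_ne_top]
  congr with y
  rw [← lintegral_const_mul' _ _ ENNReal.ofReal_ne_top]
  rfl

/-- The distance splits into a radial and an angular part and depends on x, y only through |x-y|.
Hence the kernel is symmetric in the directions, and it is comparable with its value at radii one.
-/
lemma norm_smul_sub_smul_sq (x y : UnitSphere n) (r ρ : ℝ) :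
    ‖r • (x : Rn n) - ρ • (y : Rn n)‖ ^ 2
      = (r - ρ) ^ 2 + r * ρ * ‖(x : Rn n) - (y : Rn n)‖ ^ 2 := by
  rw [@norm_sub_sq_real, @norm_sub_sq_real]
  simp [norm_smul, inner_smul_left, inner_smul_right]
  ring

lemma radialKernel_comm (s : ℝ) (x y : UnitSphere n) (r ρ : ℝ) :
    radialKernel s (x : Rn n) y r ρ = radialKernel s (y : Rn n) x r ρ := by
  have : ‖r • (x : Rn n) - ρ • (y : Rn n)‖ = ‖r • (y : Rn n) - ρ • (x : Rn n)‖ := by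
    rw [← sq_eq_sq₀ (norm_nonneg _) (norm_nonneg _), norm_smul_sub_smul_sq, norm_smul_sub_smul_sq,
      norm_sub_rev (x : Rn n)]
  simp only [radialKernel, this]

lemma radialIntegral_comm (s : ℝ) (x y : UnitSphere n) (A B : Set ℝ) :
    radialIntegral s (x : Rn n) y A B = radialIntegral s (y : Rn n) x A B := by
  simp only [radialIntegral, radialKernel_comm s x y]

lemma radialIntegral_union_left (s : ℝ) (x y : Rn n) {A A' : Set ℝ} (B : Set ℝ)
    (hA' : MeasurableSet A') (h : Disjoint A A') :
    radialIntegral s x y (A ∪ A') B = radialIntegral s x y A B + radialIntegral s x y A' B :=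
  lintegral_union hA' h

lemma radialIntegral_union_right (s : ℝ) (x y : Rn n) (A : Set ℝ) {B B' : Set ℝ}
    (hB' : MeasurableSet B') (h : Disjoint B B') :
    radialIntegral s x y A (B ∪ B') = radialIntegral s x y A B + radialIntegral s x y A B' := by
  simp only [radialIntegral]
  rw [← lintegral_add_left]
  · congr with r
    exact lintegral_union hB' h
  · exact (measurable_radialKernel_comp s (f := fun _ : ℝ × ℝ => x) (g := fun _ => y)
      (r := Prod.fst) (ρ := Prod.snd) (by fun_prop) (by fun_prop) (by fun_prop)
      (by fun_prop)).lintegral_prod_right'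

/-- The square with vertices on the diagonal determined by two radii. -/
noncomputable def radialSquare (s : ℝ) (x y : Rn n) (a b : ℝ) : ℝ≥0∞ :=
  radialIntegral s x y (Ico (min a b) (max a b)) (Ico (min a b) (max a b))

/-- For a ≤ b, cut [a,∞) at b and (0,b) at a. Both sides then consist of the same rectangles, with
[a,b)² as the extra piece. Only additivity is used, so infinite values are harmless. -/
lemma radialIntegral_symmetrize (s : ℝ) (x y : Rn n) {a b : ℝ} (ha : 0 < a) (hb : 0 < b) :
    radialIntegral s x y (Ioo 0 a) (Ici b) + radialIntegral s x y (Ioo 0 b) (Ici a)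
      = radialIntegral s x y (Ioo 0 a) (Ici a) + radialIntegral s x y (Ioo 0 b) (Ici b)
        + radialSquare s x y a b := by
  wlog h : a ≤ b generalizing a b
  · have := this hb ha (le_of_not_ge h)
    rw [add_comm, this, radialSquare, radialSquare, min_comm, max_comm]
    ring
  rw [radialSquare, min_eq_left h, max_eq_right h]
  have e1 : Ici a = Ici b ∪ Ico a b := by
    ext t; simp only [mem_Ici, mem_union, mem_Ico]
    constructor
    · intro ht; rcases le_or_gt b t with h | h
      · exact .inl h
      · exact .inr ⟨ht, h⟩
    · rintro (h' | h')
      · exact h.trans h'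
      · exact h'.1
  have e2 : Ioo 0 b = Ioo 0 a ∪ Ico a b := by
    ext t; simp only [mem_Ioo, mem_union, mem_Ico]
    constructor
    · intro ht; rcases le_or_gt a t with h | h
      · exact .inr ⟨h, ht.2⟩
      · exact .inl ⟨ht.1, h⟩
    · rintro (h' | h')
      · exact ⟨h'.1, h'.2.trans_le h⟩
      · exact ⟨ha.trans_le h'.1, h'.2⟩
  have d1 : Disjoint (Ici b) (Ico a b) :=
    Set.disjoint_left.2 fun t ht ht' => absurd ht'.2 (not_lt.2 ht)
  have d2 : Disjoint (Ioo 0 a) (Ico a b) :=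
    Set.disjoint_left.2 fun t ht ht' => absurd ht.2 (not_lt.2 ht'.1)
  have hm := measurableSet_Ico (a := a) (b := b)
  rw [e1, radialIntegral_union_right s x y _ hm d1, radialIntegral_union_right s x y _ hm d1, e2,
    radialIntegral_union_left s x y _ hm d2, radialIntegral_union_left s x y _ hm d2]
  ring

lemma lintegral_scale {a : ℝ} (ha : 0 < a) (f : ℝ → ℝ≥0∞) :
    ∫⁻ r, f r = ENNReal.ofReal a * ∫⁻ r, f (a * r) := by
  have h := Real.smul_map_volume_mul_left ha.ne'
  conv_lhs => rw [← h]
  rw [lintegral_smul_measure, abs_of_pos ha, smul_eq_mul]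
  congr 1
  exact (Homeomorph.mulLeft₀ a ha.ne').measurableEmbedding.lintegral_map f

lemma setLIntegral_scale {a : ℝ} (ha : 0 < a) {A : Set ℝ} (hA : MeasurableSet A)
    (f : ℝ → ℝ≥0∞) :
    ∫⁻ r in A, f r = ENNReal.ofReal a * ∫⁻ r in (a * ·) ⁻¹' A, f (a * r) := by
  rw [← lintegral_indicator hA, lintegral_scale ha,
    ← lintegral_indicator ((measurable_const_mul a) hA)]
  rfl

/-- Homogeneity count: two line elements, two weights of degree n-1 and a kernel of degree -(n+s)
give n-s. -/
lemma radialKernel_scale (hn : 1 ≤ n) (s : ℝ) (x y : Rn n) {a r ρ : ℝ} (ha : 0 < a) (hr : 0 ≤ r)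
    (hρ : 0 ≤ ρ) : ENNReal.ofReal a * (ENNReal.ofReal a * radialKernel s x y (a * r) (a * ρ))
      = ENNReal.ofReal (a ^ ((n : ℝ) - s)) * radialKernel s x y r ρ := by
  simp only [radialKernel]
  rw [← ENNReal.ofReal_mul (by positivity), ← ENNReal.ofReal_mul (by positivity),
    ← ENNReal.ofReal_mul (by positivity), ← ENNReal.ofReal_mul (by positivity),
    ← ENNReal.ofReal_mul (by positivity), ← ENNReal.ofReal_mul (by positivity),
    ← ENNReal.ofReal_mul (by positivity)]
  congr 1
  rw [mul_smul, mul_smul, ← smul_sub, norm_smul, Real.norm_of_nonneg ha.le,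
    Real.mul_rpow ha.le (norm_nonneg _)]
  have e : a * a * a ^ (n - 1) * a ^ (n - 1) = a ^ ((n : ℝ) - s) * a ^ ((n : ℝ) + s) := by
    rw [← Real.rpow_add ha, show (n : ℝ) - s + (n + s) = ((2 * n : ℕ) : ℝ) by push_cast; ring,
      Real.rpow_natCast]
    obtain ⟨k, rfl⟩ := Nat.exists_eq_add_of_le' hn
    rw [Nat.add_sub_cancel]
    ring
  have h0 : a ^ ((n : ℝ) + s) ≠ 0 := (Real.rpow_pos_of_pos ha _).ne'
  rw [one_div, mul_inv, mul_pow, mul_pow, one_div]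
  field_simp
  linear_combination (r ^ (n - 1) * ρ ^ (n - 1) * (‖r • x - ρ • y‖ ^ ((n : ℝ) + s))⁻¹) * e

lemma radialIntegral_scale (hn : 1 ≤ n) (s : ℝ) (x y : Rn n) {a : ℝ} (ha : 0 < a) :
    radialIntegral s x y (Ioo 0 a) (Ici a)
      = ENNReal.ofReal (a ^ ((n : ℝ) - s)) * radialIntegral s x y (Ioo 0 1) (Ici 1) := by
  have e1 : (a * ·) ⁻¹' Ioo 0 a = Ioo 0 1 := by
    ext t
    simp only [mem_preimage, mem_Ioo, mul_pos_iff_of_pos_left ha, mul_lt_iff_lt_one_right ha]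
  have e2 : (a * ·) ⁻¹' Ici a = Ici 1 := by
    ext t
    simp only [mem_preimage, mem_Ici, le_mul_iff_one_le_right ha]
  simp only [radialIntegral]
  rw [setLIntegral_scale ha measurableSet_Ioo, e1, ← lintegral_const_mul' _ _ ENNReal.ofReal_ne_top,
    ← lintegral_const_mul' _ _ ENNReal.ofReal_ne_top]
  refine setLIntegral_congr_fun measurableSet_Ioo fun r hr => ?_
  rw [setLIntegral_scale ha measurableSet_Ici, e2, ← lintegral_const_mul' _ _ ENNReal.ofReal_ne_top,
    ← lintegral_const_mul' _ _ ENNReal.ofReal_ne_top, ← lintegral_const_mul' _ _ ENNReal.ofReal_ne_top]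
  refine setLIntegral_congr_fun measurableSet_Ici fun ρ hρ => ?_
  exact radialKernel_scale hn s x y ha hr.1.le (zero_le_one.trans hρ)

/-- The `s`-perimeter of the unit ball per unit of surface. -/
noncomputable def perimeterDensity (n : ℕ) [NeZero n] (s : ℝ) : ℝ≥0∞ :=
  ∫⁻ y : UnitSphere n, radialIntegral s (EuclideanSpace.single (0 : Fin n) (1 : ℝ)) (y : Rn n)
    (Ioo 0 1) (Ici 1) ∂(surfaceMeasure n)

lemma lintegral_radialIntegral_one [NeZero n] (s : ℝ) (x : UnitSphere n) :
    ∫⁻ y : UnitSphere n, radialIntegral s (x : Rn n) (y : Rn n) (Ioo 0 1) (Ici 1)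
      ∂(surfaceMeasure n) = perimeterDensity n s := by
  refine lintegral_sphere_const (F := fun x y => radialIntegral s x y (Ioo 0 1) (Ici 1)) ?_ x
    ⟨EuclideanSpace.single (0 : Fin n) (1 : ℝ), by simp⟩
  intro e x y
  simp only [radialIntegral, radialKernel]
  congr! 7 with r ρ
  rw [← map_smul, ← map_smul, ← map_sub, LinearIsometryEquiv.norm_map]

lemma lintegral_add_add {α : Type*} [MeasurableSpace α] {μ : Measure α} {f g : α → ℝ≥0∞}
    (hf : Measurable f) (hg : Measurable g) (h : α → ℝ≥0∞) :
    ∫⁻ x, (f x + g x + h x) ∂μ = ∫⁻ x, f x ∂μ + ∫⁻ x, g x ∂μ + ∫⁻ x, h x ∂μ := by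
  rw [lintegral_add_left (f := fun x => f x + g x) (hf.add hg), lintegral_add_left hf]

/-- The `s`-perimeter of a star-shaped set as a bulk term and a boundary interaction. -/
lemma two_mul_sPerimeter [NeZero n] (s : ℝ) {E : Set (Rn n)}
    (hE : MeasurableSet E) {R : UnitSphere n → ℝ} (hR : Measurable R) (hR0 : ∀ x, 0 < R x)
    (hER : ∀ (x : UnitSphere n) (r : ℝ), 0 < r → (r • (x : Rn n) ∈ E ↔ r < R x)) :
    2 * sPerimeter s E
      = 2 * ((∫⁻ x, ENNReal.ofReal (R x ^ ((n : ℝ) - s)) ∂(surfaceMeasure n))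
          * perimeterDensity n s)
        + ∫⁻ x : UnitSphere n, ∫⁻ y : UnitSphere n, radialSquare s (x : Rn n) y (R x) (R y)
          ∂(surfaceMeasure n) ∂(surfaceMeasure n) := by
  have hn : 1 ≤ n := NeZero.one_le
  have mI : Measurable fun p : UnitSphere n × UnitSphere n =>
      radialIntegral s (p.1 : Rn n) p.2 (Ioo 0 (R p.1)) (Ici (R p.2)) := by
    refine measurable_radialIntegral s (by fun_prop) (by fun_prop) ?_ ?_
    · exact (measurableSet_lt measurable_const measurable_snd).inter
        (measurableSet_lt measurable_snd (by fun_prop))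
    · exact measurableSet_le (by fun_prop) measurable_snd
  have mJ : Measurable fun p : UnitSphere n × UnitSphere n =>
      radialIntegral s (p.1 : Rn n) p.2 (Ioo 0 (R p.1)) (Ici (R p.1)) := by
    refine measurable_radialIntegral s (by fun_prop) (by fun_prop) ?_ ?_
    · exact (measurableSet_lt measurable_const measurable_snd).inter
        (measurableSet_lt measurable_snd (by fun_prop))
    · exact measurableSet_le (by fun_prop) measurable_snd
  have mJ' : Measurable fun p : UnitSphere n × UnitSphere n =>
      radialIntegral s (p.1 : Rn n) p.2 (Ioo 0 (R p.2)) (Ici (R p.2)) := by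
    refine measurable_radialIntegral s (by fun_prop) (by fun_prop) ?_ ?_
    · exact (measurableSet_lt measurable_const measurable_snd).inter
        (measurableSet_lt measurable_snd (by fun_prop))
    · exact measurableSet_le (by fun_prop) measurable_snd
  have hP := sPerimeter_eq_lintegral_radialIntegral s hE hR hR0 hER
  -- Exchanging x and y and using the symmetry of the kernel gives a second formula for the
  -- perimeter; only the sum of the two can be symmetrized pointwise.
  have hP' : sPerimeter s E = ∫⁻ x : UnitSphere n, ∫⁻ y : UnitSphere n,
      radialIntegral s (x : Rn n) y (Ioo 0 (R y)) (Ici (R x))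
        ∂(surfaceMeasure n) ∂(surfaceMeasure n) := by
    rw [hP, lintegral_lintegral_swap mI.aemeasurable]
    simp only [fun x y : UnitSphere n => radialIntegral_comm s y x]
  have hJ : ∫⁻ x : UnitSphere n, ∫⁻ y : UnitSphere n,
      radialIntegral s (x : Rn n) y (Ioo 0 (R x)) (Ici (R x))
        ∂(surfaceMeasure n) ∂(surfaceMeasure n)
      = (∫⁻ x, ENNReal.ofReal (R x ^ ((n : ℝ) - s)) ∂(surfaceMeasure n))
          * perimeterDensity n s := by
    rw [← lintegral_mul_const _ (by fun_prop)]
    congr with x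
    simp only [fun y : UnitSphere n => radialIntegral_scale hn s (x : Rn n) (y : Rn n) (hR0 x)]
    rw [lintegral_const_mul' _ _ ENNReal.ofReal_ne_top, lintegral_radialIntegral_one]
  have hJ' : ∫⁻ x : UnitSphere n, ∫⁻ y : UnitSphere n,
      radialIntegral s (x : Rn n) y (Ioo 0 (R y)) (Ici (R y))
        ∂(surfaceMeasure n) ∂(surfaceMeasure n)
      = (∫⁻ x, ENNReal.ofReal (R x ^ ((n : ℝ) - s)) ∂(surfaceMeasure n))
          * perimeterDensity n s := by
    rw [← hJ, lintegral_lintegral_swap mJ'.aemeasurable]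
    simp only [fun x y : UnitSphere n => radialIntegral_comm s y x]
  calc 2 * sPerimeter s E = sPerimeter s E + sPerimeter s E := two_mul _
    _ = ∫⁻ x : UnitSphere n, ∫⁻ y : UnitSphere n,
          (radialIntegral s (x : Rn n) y (Ioo 0 (R x)) (Ici (R y))
            + radialIntegral s (x : Rn n) y (Ioo 0 (R y)) (Ici (R x)))
          ∂(surfaceMeasure n) ∂(surfaceMeasure n) := by
        nth_rewrite 1 [hP]
        rw [hP', ← lintegral_add_left mI.lintegral_prod_right']
        congr with x
        exact (lintegral_add_left (mI.comp measurable_prodMk_left) _).symm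
    _ = ∫⁻ x : UnitSphere n, ∫⁻ y : UnitSphere n,
          (radialIntegral s (x : Rn n) y (Ioo 0 (R x)) (Ici (R x))
            + radialIntegral s (x : Rn n) y (Ioo 0 (R y)) (Ici (R y))
            + radialSquare s (x : Rn n) y (R x) (R y))
          ∂(surfaceMeasure n) ∂(surfaceMeasure n) := by
        simp only [fun x y : UnitSphere n =>
          radialIntegral_symmetrize s (x : Rn n) (y : Rn n) (hR0 x) (hR0 y)]
    _ = _ := by
        have h1 : ∀ x : UnitSphere n, ∫⁻ y : UnitSphere n,
          (radialIntegral s (x : Rn n) y (Ioo 0 (R x)) (Ici (R x))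
            + radialIntegral s (x : Rn n) y (Ioo 0 (R y)) (Ici (R y))
            + radialSquare s (x : Rn n) y (R x) (R y)) ∂(surfaceMeasure n)
          = (∫⁻ y : UnitSphere n, radialIntegral s (x : Rn n) y (Ioo 0 (R x)) (Ici (R x))
              ∂(surfaceMeasure n)
            + ∫⁻ y : UnitSphere n, radialIntegral s (x : Rn n) y (Ioo 0 (R y)) (Ici (R y))
              ∂(surfaceMeasure n))
            + ∫⁻ y : UnitSphere n, radialSquare s (x : Rn n) y (R x) (R y)
              ∂(surfaceMeasure n) := by
          intro x
          exact lintegral_add_add (mJ.comp measurable_prodMk_left)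
            (mJ'.comp measurable_prodMk_left) _
        simp only [h1]
        refine (lintegral_add_add mJ.lintegral_prod_right' mJ'.lintegral_prod_right' _).trans ?_
        rw [hJ, hJ', ← two_mul]

end RadialKernel

/-! ### Finiteness of the perimeter of the ball. -/

section BallPerimeter

open Set

variable {n : ℕ}

lemma smul_mem_ball_iff (x : UnitSphere n) (r : ℝ) (hr : 0 < r) :
    r • (x : Rn n) ∈ ball (0 : Rn n) 1 ↔ r < 1 := by
  simp [norm_smul, abs_of_pos hr]

variable [NeZero n]

lemma sPerimeter_ball (s : ℝ) :
    sPerimeter s (ball (0 : Rn n) 1) = surfaceMeasure n univ * perimeterDensity n s := by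
  have h := two_mul_sPerimeter s (E := ball (0 : Rn n) 1) measurableSet_ball (R := fun _ => 1)
    measurable_const (fun _ => one_pos) smul_mem_ball_iff
  simp only [radialSquare, min_self, max_self, Ico_self, radialIntegral, Measure.restrict_empty,
    lintegral_zero_measure, lintegral_zero, add_zero, Real.one_rpow, ENNReal.ofReal_one,
    lintegral_one] at h
  exact (ENNReal.mul_right_inj (by norm_num) (by norm_num)).1 h

lemma lintegral_compl_ball_le {s : ℝ} (hs : 0 < s) {δ : ℝ} (hδ : 0 < δ) :
    ∫⁻ z : Rn n, {z | δ ≤ ‖z‖}.indicator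
        (fun z => ENNReal.ofReal (1 / ‖z‖ ^ ((n : ℝ) + s))) z
      = surfaceMeasure n univ * ENNReal.ofReal (δ ^ (-s) / s) := by
  have hm : MeasurableSet {z : Rn n | δ ≤ ‖z‖} := measurableSet_le (by fun_prop) (by fun_prop)
  rw [lintegral_polar ((by fun_prop : Measurable fun z : Rn n =>
    ENNReal.ofReal (1 / ‖z‖ ^ ((n : ℝ) + s))).indicator hm)]
  have h : ∀ x : UnitSphere n, ∫⁻ r in Ioi (0 : ℝ), ENNReal.ofReal (r ^ (n - 1)) *
      {z | δ ≤ ‖z‖}.indicator (fun z => ENNReal.ofReal (1 / ‖z‖ ^ ((n : ℝ) + s))) (r • (x : Rn n))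
      = ENNReal.ofReal (δ ^ (-s) / s) := by
    intro x
    have hsub : Ici δ ⊆ Ioi 0 := fun ρ hρ => hδ.trans_le hρ
    have e1 : ∫⁻ r in Ioi (0 : ℝ), ENNReal.ofReal (r ^ (n - 1)) *
      {z | δ ≤ ‖z‖}.indicator (fun z => ENNReal.ofReal (1 / ‖z‖ ^ ((n : ℝ) + s))) (r • (x : Rn n))
      = ∫⁻ r in Ioi (0 : ℝ), (Ici δ).indicator (fun r => ENNReal.ofReal (r ^ (-1 - s))) r := by
      refine setLIntegral_congr_fun measurableSet_Ioi fun r hr => ?_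
      have hr : 0 < r := hr
      have hnorm : ‖r • (x : Rn n)‖ = r := by simp [norm_smul, abs_of_pos hr]
      by_cases h : δ ≤ r
      · rw [indicator_of_mem (show r ∈ Ici δ from h), indicator_of_mem (by simpa [hnorm] using h),
          hnorm, ← ENNReal.ofReal_mul (by positivity)]
        congr 1
        have e : r ^ (n - 1) = r ^ (-1 - s) * r ^ ((n : ℝ) + s) := by
          rw [← Real.rpow_add hr, ← Real.rpow_natCast, Nat.cast_sub NeZero.one_le]
          congr 1
          push_cast
          ring
        rw [e, mul_one_div, mul_div_assoc, div_self (Real.rpow_pos_of_pos hr _).ne', mul_one]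
      · rw [indicator_of_notMem (show r ∉ Ici δ from h),
          indicator_of_notMem (by simpa [hnorm] using h), mul_zero]
    rw [e1, setLIntegral_indicator measurableSet_Ici, inter_eq_left.2 hsub,
      setLIntegral_congr Ioi_ae_eq_Ici.symm, ← ofReal_integral_eq_lintegral_ofReal
        (integrableOn_Ioi_rpow_of_lt (by linarith) hδ)]
    · rw [integral_Ioi_rpow_of_lt (by linarith) hδ]
      congr 1
      rw [show -1 - s + 1 = -s by ring, neg_div_neg_eq]
    · filter_upwards [ae_restrict_mem measurableSet_Ioi] with r hr
      exact Real.rpow_nonneg (hδ.trans hr).le _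
  simp only [h, lintegral_const, mul_comm]

lemma lintegral_one_sub_rpow_lt_top {s : ℝ} (hs1 : s < 1) :
    ∫⁻ r in Ioo (0 : ℝ) 1, ENNReal.ofReal ((1 - r) ^ (-s)) < ∞ := by
  have h : IntervalIntegrable (fun r : ℝ => r ^ (-s)) volume 0 1 :=
    intervalIntegral.intervalIntegrable_rpow' (by linarith)
  have h2 := (h.comp_sub_left 1).symm
  simp only [sub_zero, sub_self] at h2
  rw [intervalIntegrable_iff_integrableOn_Ioo_of_le zero_le_one] at h2
  exact (hasFiniteIntegral_iff_ofReal (by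
    filter_upwards [ae_restrict_mem measurableSet_Ioo] with r hr
    exact Real.rpow_nonneg (by linarith [hr.2]) _)).1 h2.2

/-- The complement of the ball lies at distance at least 1-|x| from x, so the inner integral is at
most a multiple of (1-|x|)^(-s)/s, which is integrable up to the boundary as s < 1. -/
lemma sPerimeter_ball_lt_top {s : ℝ} (hs : 0 < s) (hs1 : s < 1) :
    sPerimeter s (ball (0 : Rn n) 1) < ∞ := by
  have h1 : ∀ x ∈ ball (0 : Rn n) 1,
      ∫⁻ y in (ball (0 : Rn n) 1)ᶜ, ENNReal.ofReal (1 / ‖x - y‖ ^ ((n : ℝ) + s))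
      ≤ surfaceMeasure n univ * ENNReal.ofReal ((1 - ‖x‖) ^ (-s) / s) := by
    intro x hx
    have hx' : 0 < 1 - ‖x‖ := by simpa using hx
    rw [← lintegral_compl_ball_le hs hx', ← lintegral_indicator measurableSet_ball.compl,
      ← lintegral_sub_left_eq_self ({z | 1 - ‖x‖ ≤ ‖z‖}.indicator _) x]
    refine lintegral_mono fun y => ?_
    by_cases h : y ∈ (ball (0 : Rn n) 1)ᶜ
    · rw [indicator_of_mem h, indicator_of_mem]
      simp only [mem_compl_iff, mem_ball_zero_iff, not_lt] at h
      simp only [mem_ofPred_eq]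
      have := norm_sub_norm_le y x
      rw [norm_sub_rev] at this
      linarith
    · rw [indicator_of_notMem h]
      exact zero_le
  have h2 : sPerimeter s (ball (0 : Rn n) 1)
      ≤ ∫⁻ x : Rn n, (ball (0 : Rn n) 1).indicator
        (fun x => surfaceMeasure n univ * ENNReal.ofReal ((1 - ‖x‖) ^ (-s) / s)) x := by
    rw [lintegral_indicator measurableSet_ball]
    exact setLIntegral_mono (by fun_prop) h1
  refine h2.trans_lt ?_
  rw [lintegral_polar (Measurable.indicator (by fun_prop) measurableSet_ball)]
  have h3 : ∀ x : UnitSphere n, ∫⁻ r in Ioi (0 : ℝ), ENNReal.ofReal (r ^ (n - 1)) *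
      (ball (0 : Rn n) 1).indicator
        (fun x => surfaceMeasure n univ * ENNReal.ofReal ((1 - ‖x‖) ^ (-s) / s)) (r • (x : Rn n))
      ≤ surfaceMeasure n univ * ENNReal.ofReal s⁻¹ *
        ∫⁻ r in Ioo (0 : ℝ) 1, ENNReal.ofReal ((1 - r) ^ (-s)) := by
    intro x
    rw [← lintegral_const_mul' _ _ (ENNReal.mul_ne_top (measure_ne_top _ _) ENNReal.ofReal_ne_top)]
    have hI : Ioo (0 : ℝ) 1 = Iio 1 ∩ Ioi 0 := by ext; simp [and_comm]
    rw [hI, ← setLIntegral_indicator measurableSet_Iio]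
    refine setLIntegral_mono' measurableSet_Ioi fun r hr => ?_
    have hr : 0 < r := hr
    have hnorm : ‖r • (x : Rn n)‖ = r := by simp [norm_smul, abs_of_pos hr]
    by_cases h : r < 1
    · rw [indicator_of_mem (show r ∈ Iio (1 : ℝ) from h), indicator_of_mem (by simpa [hnorm] using h),
        hnorm]
      have h4 : ENNReal.ofReal (r ^ (n - 1)) ≤ 1 := by
        rw [← ENNReal.ofReal_one]
        exact ENNReal.ofReal_le_ofReal (pow_le_one₀ hr.le h.le)
      have h5 : ENNReal.ofReal ((1 - r) ^ (-s) / s)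
          = ENNReal.ofReal s⁻¹ * ENNReal.ofReal ((1 - r) ^ (-s)) := by
        rw [← ENNReal.ofReal_mul (by positivity)]
        congr 1
        ring
      rw [h5, ← mul_assoc (surfaceMeasure n univ)]
      exact mul_le_of_le_one_left (zero_le) h4
    · rw [indicator_of_notMem (show r ∉ Iio (1 : ℝ) from h),
        indicator_of_notMem (by simpa [hnorm] using h), mul_zero]
  refine (lintegral_mono h3).trans_lt ?_
  rw [lintegral_const]
  refine ENNReal.mul_lt_top (ENNReal.mul_lt_top (ENNReal.mul_lt_top (measure_lt_top _ _)
    ENNReal.ofReal_lt_top) (lintegral_one_sub_rpow_lt_top hs1)) (measure_lt_top _ _)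

lemma surfaceMeasure_univ_ne_zero : surfaceMeasure n univ ≠ 0 := by
  have : Nontrivial (Rn n) := inferInstance
  rw [Ne, Measure.measure_univ_eq_zero]
  exact Measure.toSphere_ne_zero _

lemma perimeterDensity_ne_top {s : ℝ} (hs : 0 < s) (hs1 : s < 1) : perimeterDensity n s ≠ ∞ := by
  have h := sPerimeter_ball_lt_top (n := n) hs hs1
  rw [sPerimeter_ball] at h
  intro h0
  rw [h0, ENNReal.mul_top surfaceMeasure_univ_ne_zero] at h
  exact lt_irrefl _ h

end BallPerimeter

/-! ### Comparison of the square terms with the Sobolev seminorm. -/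

section SquareEstimates

open Set

variable {n : ℕ}

lemma volume_Ico_min_max (a b : ℝ) : volume (Ico (min a b) (max a b)) = ENNReal.ofReal |a - b| := by
  rw [Real.volume_Ico, max_sub_min_eq_abs, abs_sub_comm]

lemma abs_sub_le_of_mem_Ico {a b r ρ : ℝ} (hr : r ∈ Ico (min a b) (max a b))
    (hρ : ρ ∈ Ico (min a b) (max a b)) : |r - ρ| ≤ |a - b| := by
  rw [abs_sub_comm a b, ← max_sub_min_eq_abs a b, abs_le]
  constructor <;> linarith [hr.1, hr.2, hρ.1, hρ.2]

lemma mem_Icc_of_mem_Ico {a b c d r : ℝ} (ha : a ∈ Icc c d) (hb : b ∈ Icc c d)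
    (hr : r ∈ Ico (min a b) (max a b)) : r ∈ Icc c d :=
  ⟨(le_min ha.1 hb.1).trans hr.1, hr.2.le.trans (max_le ha.2 hb.2)⟩

lemma radialKernel_eq (s : ℝ) (x y : Rn n) {r ρ : ℝ} (hr : 0 ≤ r) (hρ : 0 ≤ ρ) :
    radialKernel s x y r ρ
      = ENNReal.ofReal (r ^ (n - 1) * ρ ^ (n - 1) / ‖r • x - ρ • y‖ ^ ((n : ℝ) + s)) := by
  rw [radialKernel, ← ENNReal.ofReal_mul (by positivity), ← ENNReal.ofReal_mul (by positivity)]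
  congr 1
  ring

lemma radialSquare_const (c : ℝ≥0∞) (a b : ℝ) :
    ∫⁻ _ in Ico (min a b) (max a b), ∫⁻ _ in Ico (min a b) (max a b), c
      = c * ENNReal.ofReal (|a - b| ^ 2) := by
  simp only [setLIntegral_const, volume_Ico_min_max]
  rw [mul_assoc, ← ENNReal.ofReal_mul (abs_nonneg _), sq]

/-- The square has area |a-b|², and on it |rx - ρy| ≥ (1-ε)|x-y|. The exponent n+s of 1-ε is
replaced by n+1, so that the constant does not depend on s. -/
lemma radialSquare_le {s ε : ℝ} (hs : 0 < s) (hs1 : s < 1) (hε1 : ε < 1)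
    {x y : UnitSphere n} (hxy : x ≠ y) {a b : ℝ} (ha : a ∈ Icc (1 - ε) (1 + ε))
    (hb : b ∈ Icc (1 - ε) (1 + ε)) :
    radialSquare s (x : Rn n) y a b ≤ ENNReal.ofReal ((1 + ε) ^ (2 * (n - 1)) / (1 - ε) ^ (n + 1) *
      (|a - b| ^ 2 / ‖(x : Rn n) - (y : Rn n)‖ ^ ((n : ℝ) + s))) := by
  have hε0 : 0 ≤ ε := by linarith [ha.1, ha.2]
  have h1ε : 0 < 1 - ε := by linarith
  have hθ : 0 < ‖(x : Rn n) - (y : Rn n)‖ := norm_pos_iff.2 (sub_ne_zero.2 fun h => hxy (Subtype.ext h))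
  set θ := ‖(x : Rn n) - (y : Rn n)‖
  have hns : 0 < (n : ℝ) + s := by positivity
  set c := (1 + ε) ^ (2 * (n - 1)) / (1 - ε) ^ (n + 1)
  have hk : ∀ r ∈ Ico (min a b) (max a b), ∀ ρ ∈ Ico (min a b) (max a b),
      radialKernel s (x : Rn n) y r ρ ≤ ENNReal.ofReal (c * (1 / θ ^ ((n : ℝ) + s))) := by
    intro r hr ρ hρ
    have hr' := mem_Icc_of_mem_Ico ha hb hr
    have hρ' := mem_Icc_of_mem_Ico ha hb hρ
    have hr0 : 0 ≤ r := by linarith [hr'.1]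
    have hρ0 : 0 ≤ ρ := by linarith [hρ'.1]
    rw [radialKernel_eq s _ _ hr0 hρ0]
    refine ENNReal.ofReal_le_ofReal ?_
    have hlow : (1 - ε) * θ ≤ ‖r • (x : Rn n) - ρ • (y : Rn n)‖ := by
      refine abs_le_of_sq_le_sq' ?_ (norm_nonneg _) |>.2
      rw [norm_smul_sub_smul_sq]
      have : (1 - ε) * (1 - ε) ≤ r * ρ := mul_le_mul hr'.1 hρ'.1 h1ε.le hr0
      have := mul_le_mul_of_nonneg_right this (sq_nonneg θ)
      nlinarith [sq_nonneg (r - ρ)]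
    have hpow : (1 - ε) ^ (n + 1) * θ ^ ((n : ℝ) + s)
        ≤ ‖r • (x : Rn n) - ρ • (y : Rn n)‖ ^ ((n : ℝ) + s) := by
      refine le_trans ?_ (Real.rpow_le_rpow (by positivity) hlow hns.le)
      rw [Real.mul_rpow h1ε.le hθ.le]
      have : (1 - ε) ^ (n + 1) ≤ (1 - ε) ^ ((n : ℝ) + s) := by
        rw [← Real.rpow_natCast]
        exact Real.rpow_le_rpow_of_exponent_ge h1ε (by linarith) (by push_cast; linarith)
      gcongr
    have hnum : r ^ (n - 1) * ρ ^ (n - 1) ≤ (1 + ε) ^ (2 * (n - 1)) := by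
      rw [two_mul, pow_add]
      have := hr'.2
      have := hρ'.2
      gcongr
    have hd : 0 < (1 - ε) ^ (n + 1) * θ ^ ((n : ℝ) + s) := by positivity
    calc _ ≤ (1 + ε) ^ (2 * (n - 1)) / ((1 - ε) ^ (n + 1) * θ ^ ((n : ℝ) + s)) := by gcongr
      _ = _ := by simp only [c]; rw [mul_one_div, div_div]
  calc radialSquare s (x : Rn n) y a b
      ≤ ∫⁻ _ in Ico (min a b) (max a b), ∫⁻ _ in Ico (min a b) (max a b),
        ENNReal.ofReal (c * (1 / θ ^ ((n : ℝ) + s))) :=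
        setLIntegral_mono' measurableSet_Ico fun r hr =>
          setLIntegral_mono' measurableSet_Ico fun ρ hρ => hk r hr ρ hρ
    _ = _ := by
        rw [radialSquare_const, ← ENNReal.ofReal_mul (by positivity)]
        congr 1
        ring

/-- The Lipschitz hypothesis keeps the radial part of the distance below 2ε|x-y|. Since (2ε)² +
(1+ε)² ≤ (1+3ε)², the kernel is then nearly the one at radii one. -/
lemma le_radialSquare {s ε : ℝ} (hs : 0 < s) (hs1 : s < 1) (hε1 : ε < 1)
    {x y : UnitSphere n} (hxy : x ≠ y) {a b : ℝ} (ha : a ∈ Icc (1 - ε) (1 + ε))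
    (hb : b ∈ Icc (1 - ε) (1 + ε)) (hab : |a - b| ≤ 2 * ε * ‖(x : Rn n) - (y : Rn n)‖) :
    ENNReal.ofReal ((1 - ε) ^ (2 * (n - 1)) / (1 + 3 * ε) ^ (n + 1) *
      (|a - b| ^ 2 / ‖(x : Rn n) - (y : Rn n)‖ ^ ((n : ℝ) + s)))
      ≤ radialSquare s (x : Rn n) y a b := by
  have hε0 : 0 ≤ ε := by linarith [ha.1, ha.2]
  have h1ε : 0 < 1 - ε := by linarith
  have hθ : 0 < ‖(x : Rn n) - (y : Rn n)‖ := norm_pos_iff.2 (sub_ne_zero.2 fun h => hxy (Subtype.ext h))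
  set θ := ‖(x : Rn n) - (y : Rn n)‖ with hθdef
  have hns : 0 < (n : ℝ) + s := by positivity
  set c := (1 - ε) ^ (2 * (n - 1)) / (1 + 3 * ε) ^ (n + 1)
  have hk : ∀ r ∈ Ico (min a b) (max a b), ∀ ρ ∈ Ico (min a b) (max a b),
      ENNReal.ofReal (c * (1 / θ ^ ((n : ℝ) + s))) ≤ radialKernel s (x : Rn n) y r ρ := by
    intro r hr ρ hρ
    have hr' := mem_Icc_of_mem_Ico ha hb hr
    have hρ' := mem_Icc_of_mem_Ico ha hb hρ
    have hr0 : 0 < r := by linarith [hr'.1]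
    have hρ0 : 0 < ρ := by linarith [hρ'.1]
    rw [radialKernel_eq s _ _ hr0.le hρ0.le]
    refine ENNReal.ofReal_le_ofReal ?_
    have hup : ‖r • (x : Rn n) - ρ • (y : Rn n)‖ ≤ (1 + 3 * ε) * θ := by
      refine abs_le_of_sq_le_sq' ?_ (by positivity) |>.2
      rw [norm_smul_sub_smul_sq, ← hθdef]
      have h1 : r * ρ ≤ (1 + ε) * (1 + ε) := mul_le_mul hr'.2 hρ'.2 hρ0.le (by linarith)
      have h2 := mul_le_mul_of_nonneg_right h1 (sq_nonneg θ)
      have h3 : (r - ρ) ^ 2 ≤ (2 * ε * θ) ^ 2 := by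
        rw [← sq_abs (r - ρ)]
        exact pow_le_pow_left₀ (abs_nonneg _) ((abs_sub_le_of_mem_Ico hr hρ).trans hab) 2
      nlinarith [mul_nonneg hε0 (sq_nonneg θ), mul_nonneg (mul_nonneg hε0 hε0) (sq_nonneg θ)]
    have hpos : 0 < ‖r • (x : Rn n) - ρ • (y : Rn n)‖ := by
      have h4 : 0 < ‖r • (x : Rn n) - ρ • (y : Rn n)‖ ^ 2 := by
        rw [norm_smul_sub_smul_sq, ← hθdef]
        positivity
      exact lt_of_le_of_ne (norm_nonneg _) fun h0 => by simp [← h0] at h4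
    have hpow : ‖r • (x : Rn n) - ρ • (y : Rn n)‖ ^ ((n : ℝ) + s)
        ≤ (1 + 3 * ε) ^ (n + 1) * θ ^ ((n : ℝ) + s) := by
      refine le_trans (Real.rpow_le_rpow (norm_nonneg _) hup hns.le) ?_
      rw [Real.mul_rpow (by linarith) hθ.le]
      have : (1 + 3 * ε) ^ ((n : ℝ) + s) ≤ (1 + 3 * ε) ^ (n + 1) := by
        rw [← Real.rpow_natCast]
        exact Real.rpow_le_rpow_of_exponent_le (by linarith) (by push_cast; linarith)
      gcongr
    have hnum : (1 - ε) ^ (2 * (n - 1)) ≤ r ^ (n - 1) * ρ ^ (n - 1) := by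
      rw [two_mul, pow_add]
      have := hr'.1
      have := hρ'.1
      gcongr
    calc _ = (1 - ε) ^ (2 * (n - 1)) / ((1 + 3 * ε) ^ (n + 1) * θ ^ ((n : ℝ) + s)) := by
            simp only [c]; rw [mul_one_div, div_div]
      _ ≤ _ := by
            have := Real.rpow_pos_of_pos hpos ((n : ℝ) + s)
            gcongr
  calc _ = ∫⁻ _ in Ico (min a b) (max a b), ∫⁻ _ in Ico (min a b) (max a b),
        ENNReal.ofReal (c * (1 / θ ^ ((n : ℝ) + s))) := by
        rw [radialSquare_const, ← ENNReal.ofReal_mul (by positivity)]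
        congr 1
        ring
    _ ≤ _ := setLIntegral_mono' measurableSet_Ico fun r hr =>
          setLIntegral_mono' measurableSet_Ico fun ρ hρ => hk r hr ρ hρ

lemma radialSquare_self (s : ℝ) (x y : Rn n) (a : ℝ) : radialSquare s x y a a = 0 := by
  simp [radialSquare, radialIntegral]

lemma lintegral_radialSquare_le {s ε : ℝ} (hs : 0 < s) (hs1 : s < 1) (hε1 : ε < 1)
    {u : UnitSphere n → ℝ} (hu : ∀ x, |u x| ≤ ε) :
    ∫⁻ x : UnitSphere n, ∫⁻ y : UnitSphere n, radialSquare s (x : Rn n) y (1 + u x) (1 + u y)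
      ∂(surfaceMeasure n) ∂(surfaceMeasure n)
      ≤ ENNReal.ofReal ((1 + ε) ^ (2 * (n - 1)) / (1 - ε) ^ (n + 1)) * sobolevSeminormSq s u := by
  rw [sobolevSeminormSq, ← lintegral_const_mul' _ _ ENNReal.ofReal_ne_top]
  refine lintegral_mono fun x => ?_
  rw [← lintegral_const_mul' _ _ ENNReal.ofReal_ne_top]
  refine lintegral_mono fun y => ?_
  have hε0 : 0 ≤ ε := (abs_nonneg _).trans (hu x)
  have h1ε : 0 < 1 - ε := by linarith
  have hI : ∀ x, 1 + u x ∈ Icc (1 - ε) (1 + ε) := fun x => by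
    have := abs_le.1 (hu x)
    constructor <;> linarith
  by_cases h : x = y
  · subst h
    rw [radialSquare_self]
    exact zero_le
  rw [← ENNReal.ofReal_mul (by positivity)]
  refine (radialSquare_le hs hs1 hε1 h (hI x) (hI y)).trans_eq ?_
  rw [show 1 + u x - (1 + u y) = u x - u y by ring]

lemma le_lintegral_radialSquare {s ε : ℝ} (hs : 0 < s) (hs1 : s < 1) (hε1 : ε < 1)
    {u : UnitSphere n → ℝ} (hu : ∀ x, |u x| ≤ ε)
    (hL : ∀ x y : UnitSphere n, |u x - u y| ≤ 2 * ε * ‖(x : Rn n) - (y : Rn n)‖) :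
    ENNReal.ofReal ((1 - ε) ^ (2 * (n - 1)) / (1 + 3 * ε) ^ (n + 1)) * sobolevSeminormSq s u
      ≤ ∫⁻ x : UnitSphere n, ∫⁻ y : UnitSphere n, radialSquare s (x : Rn n) y (1 + u x) (1 + u y)
      ∂(surfaceMeasure n) ∂(surfaceMeasure n) := by
  rw [sobolevSeminormSq, ← lintegral_const_mul' _ _ ENNReal.ofReal_ne_top]
  refine lintegral_mono fun x => ?_
  rw [← lintegral_const_mul' _ _ ENNReal.ofReal_ne_top]
  refine lintegral_mono fun y => ?_
  have hε0 : 0 ≤ ε := (abs_nonneg _).trans (hu x)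
  have h1ε : 0 < 1 - ε := by linarith
  have hI : ∀ x, 1 + u x ∈ Icc (1 - ε) (1 + ε) := fun x => by
    have := abs_le.1 (hu x)
    constructor <;> linarith
  by_cases h : x = y
  · subst h
    simp
  rw [← ENNReal.ofReal_mul (by positivity)]
  refine le_trans (le_of_eq ?_) (le_radialSquare hs hs1 hε1 h (hI x) (hI y) ?_)
  · rw [show 1 + u x - (1 + u y) = u x - u y by ring]
  · rw [show 1 + u x - (1 + u y) = u x - u y by ring]
    exact hL x y

end SquareEstimates

/-! ### Second-order expansion of (1+v)^(n-s). -/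

section Taylor

/-- Bernoulli's inequality for the concave power s, applied at v for the lower bound and at -v/(1+v)
for the upper one. The factor s must survive: the final error is absorbed by sκ‖u‖². -/
lemma rpow_neg_sub_le {s v : ℝ} (hs : 0 < s) (hs1 : s < 1) (hv : |v| ≤ 1 / 2) :
    |(1 + v) ^ (-s) - 1 + s * v| ≤ 2 * s * v ^ 2 := by
  obtain ⟨hv1, hv2⟩ := abs_le.1 hv
  have h1v : 0 < 1 + v := by linarith
  have hup : (1 + v) ^ (-s) ≤ 1 + s * (-v / (1 + v)) := by
    have h := rpow_one_add_le_one_add_mul_self (s := -v / (1 + v)) (p := s) (by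
      rw [le_div_iff₀ h1v]; linarith) hs.le hs1.le
    have e : 1 + -v / (1 + v) = (1 + v)⁻¹ := by field_simp; ring
    rwa [e, Real.inv_rpow h1v.le, ← Real.rpow_neg h1v.le] at h
  have hlow : 1 - s * v ≤ (1 + v) ^ (-s) := by
    have h := rpow_one_add_le_one_add_mul_self (s := v) (p := s) (by linarith) hs.le hs1.le
    have h0 : 0 < (1 + v) ^ s := Real.rpow_pos_of_pos h1v s
    rw [Real.rpow_neg h1v.le, ← one_div, le_div_iff₀ h0]
    by_cases h2 : 0 ≤ 1 - s * v
    · nlinarith [mul_le_mul_of_nonneg_left h h2, sq_nonneg (s * v)]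
    · nlinarith
  have e2 : s * (-v / (1 + v)) = - (s * v) + s * (v ^ 2 / (1 + v)) := by field_simp; ring
  have e3 : v ^ 2 / (1 + v) ≤ 2 * v ^ 2 := by
    rw [div_le_iff₀ h1v]
    nlinarith [sq_nonneg v]
  have e4 := mul_le_mul_of_nonneg_left e3 hs.le
  rw [abs_le]
  constructor
  · nlinarith [mul_nonneg hs.le (sq_nonneg v)]
  · linarith

lemma abs_one_add_pow_sub_one_le {v : ℝ} (hv : |v| ≤ 1) (k : ℕ) :
    |(1 + v) ^ k - 1| ≤ k * 2 ^ k * |v| := by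
  induction k with
  | zero => simp
  | succ k ih =>
    have h2 : |1 + v| ≤ 2 := by
      rw [abs_le] at hv ⊢
      constructor <;> linarith
    have e : (1 + v) ^ (k + 1) - 1 = (1 + v) * ((1 + v) ^ k - 1) + v := by ring
    have h1 : (1 : ℝ) ≤ 2 ^ (k + 1) := one_le_pow₀ (by norm_num)
    rw [e]
    calc |(1 + v) * ((1 + v) ^ k - 1) + v| ≤ |1 + v| * |(1 + v) ^ k - 1| + |v| := by
          rw [← abs_mul]; exact abs_add_le _ _
      _ ≤ 2 * (k * 2 ^ k * |v|) + 2 ^ (k + 1) * |v| := by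
          gcongr
          exact le_mul_of_one_le_left (abs_nonneg _) h1
      _ = _ := by push_cast; ring

/-- The deviation of `(1 + v)ⁿ⁻ˢ` from the affine function of `(1 + v)ⁿ` tangent at `v = 0`. -/
noncomputable def powerDefect (n : ℕ) (s v : ℝ) : ℝ :=
  (1 + v) ^ ((n : ℝ) - s) - ((n : ℝ) - s) / n * (1 + v) ^ n - s / n

/-- The left-hand side vanishes at v = 0 and its derivative is O(s v²), so the mean value inequality
gives a cubic bound that is still proportional to s. -/
lemma abs_powerDefect_add_le {n : ℕ} (hn : 1 ≤ n) {s v : ℝ} (hs : 0 < s) (hs1 : s < 1)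
    (hv : |v| ≤ 1 / 2) :
    |powerDefect n s v + s * ((n : ℝ) - s) / 2 * v ^ 2| ≤ n * (n + 2) * 2 ^ n * s * |v| ^ 3 := by
  have hn0 : (1 : ℝ) ≤ n := by exact_mod_cast hn
  have hn0' : (n : ℝ) ≠ 0 := by linarith
  let G (w : ℝ) : ℝ := powerDefect n s w + s * ((n : ℝ) - s) / 2 * w ^ 2
  let G' (w : ℝ) : ℝ := ((n : ℝ) - s) * ((1 + w) ^ ((n : ℝ) - s - 1) - (1 + w) ^ (n - 1))
    + s * ((n : ℝ) - s) * w
  have hder : ∀ w, |w| ≤ 1 / 2 → HasDerivAt G (G' w) w := by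
    intro w hw
    have h1w : 0 < 1 + w := by linarith [(abs_le.1 hw).1]
    have d0 : HasDerivAt (fun w : ℝ => 1 + w) 1 w := (hasDerivAt_id w).const_add 1
    have d1 := d0.rpow_const (p := (n : ℝ) - s) (.inl h1w.ne')
    have d2 := (d0.pow n).const_mul (((n : ℝ) - s) / n)
    have d3 := (hasDerivAt_pow 2 w).const_mul (s * ((n : ℝ) - s) / 2)
    have d4 := ((d1.sub d2).sub_const (s / n)).add d3
    refine d4.congr_deriv ?_
    simp only [G']
    field_simp
    push_cast
    ring
  have hbound : ∀ w, |w| ≤ |v| → |G' w| ≤ n * (n + 2) * 2 ^ n * s * |v| ^ 2 := by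
    intro w hw
    have hw2 : |w| ≤ 1 / 2 := hw.trans hv
    have h1w : 0 < 1 + w := by linarith [(abs_le.1 hw2).1]
    have e1 : (1 + w) ^ ((n : ℝ) - s - 1) = (1 + w) ^ (n - 1) * (1 + w) ^ (-s) := by
      rw [← Real.rpow_natCast, ← Real.rpow_add h1w, Nat.cast_sub hn]
      congr 1
      push_cast
      ring
    have e2 : G' w = ((n : ℝ) - s) * ((1 + w) ^ (n - 1) * ((1 + w) ^ (-s) - 1 + s * w)
        - s * w * ((1 + w) ^ (n - 1) - 1)) := by
      simp only [G', e1]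
      ring
    have b1 := rpow_neg_sub_le hs hs1 hw2
    have b2 := abs_one_add_pow_sub_one_le (hw2.trans (by norm_num)) (n - 1)
    have b3 : |(1 + w) ^ (n - 1)| ≤ 2 ^ n := by
      rw [abs_pow]
      have : |1 + w| ≤ 2 := by
        rw [abs_le] at hw2 ⊢
        constructor <;> linarith
      calc |1 + w| ^ (n - 1) ≤ 2 ^ (n - 1) := by gcongr
        _ ≤ 2 ^ n := pow_le_pow_right₀ (by norm_num) (Nat.sub_le _ _)
    have b4 : ((n - 1 : ℕ) : ℝ) * 2 ^ (n - 1) ≤ n * 2 ^ n := by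
      gcongr
      · exact Nat.sub_le _ _
      · norm_num
      · exact Nat.sub_le _ _
    have hsw : |w| ^ 2 ≤ |v| ^ 2 := by gcongr
    calc |G' w| = ((n : ℝ) - s) * |(1 + w) ^ (n - 1) * ((1 + w) ^ (-s) - 1 + s * w)
        - s * w * ((1 + w) ^ (n - 1) - 1)| := by
          rw [e2, abs_mul, abs_of_nonneg (by linarith)]
      _ ≤ n * (|(1 + w) ^ (n - 1)| * |(1 + w) ^ (-s) - 1 + s * w|
          + s * |w| * |(1 + w) ^ (n - 1) - 1|) := by
          refine mul_le_mul (by linarith) ?_ (abs_nonneg _) (by linarith)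
          refine (abs_sub _ _).trans_eq ?_
          rw [abs_mul, abs_mul, abs_mul, abs_of_pos hs]
      _ ≤ n * (2 ^ n * (2 * s * |w| ^ 2) + s * |w| * (n * 2 ^ n * |w|)) := by
          rw [sq_abs]
          gcongr
          exact b2.trans (by gcongr)
      _ = n * (n + 2) * 2 ^ n * s * |w| ^ 2 := by ring
      _ ≤ _ := by gcongr
  have hconv : Convex ℝ (Set.Icc (-|v|) |v|) := convex_Icc _ _
  have := hconv.norm_image_sub_le_of_norm_hasDerivWithin_le (f := G) (f' := G')
    (C := n * (n + 2) * 2 ^ n * s * |v| ^ 2) (x := 0) (y := v)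
    (fun w hw => (hder w ((abs_le.2 (Set.mem_Icc.1 hw)).trans hv)).hasDerivWithinAt)
    (fun w hw => hbound w (abs_le.2 (Set.mem_Icc.1 hw)))
    (Set.mem_Icc.2 ⟨neg_nonpos.2 (abs_nonneg v), abs_nonneg v⟩)
    (Set.mem_Icc.2 ⟨neg_abs_le v, le_abs_self v⟩)
  have hG0 : G 0 = 0 := by
    simp only [G, powerDefect]
    simp
    field_simp
    ring
  rw [hG0, sub_zero, sub_zero, Real.norm_eq_abs, Real.norm_eq_abs] at this
  calc _ ≤ _ := this
    _ = _ := by ring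

end Taylor

/-! ### Perimeter difference under the volume constraint. -/

section PerimeterDifference

open Set

lemma lintegral_Ioo_pow {R : ℝ} (hR : 0 ≤ R) (k : ℕ) :
    ∫⁻ r in Ioo 0 R, ENNReal.ofReal (r ^ k) = ENNReal.ofReal (R ^ (k + 1) / (k + 1)) := by
  rw [setLIntegral_congr Ioo_ae_eq_Ioc, ← ofReal_integral_eq_lintegral_ofReal
    (intervalIntegral.intervalIntegrable_pow k).1, ← intervalIntegral.integral_of_le hR,
    integral_pow]
  · simp
  · filter_upwards [ae_restrict_mem measurableSet_Ioc] with r hr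
    exact pow_nonneg hr.1.le _

variable {n : ℕ} [NeZero n]

lemma volume_eq_lintegral {E : Set (Rn n)}
    (hE : MeasurableSet E) {R : UnitSphere n → ℝ} (hR0 : ∀ x, 0 < R x)
    (hER : ∀ (x : UnitSphere n) (r : ℝ), 0 < r → (r • (x : Rn n) ∈ E ↔ r < R x)) :
    volume E = ∫⁻ x, ENNReal.ofReal (R x ^ n / n) ∂(surfaceMeasure n) := by
  have hn : 1 ≤ n := NeZero.one_le
  rw [← lintegral_indicator_one hE, lintegral_polar (measurable_one.indicator hE)]
  congr with x
  have hI : Ioo 0 (R x) = Iio (R x) ∩ Ioi 0 := by ext; simp [and_comm]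
  have e : ∫⁻ r in Ioi (0 : ℝ), ENNReal.ofReal (r ^ (n - 1)) * E.indicator 1 (r • (x : Rn n))
      = ∫⁻ r in Ioo 0 (R x), ENNReal.ofReal (r ^ (n - 1)) := by
    rw [hI, ← setLIntegral_indicator measurableSet_Iio]
    refine setLIntegral_congr_fun measurableSet_Ioi fun r hr => ?_
    by_cases h : r < R x
    · rw [indicator_of_mem (show r ∈ Iio (R x) from h), indicator_of_mem ((hER x r hr).2 h)]
      simp
    · rw [indicator_of_notMem (show r ∉ Iio (R x) from h),
        indicator_of_notMem (fun h' => h ((hER x r hr).1 h')), mul_zero]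
  rw [e, lintegral_Ioo_pow (hR0 x).le, Nat.sub_add_cancel hn, Nat.cast_sub hn]
  simp

lemma integral_pow_of_volume_eq {E : Set (Rn n)} (hE : MeasurableSet E) {u : UnitSphere n → ℝ}
    (hu : Continuous u) (hu0 : ∀ x, |u x| ≤ 1 / 2)
    (hER : ∀ (x : UnitSphere n) (r : ℝ), 0 < r → (r • (x : Rn n) ∈ E ↔ r < 1 + u x))
    (hvol : volume E = volume (ball (0 : Rn n) 1)) :
    ∫ x, (1 + u x) ^ n ∂(surfaceMeasure n) = (surfaceMeasure n).real univ := by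
  have hpos : ∀ x, 0 < 1 + u x := fun x => by linarith [(abs_le.1 (hu0 x)).1]
  have hn : (0 : ℝ) < n := by exact_mod_cast NeZero.pos n
  rw [volume_eq_lintegral hE hpos hER, volume_eq_lintegral (R := fun _ => 1) measurableSet_ball
    (fun _ => one_pos) smul_mem_ball_iff, ← ofReal_integral_eq_lintegral_ofReal
    (integrable_sphere (by fun_prop))
    (Filter.Eventually.of_forall fun x => div_nonneg (pow_nonneg (hpos x).le _) hn.le),
    ← ofReal_integral_eq_lintegral_ofReal
    (integrable_sphere (by fun_prop))
    (Filter.Eventually.of_forall fun x => div_nonneg (by simp) hn.le),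
    ENNReal.ofReal_eq_ofReal_iff
    (integral_nonneg fun x => div_nonneg (pow_nonneg (hpos x).le _) hn.le)
    (integral_nonneg fun x => div_nonneg (by simp) hn.le), integral_div, integral_div,
    div_left_inj' hn.ne'] at hvol
  simpa using hvol

/-- The interaction term of the perimeter expansion. -/
noncomputable def radialInteraction (s : ℝ) (u : UnitSphere n → ℝ) : ℝ≥0∞ :=
  ∫⁻ x : UnitSphere n, ∫⁻ y : UnitSphere n, radialSquare s (x : Rn n) y (1 + u x) (1 + u y)
    ∂(surfaceMeasure n) ∂(surfaceMeasure n)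

/-- Expansion of the `s`-perimeter of a star-shaped set with the volume of the unit ball. -/
lemma sPerimeter_sub_ball {s : ℝ} (hs : 0 < s) (hs1 : s < 1) {E : Set (Rn n)}
    (hE : MeasurableSet E) {u : UnitSphere n → ℝ}
    (hu : Continuous u) (hu0 : ∀ x, |u x| ≤ 1 / 2)
    (hER : ∀ (x : UnitSphere n) (r : ℝ), 0 < r → (r • (x : Rn n) ∈ E ↔ r < 1 + u x))
    (hvol : volume E = volume (ball (0 : Rn n) 1)) :
    (sPerimeter s E ≠ ∞ ↔ radialInteraction s u ≠ ∞) ∧ (radialInteraction s u ≠ ∞ →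
    (sPerimeter s E).toReal - (sPerimeter s (ball (0 : Rn n) 1)).toReal
      = (perimeterDensity n s).toReal * ∫ x, powerDefect n s (u x) ∂(surfaceMeasure n)
        + (radialInteraction s u).toReal / 2) := by
  have hn : (0 : ℝ) < n := by exact_mod_cast NeZero.pos n
  have hpos : ∀ x, 0 < 1 + u x := fun x => by linarith [(abs_le.1 (hu0 x)).1]
  have h := two_mul_sPerimeter s hE (R := fun x => 1 + u x) (by fun_prop) hpos hER
  rw [← radialInteraction] at h
  have hκ := perimeterDensity_ne_top (n := n) hs hs1
  have hcont : Continuous fun x => (1 + u x) ^ ((n : ℝ) - s) :=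
    Continuous.rpow_const (by fun_prop) fun x => .inl (hpos x).ne'
  have hnn : ∀ x, 0 ≤ (1 + u x) ^ ((n : ℝ) - s) := fun x => Real.rpow_nonneg (hpos x).le _
  rw [← ofReal_integral_eq_lintegral_ofReal (integrable_sphere hcont)
    (Filter.Eventually.of_forall hnn)] at h
  have hfin : 2 * (ENNReal.ofReal (∫ x, (1 + u x) ^ ((n : ℝ) - s) ∂(surfaceMeasure n))
      * perimeterDensity n s) ≠ ∞ :=
    ENNReal.mul_ne_top (by norm_num) (ENNReal.mul_ne_top ENNReal.ofReal_ne_top hκ)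
  constructor
  · constructor
    · intro hP hD
      rw [hD, add_top] at h
      exact ENNReal.mul_ne_top (by norm_num) hP h
    · intro hD hP
      rw [hP, ENNReal.mul_top (by norm_num)] at h
      exact ENNReal.add_ne_top.2 ⟨hfin, hD⟩ h.symm
  · intro hD
    have h2 := congrArg ENNReal.toReal h
    rw [ENNReal.toReal_add hfin hD, ENNReal.toReal_mul, ENNReal.toReal_mul, ENNReal.toReal_mul,
      ENNReal.toReal_ofReal (integral_nonneg hnn)] at h2
    simp only [ENNReal.toReal_ofNat] at h2
    -- The affine function of (1+u)^n inside the defect integrates to σ, because the volume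
    -- constraint gives ∫ (1+u)^n = σ.
    have hψ : ∫ x, powerDefect n s (u x) ∂(surfaceMeasure n)
        = ∫ x, (1 + u x) ^ ((n : ℝ) - s) ∂(surfaceMeasure n) - (surfaceMeasure n).real univ := by
      simp only [powerDefect]
      rw [integral_sub, integral_sub (integrable_sphere hcont)
        (integrable_sphere (by fun_prop)), integral_const_mul,
        integral_pow_of_volume_eq hE hu hu0 hER hvol, integral_const, smul_eq_mul]
      · field_simp
        ring
      · exact (integrable_sphere hcont).sub (integrable_sphere (by fun_prop))
      · exact integrable_const _
    rw [hψ, sPerimeter_ball, ENNReal.toReal_mul, ← measureReal_def]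
    linarith

end PerimeterDifference

/-! ### Seminorms of the coordinate functions. -/

section LinearEnergy

open Set

variable {n : ℕ}

lemma norm_sub_sq_sphere (x y : UnitSphere n) :
    ‖(x : Rn n) - (y : Rn n)‖ ^ 2 = 2 * (1 - inner ℝ (x : Rn n) (y : Rn n)) := by
  rw [norm_sub_sq_real, norm_eq_of_mem_sphere, norm_eq_of_mem_sphere]
  ring

lemma norm_sub_sq_eq_sum (x y : Rn n) : ‖x - y‖ ^ 2 = ∑ i, (x i - y i) ^ 2 := by
  rw [EuclideanSpace.norm_sq_eq]
  simp

lemma norm_sub_rpow_sphere (s : ℝ) (x y : UnitSphere n) :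
    ‖(x : Rn n) - (y : Rn n)‖ ^ ((n : ℝ) + s)
      = 2 ^ (((n : ℝ) + s) / 2) * (1 - inner ℝ (x : Rn n) (y : Rn n)) ^ (((n : ℝ) + s) / 2) := by
  have h := abs_le.1 (abs_inner_sphere_le x y)
  rw [← Real.mul_rpow (by norm_num) (by linarith), ← norm_sub_sq_sphere, ← Real.rpow_natCast,
    ← Real.rpow_mul (norm_nonneg _)]
  congr 1
  push_cast
  ring

lemma sobolevSeminormSq_le_of_abs_sub_le (s : ℝ) {u v : UnitSphere n → ℝ} {c : ℝ}
    (h : ∀ x y, |u x - u y| ≤ c * |v x - v y|) :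
    sobolevSeminormSq s u ≤ ENNReal.ofReal (c ^ 2) * sobolevSeminormSq s v := by
  rw [sobolevSeminormSq, sobolevSeminormSq, ← lintegral_const_mul' _ _ ENNReal.ofReal_ne_top]
  refine lintegral_mono fun x => ?_
  rw [← lintegral_const_mul' _ _ ENNReal.ofReal_ne_top]
  refine lintegral_mono fun y => ?_
  rw [← ENNReal.ofReal_mul (sq_nonneg c), ← mul_div_assoc, ← mul_pow]
  gcongr
  exact h x y

/-- The coordinate function `x ↦ xᵢ` on the sphere. -/
def sphereCoord (i : Fin n) (x : UnitSphere n) : ℝ := (x : Rn n) i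

@[fun_prop]
lemma continuous_sphereCoord (i : Fin n) : Continuous (sphereCoord (n := n) i) := by
  unfold sphereCoord
  fun_prop

lemma abs_sphereCoord_le (i : Fin n) (x : UnitSphere n) : |sphereCoord i x| ≤ 1 := by
  have := PiLp.norm_apply_le (x : Rn n) i
  rwa [norm_eq_of_mem_sphere] at this

lemma abs_sphereCoord_sub_le (i : Fin n) (x y : UnitSphere n) :
    |sphereCoord i x - sphereCoord i y| ≤ ‖(x : Rn n) - (y : Rn n)‖ := by
  simpa [sphereCoord] using PiLp.norm_apply_le ((x : Rn n) - (y : Rn n)) i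

lemma measurable_sobolev_integrand (s : ℝ) {u : UnitSphere n → ℝ} (hu : Continuous u) :
    Measurable fun p : UnitSphere n × UnitSphere n => ENNReal.ofReal
      (|u p.1 - u p.2| ^ 2 / ‖(p.1 : Rn n) - (p.2 : Rn n)‖ ^ ((n : ℝ) + s)) := by
  have hu' := hu.measurable
  fun_prop

lemma sum_sobolevSeminormSq_sphereCoord (s : ℝ) :
    ∑ i, sobolevSeminormSq s (sphereCoord (n := n) i)
      = ∫⁻ x : UnitSphere n, ∫⁻ y : UnitSphere n, ENNReal.ofReal
        (‖(x : Rn n) - (y : Rn n)‖ ^ 2 / ‖(x : Rn n) - (y : Rn n)‖ ^ ((n : ℝ) + s))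
        ∂(surfaceMeasure n) ∂(surfaceMeasure n) := by
  have hm := fun i => measurable_sobolev_integrand s (continuous_sphereCoord (n := n) i)
  simp only [sobolevSeminormSq]
  rw [← lintegral_finsetSum _ fun i _ => (hm i).lintegral_prod_right']
  congr with x
  rw [← lintegral_finsetSum _ fun i _ => by exact (hm i).comp measurable_prodMk_left]
  congr with y
  rw [← ENNReal.ofReal_sum_of_nonneg fun i _ => by positivity, ← Finset.sum_div,
    norm_sub_sq_eq_sum]
  simp only [sq_abs, sphereCoord]

/-- As |x-y|² is the sum of the squared coordinate differences, the coordinates dominate every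
Lipschitz function; finiteness needs to be known for them alone. -/
lemma sobolevSeminormSq_le_of_lipschitz (s : ℝ) {u : UnitSphere n → ℝ} {L : ℝ}
    (h : ∀ x y : UnitSphere n, (u x - u y) ^ 2 ≤ L * ‖(x : Rn n) - (y : Rn n)‖ ^ 2) (hL : 0 ≤ L) :
    sobolevSeminormSq s u ≤ ENNReal.ofReal L * ∑ i, sobolevSeminormSq s (sphereCoord (n := n) i) := by
  rw [sum_sobolevSeminormSq_sphereCoord, sobolevSeminormSq,
    ← lintegral_const_mul' _ _ ENNReal.ofReal_ne_top]
  refine lintegral_mono fun x => ?_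
  rw [← lintegral_const_mul' _ _ ENNReal.ofReal_ne_top]
  refine lintegral_mono fun y => ?_
  rw [← ENNReal.ofReal_mul hL, ← mul_div_assoc, sq_abs]
  gcongr
  exact h x y

lemma sum_sphereL2NormSq_sphereCoord :
    ∑ i, sphereL2NormSq (sphereCoord (n := n) i) = (surfaceMeasure n).real univ := by
  simp only [sphereL2NormSq]
  rw [← integral_finsetSum _ fun i _ => integrable_sphere (by fun_prop)]
  simp only [sphereCoord, sphere_sum_sq]
  simp

lemma ofReal_sobolev_integrand (s : ℝ) (c : ℝ) (x y : UnitSphere n) :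
    ENNReal.ofReal (|c| ^ 2 / (1 - inner ℝ (x : Rn n) (y : Rn n)) ^ (((n : ℝ) + s) / 2))
      = ENNReal.ofReal (2 ^ (((n : ℝ) + s) / 2))
        * ENNReal.ofReal (|c| ^ 2 / ‖(x : Rn n) - (y : Rn n)‖ ^ ((n : ℝ) + s)) := by
  rw [← ENNReal.ofReal_mul (by positivity), norm_sub_rpow_sphere]
  congr 1
  have : (0 : ℝ) < 2 ^ (((n : ℝ) + s) / 2) := by positivity
  field_simp

end LinearEnergy

/-! ### Translated balls as radial graphs. -/

section Translation

open Set

variable {n : ℕ}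

/-- The radial graph over the unit sphere of the boundary of the unit ball centred at `t eᵢ`, as a
function of the coordinate `c = xᵢ`. -/
noncomputable def translatedGraph (t c : ℝ) : ℝ := t * c + (√(1 - t ^ 2 * (1 - c ^ 2)) - 1)

lemma translatedGraph_arg_bounds {t c : ℝ} (ht0 : 0 ≤ t) (ht : t ≤ 1 / 8) (hc : |c| ≤ 1) :
    1 - t ^ 2 ≤ 1 - t ^ 2 * (1 - c ^ 2) ∧ 1 - t ^ 2 * (1 - c ^ 2) ≤ 1 ∧ 3 / 4 ≤ 1 - t ^ 2 := by
  have hc2 : c ^ 2 ≤ 1 := (sq_le_one_iff_abs_le_one c).2 hc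
  refine ⟨?_, ?_, ?_⟩
  · nlinarith [sq_nonneg (t * c)]
  · nlinarith [mul_nonneg (sq_nonneg t) (sub_nonneg.2 hc2)]
  · nlinarith

lemma translatedGraph_sqrt_bounds {t c : ℝ} (ht0 : 0 ≤ t) (ht : t ≤ 1 / 8) (hc : |c| ≤ 1) :
    1 - t ^ 2 ≤ √(1 - t ^ 2 * (1 - c ^ 2)) ∧ √(1 - t ^ 2 * (1 - c ^ 2)) ≤ 1 := by
  obtain ⟨h1, h2, h3⟩ := translatedGraph_arg_bounds ht0 ht hc
  refine ⟨Real.le_sqrt_of_sq_le ?_, Real.sqrt_le_one.2 h2⟩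
  nlinarith [sq_nonneg t]

lemma abs_translatedGraph_sub_le {t c : ℝ} (ht0 : 0 ≤ t) (ht : t ≤ 1 / 8) (hc : |c| ≤ 1) :
    |translatedGraph t c - t * c| ≤ t ^ 2 := by
  obtain ⟨h1, h2⟩ := translatedGraph_sqrt_bounds ht0 ht hc
  rw [translatedGraph, abs_le]
  constructor <;> linarith

lemma abs_translatedGraph_le {t c : ℝ} (ht0 : 0 ≤ t) (ht : t ≤ 1 / 8) (hc : |c| ≤ 1) :
    |translatedGraph t c| ≤ 2 * t := by
  have h1 := abs_le.1 (abs_translatedGraph_sub_le ht0 ht hc)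
  have h2 := abs_le.1 hc
  rw [abs_le]
  constructor <;> nlinarith

/-- Multiplying the difference of the two square roots by their sum, which is at least one, gives
t²|c²-d²|. So the graph is t c up to an error of order t² in the Lipschitz sense too, as the
seminorm requires. -/
lemma abs_translatedGraph_sub_sub_le {t c d : ℝ} (ht0 : 0 ≤ t) (ht : t ≤ 1 / 8) (hc : |c| ≤ 1)
    (hd : |d| ≤ 1) :
    |translatedGraph t c - translatedGraph t d - t * (c - d)| ≤ 2 * t ^ 2 * |c - d| := by
  obtain ⟨c1, c2, c3⟩ := translatedGraph_arg_bounds ht0 ht hc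
  obtain ⟨d1, d2, d3⟩ := translatedGraph_arg_bounds ht0 ht hd
  have c4 := (translatedGraph_sqrt_bounds ht0 ht hc).1
  have d4 := (translatedGraph_sqrt_bounds ht0 ht hd).1
  have c5 := Real.sq_sqrt (show 0 ≤ 1 - t ^ 2 * (1 - c ^ 2) by linarith)
  have d5 := Real.sq_sqrt (show 0 ≤ 1 - t ^ 2 * (1 - d ^ 2) by linarith)
  obtain ⟨p, hp⟩ : ∃ p, p = √(1 - t ^ 2 * (1 - c ^ 2)) := ⟨_, rfl⟩
  obtain ⟨q, hq⟩ : ∃ q, q = √(1 - t ^ 2 * (1 - d ^ 2)) := ⟨_, rfl⟩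
  rw [translatedGraph, translatedGraph, ← hp, ← hq]
  rw [← hp] at c4 c5
  rw [← hq] at d4 d5
  have e : (p - q) * (p + q) = t ^ 2 * ((c - d) * (c + d)) := by linear_combination c5 - d5
  have hpq : 1 ≤ p + q := by linarith
  have hcd : |c + d| ≤ 2 := (abs_add_le c d).trans (by linarith)
  have e2 : |p - q| * (p + q) = t ^ 2 * (|c - d| * |c + d|) := by
    rw [← abs_of_nonneg (show 0 ≤ p + q by linarith), ← abs_mul, e, abs_mul, abs_mul,
      abs_of_nonneg (sq_nonneg t)]
  calc |t * c + (p - 1) - (t * d + (q - 1)) - t * (c - d)| = |p - q| := by congr 1; ring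
    _ ≤ |p - q| * (p + q) := le_mul_of_one_le_right (abs_nonneg _) hpq
    _ = t ^ 2 * (|c - d| * |c + d|) := e2
    _ ≤ t ^ 2 * (|c - d| * 2) := by gcongr
    _ = _ := by ring

@[fun_prop]
lemma continuous_translatedGraph (t : ℝ) : Continuous (translatedGraph t) := by
  unfold translatedGraph
  fun_prop

lemma smul_mem_translated_ball_iff {t : ℝ} (ht0 : 0 ≤ t) (ht : t ≤ 1 / 8) (i : Fin n)
    (x : UnitSphere n) (r : ℝ) (hr : 0 < r) :
    r • (x : Rn n) ∈ ball (EuclideanSpace.single i t) 1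
      ↔ r < 1 + translatedGraph t (sphereCoord i x) := by
  have hc := abs_sphereCoord_le i x
  obtain ⟨c1, c2, c3⟩ := translatedGraph_arg_bounds ht0 ht hc
  have h4 := (translatedGraph_sqrt_bounds ht0 ht hc).1
  have hn2 : ‖r • (x : Rn n) - EuclideanSpace.single i t‖ ^ 2
      = (r - t * sphereCoord i x) ^ 2 + t ^ 2 * (1 - sphereCoord i x ^ 2) := by
    rw [norm_sub_sq_real, norm_smul, norm_eq_of_mem_sphere, inner_smul_left, sphere_inner_eq]
    simp [sphereCoord]
    ring
  have hiff : ‖r • (x : Rn n) - EuclideanSpace.single i t‖ < 1 ↔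
      (r - t * sphereCoord i x) ^ 2 < 1 - t ^ 2 * (1 - sphereCoord i x ^ 2) := by
    rw [← sq_lt_one_iff₀ (norm_nonneg _), hn2, lt_sub_iff_add_lt]
  rw [mem_ball, dist_eq_norm, hiff, translatedGraph]
  obtain ⟨p, hp⟩ : ∃ p, p = √(1 - t ^ 2 * (1 - sphereCoord i x ^ 2)) := ⟨_, rfl⟩
  have hp2 : p ^ 2 = 1 - t ^ 2 * (1 - sphereCoord i x ^ 2) := hp ▸ Real.sq_sqrt (by linarith)
  rw [← hp] at h4 ⊢
  have hp0 : 0 ≤ p := by linarith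
  have htc : t * sphereCoord i x ≤ t := by nlinarith [(abs_le.1 hc).2]
  rw [← hp2, sq_lt_sq, abs_of_nonneg hp0, abs_lt]
  constructor
  · rintro ⟨-, h⟩
    linarith
  · intro h
    constructor <;> nlinarith

lemma sPerimeter_ball_center (s : ℝ) (c : Rn n) :
    sPerimeter s (ball c 1) = sPerimeter s (ball (0 : Rn n) 1) := by
  have hmp := measurePreserving_sub_right (volume : Measure (Rn n)) c
  have hemb : MeasurableEmbedding fun x : Rn n => x - c := (Homeomorph.subRight c).measurableEmbedding
  have hb : ball c 1 = (fun x : Rn n => x - c) ⁻¹' ball 0 1 := by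
    ext x
    simp [dist_eq_norm]
  have hbc : (ball c 1)ᶜ = (fun x : Rn n => x - c) ⁻¹' (ball 0 1)ᶜ := by rw [hb, preimage_compl]
  rw [sPerimeter, hbc, hb, sPerimeter, ← hmp.setLIntegral_comp_preimage_emb hemb
    (fun x => ∫⁻ y in (ball (0 : Rn n) 1)ᶜ, ENNReal.ofReal (1 / ‖x - y‖ ^ ((n : ℝ) + s)))]
  refine lintegral_congr fun x => ?_
  rw [← hmp.setLIntegral_comp_preimage_emb hemb
    (fun y => ENNReal.ofReal (1 / ‖x - c - y‖ ^ ((n : ℝ) + s)))]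
  simp

end Translation

/-! ### Translation invariance bounds the linear energy from below. -/

section TranslationEnergy

open Set Filter Topology

variable {n : ℕ} [NeZero n]

/-- The translated ball has the volume and the perimeter of B, so its perimeter expansion vanishes.
-/
lemma radialInteraction_translatedGraph {s : ℝ} (hs : 0 < s) (hs1 : s < 1) (i : Fin n) {t : ℝ}
    (ht0 : 0 ≤ t) (ht : t ≤ 1 / 8) :
    radialInteraction s (fun x => translatedGraph t (sphereCoord (n := n) i x)) ≠ ∞ ∧
    (perimeterDensity n s).toReal
        * ∫ x, powerDefect n s (translatedGraph t (sphereCoord (n := n) i x)) ∂(surfaceMeasure n)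
      + (radialInteraction s (fun x => translatedGraph t (sphereCoord (n := n) i x))).toReal / 2 = 0 := by
  obtain ⟨h1, h2⟩ := sPerimeter_sub_ball hs hs1 (E := ball (EuclideanSpace.single i t) 1)
    measurableSet_ball (u := fun x => translatedGraph t (sphereCoord i x)) (by fun_prop)
    (fun x => (abs_translatedGraph_le ht0 ht (abs_sphereCoord_le i x)).trans (by linarith))
    (smul_mem_translated_ball_iff ht0 ht i) (Measure.addHaar_ball_center _ _ _)
  rw [sPerimeter_ball_center] at h1 h2
  have h3 := h1.1 (sPerimeter_ball_lt_top hs hs1).ne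
  exact ⟨h3, by rw [← h2 h3, sub_self]⟩

/-- The finite perimeter of a ball translated by 1/8 bounds the seminorm of its graph, and the graph
is comparable with the coordinate itself. -/
lemma sobolevSeminormSq_sphereCoord_ne_top {s : ℝ} (hs : 0 < s) (hs1 : s < 1) (i : Fin n) :
    sobolevSeminormSq s (sphereCoord (n := n) i) ≠ ∞ := by
  have hc := abs_sphereCoord_le (n := n) i
  have ht0 : (0 : ℝ) ≤ 1 / 8 := by norm_num
  have h1 := (radialInteraction_translatedGraph hs hs1 i ht0 le_rfl).1
  have h2 := le_lintegral_radialSquare hs hs1 (ε := 2 * (1 / 8)) (by norm_num)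
    (u := fun x => translatedGraph (1 / 8) (sphereCoord (n := n) i x))
    (fun x => abs_translatedGraph_le ht0 le_rfl (hc x)) fun x y => by
      have h3 := abs_le.1 (abs_translatedGraph_sub_sub_le ht0 le_rfl (hc x) (hc y))
      have h4 := abs_sphereCoord_sub_le i x y
      have h5 := abs_le.1 h4
      rw [abs_le]
      constructor <;> linarith
  rw [← radialInteraction] at h2
  have h3 : sobolevSeminormSq s
      (fun x => translatedGraph (1 / 8) (sphereCoord (n := n) i x)) ≠ ∞ := by
    intro h
    rw [h, ENNReal.mul_top (by
      rw [Ne, ENNReal.ofReal_eq_zero, not_le]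
      positivity)] at h2
    exact h1 (top_le_iff.1 h2)
  -- At t = 1/8 the graph has slope at least t - 2t² = 3/32 in the coordinate, hence the constant
  -- 32/3.
  refine ne_top_of_le_ne_top (ENNReal.mul_ne_top ENNReal.ofReal_ne_top h3)
    (sobolevSeminormSq_le_of_abs_sub_le s (c := 32 / 3) fun x y => ?_)
  have h4 := abs_translatedGraph_sub_sub_le ht0 le_rfl (hc x) (hc y)
  have h5 := abs_sub_abs_le_abs_sub (1 / 8 * (sphereCoord i x - sphereCoord i y))
    (translatedGraph (1 / 8) (sphereCoord i x) - translatedGraph (1 / 8) (sphereCoord i y))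
  rw [abs_sub_comm (1 / 8 * _), abs_mul, abs_of_pos (show (0 : ℝ) < 1 / 8 by norm_num)] at h5
  linarith

/-- The second variation of the `s`-perimeter under translations is nonnegative. -/
lemma perimeterDensity_mul_le_sobolevSeminormSq_sphereCoord {s : ℝ} (hs : 0 < s) (hs1 : s < 1)
    (i : Fin n) :
    (perimeterDensity n s).toReal * (s * (n - s)) * sphereL2NormSq (sphereCoord (n := n) i)
      ≤ (sobolevSeminormSq s (sphereCoord (n := n) i)).toReal := by
  have hn : (1 : ℝ) ≤ n := by exact_mod_cast NeZero.one_le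
  have hc := abs_sphereCoord_le (n := n) i
  obtain ⟨κ, hκ⟩ : ∃ κ, κ = (perimeterDensity n s).toReal := ⟨_, rfl⟩
  obtain ⟨Z, hZ⟩ : ∃ Z, Z = (sobolevSeminormSq s (sphereCoord (n := n) i)).toReal := ⟨_, rfl⟩
  obtain ⟨m, hm⟩ : ∃ m, m = sphereL2NormSq (sphereCoord (n := n) i) := ⟨_, rfl⟩
  obtain ⟨σ, hσ⟩ : ∃ σ, σ = (surfaceMeasure n).real univ := ⟨_, rfl⟩
  have hκ0 : 0 ≤ κ := hκ ▸ ENNReal.toReal_nonneg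
  have hZtop := sobolevSeminormSq_sphereCoord_ne_top hs hs1 i
  rw [← hκ, ← hZ, ← hm]
  obtain ⟨C, hC⟩ : ∃ C : ℝ, C = n * (n + 2) * 2 ^ n := ⟨_, rfl⟩
  obtain ⟨K, hK⟩ : ∃ K : ℝ, K = κ * ((s * (n - s) * 3 + 16 * (C * s)) * σ) := ⟨_, rfl⟩
  let F (t : ℝ) : ℝ := (1 + 2 * t) ^ (2 * (n - 1)) / (1 - 2 * t) ^ (n + 1) * ((1 + 2 * t) ^ 2 * Z)
  -- This is the vanishing expansion divided by t²: F bounds the square term and tK collects the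
  -- cubic errors. It is then sent to t = 0, where F equals Z.
  have key : ∀ t ∈ Ioo (0 : ℝ) (1 / 8), κ * (s * (n - s)) * m - t * K ≤ F t := by
    intro t ht
    have ht0 := ht.1.le
    have ht8 := ht.2.le
    obtain ⟨h1, h2⟩ := radialInteraction_translatedGraph hs hs1 i ht0 ht8
    have h2t : 0 < 1 - 2 * t := by linarith
    have hD : (radialInteraction s (fun x => translatedGraph t (sphereCoord (n := n) i x))).toReal
        ≤ t ^ 2 * F t := by
      have a1 := lintegral_radialSquare_le hs hs1 (ε := 2 * t) (by linarith)
        (u := fun x => translatedGraph t (sphereCoord (n := n) i x))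
        (fun x => abs_translatedGraph_le ht0 ht8 (hc x))
      have a2 := sobolevSeminormSq_le_of_abs_sub_le s (c := t * (1 + 2 * t))
        (u := fun x => translatedGraph t (sphereCoord (n := n) i x)) (v := sphereCoord i)
        fun x y => by
          have h4 := abs_translatedGraph_sub_sub_le ht0 ht8 (hc x) (hc y)
          have h5 := abs_sub_abs_le_abs_sub
            (translatedGraph t (sphereCoord i x) - translatedGraph t (sphereCoord i y))
            (t * (sphereCoord i x - sphereCoord i y))
          rw [abs_mul, abs_of_nonneg ht0] at h5
          nlinarith
      rw [← radialInteraction] at a1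
      have a3 := a1.trans (mul_le_mul_right a2 _)
      have a4 := ENNReal.toReal_mono (ENNReal.mul_ne_top ENNReal.ofReal_ne_top
        (ENNReal.mul_ne_top ENNReal.ofReal_ne_top hZtop)) a3
      rw [ENNReal.toReal_mul, ENNReal.toReal_mul, ← hZ, ENNReal.toReal_ofReal (by positivity),
        ENNReal.toReal_ofReal (by positivity)] at a4
      refine a4.trans_eq ?_
      simp only [F]
      ring
    have hψ : ∫ x, powerDefect n s (translatedGraph t (sphereCoord (n := n) i x)) ∂(surfaceMeasure n)
        ≤ -(s * (n - s) / 2 * t ^ 2 * m) + (s * (n - s) / 2 * (3 * t ^ 3) + C * s * (8 * t ^ 3)) * σ := by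
      have hcont : Continuous fun x =>
          powerDefect n s (translatedGraph t (sphereCoord (n := n) i x)) := by
        unfold powerDefect
        have : Continuous fun x =>
            (1 + translatedGraph t (sphereCoord (n := n) i x)) ^ ((n : ℝ) - s) :=
          Continuous.rpow_const (by fun_prop) fun x => .inl (by
            linarith [(abs_le.1 (abs_translatedGraph_le ht0 ht8 (hc x))).1])
        fun_prop
      have hpt : ∀ x, powerDefect n s (translatedGraph t (sphereCoord (n := n) i x))
          ≤ -(s * (n - s) / 2 * t ^ 2) * sphereCoord i x ^ 2
            + (s * (n - s) / 2 * (3 * t ^ 3) + C * s * (8 * t ^ 3)) := by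
        intro x
        have b1 := abs_translatedGraph_le ht0 ht8 (hc x)
        have b2 := abs_translatedGraph_sub_le ht0 ht8 (hc x)
        have b3 := abs_powerDefect_add_le (n := n) NeZero.one_le hs hs1
          (v := translatedGraph t (sphereCoord i x)) (by linarith)
        rw [← hC] at b3
        obtain ⟨v, hv⟩ : ∃ v, v = translatedGraph t (sphereCoord i x) := ⟨_, rfl⟩
        rw [← hv] at b1 b2 b3 ⊢
        have b4 : |v| ^ 3 ≤ 8 * t ^ 3 :=
          (pow_le_pow_left₀ (abs_nonneg v) b1 3).trans_eq (by ring)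
        have b5 : t ^ 2 * sphereCoord i x ^ 2 - v ^ 2 ≤ 3 * t ^ 3 := by
          have c1 : |v + t * sphereCoord i x| ≤ 3 * t := by
            refine (abs_add_le _ _).trans ?_
            rw [abs_mul, abs_of_nonneg ht0]
            nlinarith [hc x]
          calc t ^ 2 * sphereCoord i x ^ 2 - v ^ 2
              ≤ |(v - t * sphereCoord i x) * (v + t * sphereCoord i x)| := by
                refine le_trans (le_of_eq ?_) (neg_le_abs _)
                ring
            _ ≤ t ^ 2 * (3 * t) := by
                rw [abs_mul]
                gcongr
            _ = _ := by ring
        have b6 : 0 ≤ s * (n - s) / 2 := by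
          have := mul_nonneg hs.le (show (0 : ℝ) ≤ n - s by linarith)
          linarith
        have b7 := mul_le_mul_of_nonneg_left b5 b6
        have hC0 : 0 ≤ C * s := by rw [hC]; positivity
        have b8 := mul_le_mul_of_nonneg_left b4 hC0
        have b9 := (abs_le.1 b3).2
        linarith
      calc _ ≤ ∫ x, (-(s * (n - s) / 2 * t ^ 2) * sphereCoord i x ^ 2
            + (s * (n - s) / 2 * (3 * t ^ 3) + C * s * (8 * t ^ 3))) ∂(surfaceMeasure n) :=
            integral_mono (integrable_sphere hcont) (integrable_sphere (by fun_prop)) hpt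
        _ = _ := by
            rw [integral_add (integrable_sphere (by fun_prop)) (integrable_const _),
              integral_const_mul, integral_const, ← hσ, smul_eq_mul, hm, sphereL2NormSq]
            ring
    rw [← hκ] at h2
    have h3 := mul_le_mul_of_nonneg_left hψ hκ0
    have h4 : t ^ 2 * (κ * (s * (n - s)) * m - t * K) ≤ t ^ 2 * F t := by
      rw [hK]
      linarith
    exact le_of_mul_le_mul_left h4 (by have := ht.1; positivity)
  have l1 : Tendsto (fun t : ℝ => κ * (s * (n - s)) * m - t * K) (𝓝[>] 0)
      (𝓝 (κ * (s * (n - s)) * m - 0 * K)) :=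
    Continuous.tendsto' (by fun_prop) _ _ rfl |>.mono_left nhdsWithin_le_nhds
  have l2 : Tendsto F (𝓝[>] 0) (𝓝 (F 0)) := by
    refine ContinuousAt.tendsto ?_ |>.mono_left nhdsWithin_le_nhds
    have : (1 - 2 * (0 : ℝ)) ^ (n + 1) ≠ 0 := by simp
    fun_prop (disch := assumption)
  have := le_of_tendsto_of_tendsto l1 l2
    (by filter_upwards [Ioo_mem_nhdsGT (show (0 : ℝ) < 1 / 8 by norm_num)] using key)
  simpa [F] using this

/-- The energy `[xᵢ]²` of the coordinate functions, summed over `i` and divided by `|∂B|`. -/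
noncomputable def linearEnergy (n : ℕ) (s : ℝ) : ℝ :=
  (∑ i, sobolevSeminormSq s (sphereCoord (n := n) i)).toReal / (surfaceMeasure n).real univ

lemma sum_sobolevSeminormSq_sphereCoord_ne_top {s : ℝ} (hs : 0 < s) (hs1 : s < 1) :
    ∑ i, sobolevSeminormSq s (sphereCoord (n := n) i) ≠ ∞ :=
  ENNReal.sum_ne_top.2 fun i _ => sobolevSeminormSq_sphereCoord_ne_top hs hs1 i

lemma toReal_sum_sobolevSeminormSq_sphereCoord (s : ℝ) :
    (∑ i, sobolevSeminormSq s (sphereCoord (n := n) i)).toReal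
      = (surfaceMeasure n).real univ * linearEnergy n s := by
  have := (surfaceMeasure_real_univ_pos (n := n)).ne'
  rw [linearEnergy]
  field_simp

lemma mul_perimeterDensity_le_linearEnergy {s : ℝ} (hs : 0 < s) (hs1 : s < 1) :
    s * (n - s) * (perimeterDensity n s).toReal ≤ linearEnergy n s := by
  have h := Finset.sum_le_sum fun i (_ : i ∈ Finset.univ) =>
    perimeterDensity_mul_le_sobolevSeminormSq_sphereCoord (n := n) hs hs1 i
  rw [← Finset.mul_sum, sum_sphereL2NormSq_sphereCoord, ← ENNReal.toReal_sum fun i _ =>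
    sobolevSeminormSq_sphereCoord_ne_top hs hs1 i] at h
  rw [linearEnergy, le_div_iff₀ surfaceMeasure_real_univ_pos]
  linarith

end TranslationEnergy

/-! ### The spectral gap in terms of the Sobolev seminorm. -/

section SpectralGapSobolev

open Set

variable {n : ℕ} [NeZero n]

/-- Since |x-y|² = 2(1 - x·y), the exponent is a = (n+s)/2. The seminorm rescales by 2^(-a), and L
is 2^(1-a) times the integral ℓ of `spectral_gap_kernel`, so the powers of two cancel. -/
lemma spectral_gap_sobolev (hn : 2 ≤ n) {s : ℝ} (hs : 0 < s) (hs1 : s < 1)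
    {v : UnitSphere n → ℝ} (hv : Continuous v)
    (h0 : ∫ x, v x ∂(surfaceMeasure n) = 0)
    (h1 : ∀ i, ∫ x : UnitSphere n, sphereCoord i x * v x ∂(surfaceMeasure n) = 0)
    (hQ : sobolevSeminormSq s v ≠ ∞) :
    (1 + 2 / n) * linearEnergy n s * sphereL2NormSq v ≤ (sobolevSeminormSq s v).toReal := by
  have hn2 : (2 : ℝ) ≤ n := by exact_mod_cast hn
  obtain ⟨a, ha⟩ : ∃ a, a = ((n : ℝ) + s) / 2 := ⟨_, rfl⟩
  obtain ⟨e⟩ : Nonempty (UnitSphere n) := inferInstance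
  have hinner : ∀ x y : UnitSphere n, 0 ≤ 1 - inner ℝ (x : Rn n) (y : Rn n) := fun x y =>
    sub_nonneg.2 (abs_le.1 (abs_inner_sphere_le x y)).2
  have hval : ∫⁻ p : UnitSphere n × UnitSphere n, ENNReal.ofReal
      ((v p.1 - v p.2) ^ 2 / (1 - inner ℝ (p.1 : Rn n) (p.2 : Rn n)) ^ a)
        ∂((surfaceMeasure n).prod (surfaceMeasure n))
      = ENNReal.ofReal (2 ^ a) * sobolevSeminormSq s v := by
    rw [sobolevSeminormSq, ← lintegral_const_mul' _ _ ENNReal.ofReal_ne_top,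
      lintegral_prod _ (by have := hv.measurable; fun_prop)]
    refine lintegral_congr fun x => ?_
    rw [← lintegral_const_mul' _ _ ENNReal.ofReal_ne_top]
    refine lintegral_congr fun y => ?_
    rw [ha, ← ofReal_sobolev_integrand, sq_abs]
  have hvalI : (surfaceMeasure n univ) * ∫⁻ y : UnitSphere n, ENNReal.ofReal
      ((1 - inner ℝ (e : Rn n) (y : Rn n)) * (1 / (1 - inner ℝ (e : Rn n) (y : Rn n)) ^ a))
        ∂(surfaceMeasure n)
      = ENNReal.ofReal (2 ^ a / 2) * ∑ i, sobolevSeminormSq s (sphereCoord (n := n) i) := by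
    rw [sum_sobolevSeminormSq_sphereCoord]
    have hc : ∀ x : UnitSphere n, ∫⁻ y : UnitSphere n, ENNReal.ofReal
        (‖(x : Rn n) - (y : Rn n)‖ ^ 2 / ‖(x : Rn n) - (y : Rn n)‖ ^ ((n : ℝ) + s))
        ∂(surfaceMeasure n) = ∫⁻ y : UnitSphere n, ENNReal.ofReal
        (‖(e : Rn n) - (y : Rn n)‖ ^ 2 / ‖(e : Rn n) - (y : Rn n)‖ ^ ((n : ℝ) + s))
        ∂(surfaceMeasure n) := fun x =>
      lintegral_sphere_const (F := fun x y => ENNReal.ofReal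
        (‖x - y‖ ^ 2 / ‖x - y‖ ^ ((n : ℝ) + s))) (by simp [← map_sub]) x e
    simp only [hc]
    rw [lintegral_const, mul_comm _ (surfaceMeasure n univ), mul_left_comm,
      ← lintegral_const_mul' _ _ ENNReal.ofReal_ne_top]
    congr 1
    refine lintegral_congr fun y => ?_
    rw [← ENNReal.ofReal_mul (by positivity), norm_sub_rpow_sphere, norm_sub_sq_sphere, ← ha]
    congr 1
    have : (0 : ℝ) < 2 ^ a := by positivity
    field_simp
  have hσ0 := surfaceMeasure_univ_ne_zero (n := n)
  have hfinI : ∫⁻ y : UnitSphere n, ENNReal.ofReal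
      ((1 - inner ℝ (e : Rn n) (y : Rn n)) * (1 / (1 - inner ℝ (e : Rn n) (y : Rn n)) ^ a))
        ∂(surfaceMeasure n) ≠ ∞ := by
    intro h
    rw [h, ENNReal.mul_top hσ0] at hvalI
    exact ENNReal.mul_ne_top ENNReal.ofReal_ne_top
      (sum_sobolevSeminormSq_sphereCoord_ne_top hs hs1) hvalI.symm
  have nnQ : ∀ p : UnitSphere n × UnitSphere n,
      0 ≤ (v p.1 - v p.2) ^ 2 / (1 - inner ℝ (p.1 : Rn n) (p.2 : Rn n)) ^ a := fun p =>
    div_nonneg (sq_nonneg _) (Real.rpow_nonneg (hinner _ _) _)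
  have nnI : ∀ y : UnitSphere n, 0 ≤
      (1 - inner ℝ (e : Rn n) (y : Rn n)) * (1 / (1 - inner ℝ (e : Rn n) (y : Rn n)) ^ a) := fun y =>
    mul_nonneg (hinner _ _) (div_nonneg zero_le_one (Real.rpow_nonneg (hinner _ _) _))
  have mQ : AEStronglyMeasurable (fun p : UnitSphere n × UnitSphere n =>
      (v p.1 - v p.2) ^ 2 / (1 - inner ℝ (p.1 : Rn n) (p.2 : Rn n)) ^ a)
      ((surfaceMeasure n).prod (surfaceMeasure n)) :=
    Measurable.aestronglyMeasurable (by have := hv.measurable; fun_prop)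
  have mI : AEStronglyMeasurable (fun y : UnitSphere n =>
      (1 - inner ℝ (e : Rn n) (y : Rn n)) * (1 / (1 - inner ℝ (e : Rn n) (y : Rn n)) ^ a))
      (surfaceMeasure n) := Measurable.aestronglyMeasurable (by fun_prop)
  have key := spectral_gap_kernel hn (a := a) (by rw [ha]; linarith) (by rw [ha]; linarith)
    (by rw [ha]; linarith) e hv h0 h1
    ((lintegral_ofReal_ne_top_iff_integrable mQ (ae_of_all _ nnQ)).1 (by
      rw [hval]
      exact ENNReal.mul_ne_top ENNReal.ofReal_ne_top hQ))
    ((lintegral_ofReal_ne_top_iff_integrable mI (ae_of_all _ nnI)).1 hfinI)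
  rw [integral_eq_lintegral_of_nonneg_ae (ae_of_all _ nnQ) mQ, hval,
    integral_eq_lintegral_of_nonneg_ae (ae_of_all _ nnI) mI, ENNReal.toReal_mul,
    ENNReal.toReal_ofReal (by positivity)] at key
  have hI2 := congrArg ENNReal.toReal hvalI
  rw [ENNReal.toReal_mul, ENNReal.toReal_mul, ENNReal.toReal_ofReal (by positivity),
    toReal_sum_sobolevSeminormSq_sphereCoord, ← measureReal_def, mul_left_comm] at hI2
  have hI3 := mul_left_cancel₀ (surfaceMeasure_real_univ_pos (n := n)).ne' hI2
  rw [hI3] at key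
  have h2a : (0 : ℝ) < 2 ^ a := by positivity
  refine le_of_mul_le_mul_left ?_ h2a
  linarith

end SpectralGapSobolev

/-! ### From the C¹ norm to a Lipschitz bound. -/

section RadialExtension

open Set

variable {n : ℕ} {u : UnitSphere n → ℝ}

lemma radialExtension_coe (u : UnitSphere n → ℝ) (x : UnitSphere n) :
    radialExtension u (x : Rn n) = u x := by
  rw [radialExtension, norm_eq_of_mem_sphere, inv_one, one_smul,
    Subtype.val_injective.extend_apply]

lemma radialExtension_smul (u : UnitSphere n → ℝ) {r : ℝ} (hr : 0 < r) (z : Rn n) :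
    radialExtension u (r • z) = radialExtension u z := by
  rw [radialExtension, radialExtension, norm_smul, Real.norm_of_nonneg hr.le, smul_smul,
    mul_inv, mul_right_comm, inv_mul_cancel₀ hr.ne', one_mul]

lemma IsC1OnSphere.continuous (hu : IsC1OnSphere u) : Continuous u := by
  have h : Continuous fun x : UnitSphere n => radialExtension u (x : Rn n) :=
    hu.continuousOn.comp_continuous continuous_subtype_val fun x => by
      simpa using ne_zero_of_mem_unit_sphere x
  simpa only [radialExtension_coe] using h

lemma IsC1OnSphere.differentiableAt (hu : IsC1OnSphere u) {z : Rn n} (hz : z ≠ 0) :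
    DifferentiableAt ℝ (radialExtension u) z :=
  (hu.differentiableOn one_ne_zero).differentiableAt (isOpen_compl_singleton.mem_nhds hz)

lemma abs_lt_of_sphereC1Norm_lt {ε : ℝ} (h : sphereC1Norm u < ENNReal.ofReal ε)
    (x : UnitSphere n) : |u x| < ε := by
  have h1 : ENNReal.ofReal |u x| < ENNReal.ofReal ε :=
    ((le_iSup (fun x => ENNReal.ofReal |u x|) x).trans le_self_add).trans_lt h
  exact (ENNReal.ofReal_lt_ofReal_iff_of_nonneg (abs_nonneg _)).1 h1

lemma norm_fderiv_lt_of_sphereC1Norm_lt {ε : ℝ} (h : sphereC1Norm u < ENNReal.ofReal ε)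
    (x : UnitSphere n) : ‖fderiv ℝ (radialExtension u) (x : Rn n)‖ < ε := by
  have h1 : ENNReal.ofReal ‖fderiv ℝ (radialExtension u) (x : Rn n)‖ < ENNReal.ofReal ε :=
    ((le_iSup (fun x : UnitSphere n =>
      ENNReal.ofReal ‖fderiv ℝ (radialExtension u) (x : Rn n)‖) x).trans le_add_self).trans_lt h
  exact (ENNReal.ofReal_lt_ofReal_iff_of_nonneg (norm_nonneg _)).1 h1

/-- The extension is homogeneous of degree zero, so its derivative is homogeneous of degree -1. -/
lemma norm_fderiv_radialExtension_le (hu : IsC1OnSphere u) {ε : ℝ}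
    (h : sphereC1Norm u < ENNReal.ofReal ε) {z : Rn n} (hz : z ≠ 0) :
    ‖fderiv ℝ (radialExtension u) z‖ ≤ ε * ‖z‖⁻¹ := by
  have hz' : 0 < ‖z‖⁻¹ := inv_pos.2 (norm_pos_iff.2 hz)
  obtain ⟨x, hx⟩ : ∃ x : UnitSphere n, (x : Rn n) = ‖z‖⁻¹ • z :=
    ⟨⟨‖z‖⁻¹ • z, by simp [norm_smul, norm_ne_zero_iff.2 hz]⟩, rfl⟩
  have h1 : HasFDerivAt (radialExtension u) (fderiv ℝ (radialExtension u) (x : Rn n))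
      (‖z‖⁻¹ • z) := by
    rw [← hx]
    exact (hu.differentiableAt (ne_zero_of_mem_unit_sphere x)).hasFDerivAt
  have h2 := h1.comp z ((hasFDerivAt_id (𝕜 := ℝ) z).const_smul ‖z‖⁻¹)
  have h3 : (radialExtension u ∘ fun y : Rn n => ‖z‖⁻¹ • y) = radialExtension u :=
    funext fun y => radialExtension_smul u hz' y
  have h4 : HasFDerivAt (radialExtension u) _ z := h3 ▸ h2
  rw [h4.fderiv]
  refine (ContinuousLinearMap.opNorm_comp_le _ _).trans ?_
  rw [norm_smul, Real.norm_of_nonneg hz'.le]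
  have h5 := ContinuousLinearMap.norm_id_le (𝕜 := ℝ) (E := Rn n)
  have h6 := (norm_fderiv_lt_of_sphereC1Norm_lt h x).le
  calc _ ≤ ε * (‖z‖⁻¹ * 1) := by
        gcongr
        exact (norm_nonneg _).trans h6
    _ = _ := by ring

/-- If |x-y| ≤ 1, the chord stays outside the ball of radius 1/2, where the derivative is at most
2ε; otherwise the bound on sup |u| suffices. -/
lemma abs_sub_le_of_sphereC1Norm_lt (hu : IsC1OnSphere u) {ε : ℝ}
    (h : sphereC1Norm u < ENNReal.ofReal ε) (x y : UnitSphere n) :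
    |u x - u y| ≤ 2 * ε * ‖(x : Rn n) - (y : Rn n)‖ := by
  have hux := abs_lt_of_sphereC1Norm_lt h x
  have huy := abs_lt_of_sphereC1Norm_lt h y
  have hε : 0 < ε := (abs_nonneg _).trans_lt hux
  by_cases hxy : ‖(x : Rn n) - (y : Rn n)‖ ≤ 1
  · have hseg : ∀ z ∈ segment ℝ (y : Rn n) (x : Rn n), 1 / 2 ≤ ‖z‖ := by
      intro z hz
      have h1 := dist_add_dist_of_mem_segment hz
      have h2 : ‖(y : Rn n)‖ - ‖z‖ ≤ dist (y : Rn n) z := by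
        rw [dist_eq_norm]
        exact norm_sub_norm_le _ _
      have h3 : ‖(x : Rn n)‖ - ‖z‖ ≤ dist z (x : Rn n) := by
        rw [dist_comm, dist_eq_norm]
        exact norm_sub_norm_le _ _
      rw [norm_eq_of_mem_sphere] at h2 h3
      rw [dist_comm (y : Rn n) x, dist_eq_norm (x : Rn n)] at h1
      linarith
    have hne : ∀ z ∈ segment ℝ (y : Rn n) (x : Rn n), z ≠ 0 := fun z hz h0 => by
      have := hseg z hz
      rw [h0, norm_zero] at this
      linarith
    have := Convex.norm_image_sub_le_of_norm_hasFDerivWithin_le (𝕜 := ℝ) (C := 2 * ε)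
      (fun z hz => (hu.differentiableAt (hne z hz)).hasFDerivAt.hasFDerivWithinAt)
      (fun z hz => by
        refine (norm_fderiv_radialExtension_le hu h (hne z hz)).trans ?_
        rw [mul_comm 2]
        gcongr
        rw [inv_le_comm₀ (norm_pos_iff.2 (hne z hz)) two_pos]
        have := hseg z hz
        linarith)
      (convex_segment (y : Rn n) (x : Rn n)) (left_mem_segment ℝ _ _) (right_mem_segment ℝ _ _)
    rwa [radialExtension_coe, radialExtension_coe, Real.norm_eq_abs] at this
  · have h1 : |u x - u y| ≤ 2 * ε := (abs_sub _ _).trans (by linarith)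
    refine h1.trans (le_mul_of_one_le_right (by linarith) (by linarith))

end RadialExtension

/-! ### A nearly spherical set is star-shaped. -/

section StarShaped

open Set

variable {n : ℕ}

lemma IsPreconnected.subset_of_disjoint_frontier {X : Type*} [TopologicalSpace X] {s t : Set X}
    (ht : IsPreconnected t) (hs : IsOpen s) (hd : Disjoint t (frontier s)) (hne : (t ∩ s).Nonempty) :
    t ⊆ s := by
  refine ht.subset_left_of_subset_union hs isClosed_closure.isOpen_compl
    (disjoint_compl_right.mono_left subset_closure) (fun z hz => ?_) hne
  by_cases h : z ∈ s
  · exact Or.inl h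
  · refine Or.inr fun h' => disjoint_left.1 hd hz ?_
    rw [hs.frontier_eq]
    exact ⟨h', h⟩

lemma smul_coe_sphere_injective {x y : UnitSphere n} {a b : ℝ} (ha : 0 ≤ a) (hb : 0 < b)
    (h : a • (x : Rn n) = b • (y : Rn n)) : a = b ∧ x = y := by
  have h1 := congrArg norm h
  rw [norm_smul, norm_smul, norm_eq_of_mem_sphere, norm_eq_of_mem_sphere, mul_one, mul_one,
    Real.norm_of_nonneg ha, Real.norm_of_nonneg hb.le] at h1
  refine ⟨h1, Subtype.ext ?_⟩
  rw [h1] at h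
  exact smul_right_injective _ hb.ne' h

/-- Each ray meets the frontier only at radius 1+u(x), so the pieces before and after it lie wholly
inside or outside E. Boundedness excludes the outer pieces. Nonemptiness then puts some inner piece
in E, and all inner pieces share the origin. -/
lemma IsNearlySpherical.smul_mem_iff {E : Set (Rn n)} {u : UnitSphere n → ℝ}
    (hE : IsNearlySpherical E u) (hne : E.Nonempty) (hu : ∀ x, |u x| < 1) (x : UnitSphere n) (r : ℝ)
    (hr : 0 < r) : r • (x : Rn n) ∈ E ↔ r < 1 + u x := by
  have hpos : ∀ x, 0 < 1 + u x := fun x => by linarith [(abs_lt.1 (hu x)).1]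
  have hfr : ∀ (x : UnitSphere n) (r : ℝ), 0 ≤ r → r • (x : Rn n) ∈ frontier E → r = 1 + u x := by
    intro x r hr h
    rw [hE.frontier_eq] at h
    obtain ⟨y, hy⟩ := h
    obtain ⟨h1, rfl⟩ := smul_coe_sphere_injective hr (hpos y) hy.symm
    exact h1
  have hcont : ∀ x : UnitSphere n, Continuous fun r : ℝ => r • (x : Rn n) := fun x => by fun_prop
  have hin : ∀ x : UnitSphere n, ((fun r : ℝ => r • (x : Rn n)) '' Ico 0 (1 + u x) ∩ E).Nonempty →
      (fun r : ℝ => r • (x : Rn n)) '' Ico 0 (1 + u x) ⊆ E := fun x =>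
    (isPreconnected_Ico.image _ (hcont x).continuousOn).subset_of_disjoint_frontier hE.isOpen (by
      rw [disjoint_left]
      rintro _ ⟨r, hr, rfl⟩ h
      exact hr.2.ne (hfr x r hr.1 h))
  have hout : ∀ (x : UnitSphere n) (r : ℝ), 1 + u x < r → r • (x : Rn n) ∉ E := by
    intro x r hr h
    have hsub := (isPreconnected_Ioi.image _ (hcont x).continuousOn).subset_of_disjoint_frontier
      (t := (fun r : ℝ => r • (x : Rn n)) '' Ioi (1 + u x)) hE.isOpen (by
      rw [disjoint_left]
      rintro _ ⟨r, hr, rfl⟩ h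
      exact (mem_Ioi.1 hr).ne' (hfr x r ((hpos x).trans hr).le h)) ⟨_, ⟨r, hr, rfl⟩, h⟩
    obtain ⟨C, hC⟩ := hE.isBounded.exists_norm_le
    have h1 := hC _ (hsub ⟨max r (C + 1), lt_max_of_lt_left hr, rfl⟩)
    rw [norm_smul, norm_eq_of_mem_sphere, mul_one] at h1
    linarith [le_max_right r (C + 1), le_abs_self (max r (C + 1)), Real.norm_eq_abs (max r (C + 1))]
  have hbd : ∀ x : UnitSphere n, (1 + u x) • (x : Rn n) ∉ E := fun x h => by
    have h1 : (1 + u x) • (x : Rn n) ∈ frontier E := hE.frontier_eq ▸ mem_range_self x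
    rw [hE.isOpen.frontier_eq] at h1
    exact h1.2 h
  have h0 : (0 : Rn n) ∈ E := by
    obtain ⟨z, hz⟩ := hne
    by_cases hz0 : z = 0
    · exact hz0 ▸ hz
    have hz0' : ‖z‖ ≠ 0 := norm_ne_zero_iff.2 hz0
    obtain ⟨y, hy⟩ : ∃ y : UnitSphere n, z = ‖z‖ • (y : Rn n) :=
      ⟨⟨‖z‖⁻¹ • z, by simp [norm_smul, hz0']⟩, by simp [smul_smul, hz0']⟩
    rw [hy] at hz
    have hlt : ‖z‖ < 1 + u y := by
      rcases lt_trichotomy ‖z‖ (1 + u y) with h | h | h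
      · exact h
      · exact absurd (h ▸ hz) (hbd y)
      · exact absurd hz (hout y _ h)
    exact hin y ⟨_, ⟨‖z‖, ⟨norm_nonneg z, hlt⟩, rfl⟩, hz⟩ ⟨0, ⟨le_rfl, hpos y⟩, zero_smul _ _⟩
  constructor
  · intro h
    rcases lt_trichotomy r (1 + u x) with h' | h' | h'
    · exact h'
    · exact absurd (h' ▸ h) (hbd x)
    · exact absurd h (hout x r h')
  · intro h
    exact hin x ⟨0, ⟨0, ⟨le_rfl, hpos x⟩, zero_smul _ _⟩, h0⟩ ⟨r, ⟨hr.le, h⟩, rfl⟩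

end StarShaped

/-! ### The barycenter condition on the sphere. -/

section Barycenter

open Set

variable {n : ℕ} [NeZero n]

/-- Used with c = 1 and c = -1, for the positive and negative parts of the coordinate. -/
lemma lintegral_coord_eq {E : Set (Rn n)} (hE : MeasurableSet E) {R : UnitSphere n → ℝ}
    (hR0 : ∀ x, 0 < R x)
    (hER : ∀ (x : UnitSphere n) (r : ℝ), 0 < r → (r • (x : Rn n) ∈ E ↔ r < R x)) (c : ℝ) (i : Fin n) :
    ∫⁻ z in E, ENNReal.ofReal (c * z i)
      = ∫⁻ x, ENNReal.ofReal (c * (R x ^ (n + 1) / (n + 1) * sphereCoord i x))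
        ∂(surfaceMeasure n) := by
  have hn : 1 ≤ n := NeZero.one_le
  rw [← lintegral_indicator hE, lintegral_polar
    (Measurable.indicator (by fun_prop) hE)]
  refine lintegral_congr fun x => ?_
  have hI : Ioo 0 (R x) = Iio (R x) ∩ Ioi 0 := by ext; simp [and_comm]
  have e : ∫⁻ r in Ioi (0 : ℝ), ENNReal.ofReal (r ^ (n - 1))
        * E.indicator (fun z => ENNReal.ofReal (c * z i)) (r • (x : Rn n))
      = ∫⁻ r in Ioo 0 (R x), ENNReal.ofReal (r ^ n) * ENNReal.ofReal (c * sphereCoord i x) := by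
    rw [hI, ← setLIntegral_indicator measurableSet_Iio]
    refine setLIntegral_congr_fun measurableSet_Ioi fun r hr => ?_
    have hr0 : 0 < r := hr
    by_cases h : r < R x
    · rw [indicator_of_mem (show r ∈ Iio (R x) from h), indicator_of_mem ((hER x r hr).2 h),
        ← ENNReal.ofReal_mul (by positivity), ← ENNReal.ofReal_mul (by positivity)]
      congr 1
      simp only [PiLp.smul_apply, smul_eq_mul, sphereCoord]
      calc r ^ (n - 1) * (c * (r * (x : Rn n) i)) = r ^ (n - 1 + 1) * (c * (x : Rn n) i) := by ring
        _ = _ := by rw [Nat.sub_add_cancel hn]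
    · rw [indicator_of_notMem (show r ∉ Iio (R x) from h),
        indicator_of_notMem (fun h' => h ((hER x r hr).1 h')), mul_zero]
  rw [e, lintegral_mul_const' _ _ ENNReal.ofReal_ne_top, lintegral_Ioo_pow (hR0 x).le,
    ← ENNReal.ofReal_mul (by have := hR0 x; positivity)]
  congr 1
  ring

lemma integral_coord_mul_pow_eq_zero {E : Set (Rn n)} (hE : MeasurableSet E)
    (hEb : Bornology.IsBounded E) {R : UnitSphere n → ℝ} (hR : Continuous R) (hR0 : ∀ x, 0 < R x)
    (hER : ∀ (x : UnitSphere n) (r : ℝ), 0 < r → (r • (x : Rn n) ∈ E ↔ r < R x))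
    (hbar : (∫ x in E, x) = 0) (i : Fin n) :
    ∫ x, sphereCoord i x * R x ^ (n + 1) ∂(surfaceMeasure n) = 0 := by
  have hid : IntegrableOn (fun z : Rn n => z) E :=
    (continuous_id.continuousOn.integrableOn_compact
      hEb.isCompact_closure).mono_set subset_closure
  have hi : IntegrableOn (fun z : Rn n => z i) E :=
    (EuclideanSpace.proj (𝕜 := ℝ) i).integrable_comp hid
  have h1 : ∫ z in E, (z : Rn n) i = 0 := by
    have := (EuclideanSpace.proj (𝕜 := ℝ) i).integral_comp_comm hid
    rw [hbar, map_zero] at this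
    exact this
  have hpos := lintegral_coord_eq hE hR0 hER 1 i
  have hneg := lintegral_coord_eq hE hR0 hER (-1) i
  simp only [one_mul, neg_one_mul] at hpos hneg
  have hS : Integrable (fun x => R x ^ (n + 1) / (n + 1) * sphereCoord i x) (surfaceMeasure n) :=
    integrable_sphere (by fun_prop)
  rw [integral_eq_lintegral_pos_part_sub_lintegral_neg_part hi, hpos, hneg,
    ← integral_eq_lintegral_pos_part_sub_lintegral_neg_part hS] at h1
  have hn : ((n : ℝ) + 1) ≠ 0 := by positivity
  calc _ = ((n : ℝ) + 1) * ∫ x, R x ^ (n + 1) / (n + 1) * sphereCoord i x ∂(surfaceMeasure n) := by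
        rw [← integral_const_mul]
        congr with x
        field_simp
    _ = 0 := by rw [h1, mul_zero]

end Barycenter

/-! ### Near-orthogonality to the affine functions. -/

section LinearPart

open Set

variable {n : ℕ}

lemma abs_one_add_pow_sub_le {v : ℝ} (hv : |v| ≤ 1) (k : ℕ) :
    |(1 + v) ^ k - 1 - k * v| ≤ k ^ 2 * 2 ^ k * v ^ 2 := by
  induction k with
  | zero => simp
  | succ k ih =>
    have e : (1 + v) ^ (k + 1) - 1 - ((k + 1 : ℕ) : ℝ) * v
        = ((1 + v) ^ k - 1 - k * v) + v * ((1 + v) ^ k - 1) := by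
      push_cast
      ring
    rw [e]
    calc _ ≤ |(1 + v) ^ k - 1 - k * v| + |v| * |(1 + v) ^ k - 1| := by
          rw [← abs_mul]; exact abs_add_le _ _
      _ ≤ k ^ 2 * 2 ^ k * v ^ 2 + |v| * (k * 2 ^ k * |v|) := by
          gcongr
          exact abs_one_add_pow_sub_one_le hv k
      _ = (k ^ 2 + k) * 2 ^ k * v ^ 2 := by rw [← sq_abs v]; ring
      _ ≤ ((k + 1 : ℕ) : ℝ) ^ 2 * 2 ^ (k + 1) * v ^ 2 := by
          push_cast
          gcongr
          · nlinarith [(Nat.cast_nonneg k : (0 : ℝ) ≤ k)]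
          · norm_num
          · omega

lemma integral_sphereCoord (i : Fin n) : ∫ x, sphereCoord i x ∂(surfaceMeasure n) = 0 := by
  have h := integral_sphere_neg (n := n) (fun y => y i)
  simp only [PiLp.neg_apply, integral_neg] at h
  simp only [sphereCoord]
  linarith

/-- Expanding the constraint, k ∫ f v equals minus the integral of a second-order remainder. So the
volume and barycenter constraints make the affine component of u quadratically small. -/
lemma abs_integral_mul_le {f v : UnitSphere n → ℝ} (hf : Continuous f) (hf1 : ∀ x, |f x| ≤ 1)
    (hv : Continuous v) (hv1 : ∀ x, |v x| ≤ 1) {k : ℕ} (hk : 0 < k)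
    (h : ∫ x, f x * ((1 + v x) ^ k - 1) ∂(surfaceMeasure n) = 0) :
    |∫ x, f x * v x ∂(surfaceMeasure n)| ≤ k * 2 ^ k * sphereL2NormSq v := by
  have hk0 : (0 : ℝ) < k := by exact_mod_cast hk
  have e : k * ∫ x, f x * v x ∂(surfaceMeasure n)
      = - ∫ x, f x * ((1 + v x) ^ k - 1 - k * v x) ∂(surfaceMeasure n) := by
    rw [← integral_const_mul, ← sub_eq_zero, sub_neg_eq_add, ← integral_add
      (integrable_sphere (by fun_prop)) (integrable_sphere (by fun_prop)), ← h]
    congr with x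
    ring
  have h2 : k * |∫ x, f x * v x ∂(surfaceMeasure n)| ≤ k * (k * 2 ^ k * sphereL2NormSq v) := by
    calc k * |∫ x, f x * v x ∂(surfaceMeasure n)|
        = |k * ∫ x, f x * v x ∂(surfaceMeasure n)| := by rw [abs_mul, abs_of_pos hk0]
      _ = |∫ x, f x * ((1 + v x) ^ k - 1 - k * v x) ∂(surfaceMeasure n)| := by rw [e, abs_neg]
      _ ≤ ∫ x, |f x * ((1 + v x) ^ k - 1 - k * v x)| ∂(surfaceMeasure n) :=
          abs_integral_le_integral_abs
      _ ≤ ∫ x, k ^ 2 * 2 ^ k * v x ^ 2 ∂(surfaceMeasure n) := by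
          refine integral_mono (integrable_sphere (by fun_prop)) (integrable_sphere (by fun_prop))
            fun x => ?_
          simp only [abs_mul]
          exact (mul_le_of_le_one_left (abs_nonneg _) (hf1 x)).trans
            (abs_one_add_pow_sub_le (hv1 x) k)
      _ = _ := by rw [integral_const_mul, sphereL2NormSq]; ring
  exact le_of_mul_le_mul_left h2 hk0

lemma integral_sphereCoord_mul [NeZero n] (i j : Fin n) :
    ∫ x, sphereCoord i x * sphereCoord j x ∂(surfaceMeasure n)
      = if i = j then (surfaceMeasure n).real univ / n else 0 := by
  have hn : (n : ℝ) ≠ 0 := by exact_mod_cast NeZero.ne n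
  have hm : zonalMoment n 2 = (surfaceMeasure n).real univ / n := by
    have := zonalMoment_rec (n := n) 0
    rw [eq_div_iff hn, ← zonalMoment_zero]
    simpa [mul_comm] using this
  have hsq : ∀ i : Fin n, ∫ x, sphereCoord i x ^ 2 ∂(surfaceMeasure n)
      = (surfaceMeasure n).real univ / n := fun i => by
    rw [← hm, ← integral_inner_pow ⟨EuclideanSpace.single i 1, by simp⟩]
    simp [EuclideanSpace.inner_single_left, sphereCoord]
  split_ifs with h
  · subst h
    simpa only [sq] using hsq i
  · have hz : ‖EuclideanSpace.single i (1 : ℝ) + EuclideanSpace.single j 1‖ ^ 2 = 2 := by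
      rw [norm_add_sq_real]
      simp [EuclideanSpace.inner_single_left, h]
      norm_num
    have h2 := integral_inner_pow_even (EuclideanSpace.single i (1 : ℝ) + EuclideanSpace.single j 1)
      (fun h0 => by rw [h0, norm_zero] at hz; norm_num at hz) 1
    rw [hz, hm] at h2
    have e : ∀ x : UnitSphere n, (inner ℝ (EuclideanSpace.single i (1 : ℝ)
        + EuclideanSpace.single j 1) (x : Rn n)) ^ (2 * 1)
        = (sphereCoord i x ^ 2 + sphereCoord j x ^ 2) + 2 * (sphereCoord i x * sphereCoord j x) := by
      intro x
      simp only [inner_add_left, EuclideanSpace.inner_single_left, sphereCoord]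
      simp
      ring
    simp only [e] at h2
    rw [integral_add (integrable_sphere (by fun_prop)) (integrable_sphere (by fun_prop)),
      integral_add (integrable_sphere (by fun_prop)) (integrable_sphere (by fun_prop)), hsq, hsq,
      integral_const_mul] at h2
    linarith

lemma sobolevSeminormSq_le_add (s : ℝ) {u v w : UnitSphere n → ℝ} (hu : Continuous u) {A B : ℝ}
    (hA : 0 ≤ A) (hB : 0 ≤ B)
    (h : ∀ x y, (w x - w y) ^ 2 ≤ A * (u x - u y) ^ 2 + B * (v x - v y) ^ 2) :
    sobolevSeminormSq s w ≤ ENNReal.ofReal A * sobolevSeminormSq s u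
      + ENNReal.ofReal B * sobolevSeminormSq s v := by
  have hm := (measurable_sobolev_integrand s hu).const_mul (ENNReal.ofReal A)
  simp only [sobolevSeminormSq]
  rw [← lintegral_const_mul' _ _ ENNReal.ofReal_ne_top,
    ← lintegral_const_mul' _ _ ENNReal.ofReal_ne_top]
  simp only [← lintegral_const_mul' _ _ ENNReal.ofReal_ne_top]
  rw [← lintegral_add_left hm.lintegral_prod_right']
  refine lintegral_mono fun x => ?_
  rw [← lintegral_add_left (by exact hm.comp measurable_prodMk_left)]
  refine lintegral_mono fun y => ?_
  rw [← ENNReal.ofReal_mul hA, ← ENNReal.ofReal_mul hB, ← ENNReal.ofReal_add (by positivity)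
    (by positivity), ← mul_div_assoc, ← mul_div_assoc, ← add_div, sq_abs, sq_abs, sq_abs]
  gcongr
  exact h x y

/-- Spectral gap for functions that are nearly orthogonal to the affine functions. -/
lemma spectral_gap_of_nearly_orthogonal [NeZero n] (hn : 2 ≤ n) {s : ℝ} (hs : 0 < s) (hs1 : s < 1)
    {u : UnitSphere n → ℝ} (hu : Continuous u) (hQ : sobolevSeminormSq s u ≠ ∞) {δ : ℝ}
    (hδ : 64 * (n : ℝ) ^ 5 * δ ≤ 5)
    (h0 : (∫ x, u x ∂(surfaceMeasure n)) ^ 2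
      ≤ δ * (surfaceMeasure n).real univ * sphereL2NormSq u)
    (h1 : ∀ i, (∫ x, sphereCoord i x * u x ∂(surfaceMeasure n)) ^ 2
      ≤ δ * (surfaceMeasure n).real univ * sphereL2NormSq u) :
    (1 + 1 / n) * linearEnergy n s * sphereL2NormSq u ≤ (sobolevSeminormSq s u).toReal := by
  have hn2 : (2 : ℝ) ≤ n := by exact_mod_cast hn
  obtain ⟨σ, hσ⟩ : ∃ σ, σ = (surfaceMeasure n).real univ := ⟨_, rfl⟩
  obtain ⟨m, hm⟩ : ∃ m, m = sphereL2NormSq u := ⟨_, rfl⟩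
  obtain ⟨L, hL⟩ : ∃ L, L = linearEnergy n s := ⟨_, rfl⟩
  obtain ⟨Q, hQr⟩ : ∃ Q, Q = (sobolevSeminormSq s u).toReal := ⟨_, rfl⟩
  obtain ⟨I, hI⟩ : ∃ I, I = ∫ x, u x ∂(surfaceMeasure n) := ⟨_, rfl⟩
  obtain ⟨J, hJ⟩ : ∃ J : Fin n → ℝ, ∀ i, J i = ∫ x, sphereCoord i x * u x ∂(surfaceMeasure n) :=
    ⟨_, fun _ => rfl⟩
  have hσ0 : 0 < σ := hσ ▸ surfaceMeasure_real_univ_pos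
  have hm0 : 0 ≤ m := hm ▸ integral_nonneg fun x => sq_nonneg _
  have hQ0 : 0 ≤ Q := hQr ▸ ENNReal.toReal_nonneg
  have hL0 : 0 ≤ L := by
    rw [hL, linearEnergy]
    exact div_nonneg ENNReal.toReal_nonneg (hσ ▸ hσ0).le
  simp only [← hJ] at h1
  rw [← hI] at h0
  rw [← hσ, ← hm] at h0 h1
  rw [← hm, ← hL, ← hQr]
  -- As ∫ xᵢxⱼ is σ/n for i = j and 0 otherwise, I/σ + ℓ is the orthogonal projection of u on the
  -- affine functions, and w is the remainder.
  let b (i : Fin n) : ℝ := n / σ * J i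
  let ℓ (x : UnitSphere n) : ℝ := ∑ i, b i * sphereCoord i x
  let w (x : UnitSphere n) : ℝ := u x - I / σ - ℓ x
  have hℓ : Continuous ℓ := by fun_prop
  have hw : Continuous w := by fun_prop
  have hℓ0 : ∫ x, ℓ x ∂(surfaceMeasure n) = 0 := by
    rw [integral_finsetSum _ fun i _ => integrable_sphere (by fun_prop)]
    simp [integral_const_mul, integral_sphereCoord]
  have hℓ1 : ∀ i, ∫ x, sphereCoord i x * ℓ x ∂(surfaceMeasure n) = J i := fun i => by
    simp only [ℓ, Finset.mul_sum]
    rw [integral_finsetSum _ fun i _ => integrable_sphere (by fun_prop)]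
    simp only [mul_left_comm (sphereCoord i _), integral_const_mul, integral_sphereCoord_mul,
      mul_ite, mul_zero, Finset.sum_ite_eq, Finset.mem_univ, if_true, b, ← hσ]
    field_simp
  have hw0 : ∫ x, w x ∂(surfaceMeasure n) = 0 := by
    simp only [w]
    rw [integral_sub (integrable_sphere (by fun_prop)) (integrable_sphere hℓ),
      integral_sub (integrable_sphere hu) (integrable_const _), hℓ0, ← hI, integral_const, ← hσ,
      smul_eq_mul]
    field_simp
    ring
  have hw1 : ∀ i, ∫ x, sphereCoord i x * w x ∂(surfaceMeasure n) = 0 := fun i => by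
    simp only [w, mul_sub]
    rw [integral_sub (integrable_sphere (by fun_prop)) (integrable_sphere (by fun_prop)),
      integral_sub (integrable_sphere (by fun_prop)) (integrable_sphere (by fun_prop)),
      hℓ1, ← hJ, integral_mul_const, integral_sphereCoord]
    ring
  have hw2 : sphereL2NormSq w = m - I ^ 2 / σ - n / σ * ∑ i, J i ^ 2 := by
    have e1 : ∫ x, w x * ℓ x ∂(surfaceMeasure n) = 0 := by
      simp only [ℓ, Finset.mul_sum]
      rw [integral_finsetSum _ fun i _ => integrable_sphere (by fun_prop)]
      refine Finset.sum_eq_zero fun i _ => ?_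
      have : ∀ x, w x * (b i * sphereCoord i x) = b i * (sphereCoord i x * w x) := fun x => by ring
      simp only [this]
      rw [integral_const_mul, hw1, mul_zero]
    have e2 : ∫ x, u x * ℓ x ∂(surfaceMeasure n) = n / σ * ∑ i, J i ^ 2 := by
      simp only [ℓ, Finset.mul_sum]
      rw [integral_finsetSum _ fun i _ => integrable_sphere (by fun_prop)]
      refine Finset.sum_congr rfl fun i _ => ?_
      have : ∀ x, u x * (b i * sphereCoord i x) = b i * (sphereCoord i x * u x) := fun x => by ring
      simp only [this]
      rw [integral_const_mul, ← hJ]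
      simp only [b]
      ring
    have e3 : ∀ x, w x ^ 2 = ((u x ^ 2 - I / σ * u x) - u x * ℓ x) - I / σ * w x - w x * ℓ x := by
      intro x
      simp only [w]
      ring
    rw [sphereL2NormSq]
    simp only [e3]
    rw [integral_sub (integrable_sphere (by fun_prop)) (integrable_sphere (by fun_prop)),
      integral_sub (integrable_sphere (by fun_prop)) (integrable_sphere (by fun_prop)),
      integral_sub (integrable_sphere (by fun_prop)) (integrable_sphere (by fun_prop)),
      integral_sub (integrable_sphere (by fun_prop)) (integrable_sphere (by fun_prop)), e1, e2,
      integral_const_mul, integral_const_mul, hw0, ← hI, hm, sphereL2NormSq]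
    ring
  have hJsum : ∑ i, J i ^ 2 ≤ n * (δ * σ * m) := by
    calc ∑ i, J i ^ 2 ≤ ∑ _i : Fin n, δ * σ * m := Finset.sum_le_sum fun i _ => h1 i
      _ = _ := by simp
  have hℓQ : sobolevSeminormSq s ℓ ≤ ENNReal.ofReal (∑ i, b i ^ 2)
      * ∑ i, sobolevSeminormSq s (sphereCoord (n := n) i) := by
    refine sobolevSeminormSq_le_of_lipschitz s (fun x y => ?_)
      (Finset.sum_nonneg fun i _ => sq_nonneg _)
    simp only [ℓ]
    rw [← Finset.sum_sub_distrib, norm_sub_sq_eq_sum]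
    simp only [← mul_sub]
    exact Finset.sum_mul_sq_le_sq_mul_sq _ _ _
  have hbsum : ∑ i, b i ^ 2 = n ^ 2 / σ ^ 2 * ∑ i, J i ^ 2 := by
    simp only [b, mul_pow, div_pow, Finset.mul_sum]
  have hη : (0 : ℝ) < 1 / (4 * n) := by positivity
  -- Young's inequality with parameter 1/(4n), small enough to retain the factor 1+1/n at the end.
  have hwQ := sobolevSeminormSq_le_add s (w := w) (v := ℓ) hu (A := 1 + 1 / (4 * n))
    (B := 1 + 4 * n) (by positivity) (by positivity) fun x y => by
      have e : w x - w y = (u x - u y) - (ℓ x - ℓ y) := by simp only [w]; ring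
      rw [e]
      generalize u x - u y = p
      generalize ℓ x - ℓ y = q
      have : (1 + 1 / (4 * (n : ℝ))) * p ^ 2 + (1 + 4 * n) * q ^ 2 - (p - q) ^ 2
          = (p + 4 * n * q) ^ 2 / (4 * n) := by
        field_simp
        ring
      have h3 : 0 ≤ (p + 4 * n * q) ^ 2 / (4 * n) := by positivity
      linarith
  have hZtop := sum_sobolevSeminormSq_sphereCoord_ne_top (n := n) hs hs1
  have hwQ' := hwQ.trans (add_le_add_right (mul_le_mul_right hℓQ _) _)
  have hrtop : ENNReal.ofReal (1 + 1 / (4 * (n : ℝ))) * sobolevSeminormSq s u ≠ ∞ :=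
    ENNReal.mul_ne_top ENNReal.ofReal_ne_top hQ
  have hrtop2 : ENNReal.ofReal (1 + 4 * (n : ℝ)) * (ENNReal.ofReal (∑ i, b i ^ 2)
      * ∑ i, sobolevSeminormSq s (sphereCoord (n := n) i)) ≠ ∞ :=
    ENNReal.mul_ne_top ENNReal.ofReal_ne_top (ENNReal.mul_ne_top ENNReal.ofReal_ne_top hZtop)
  have hgap := spectral_gap_sobolev hn hs hs1 hw hw0 hw1
    (ne_top_of_le_ne_top (ENNReal.add_ne_top.2 ⟨hrtop, hrtop2⟩) hwQ')
  have hreal := ENNReal.toReal_mono (ENNReal.add_ne_top.2 ⟨hrtop, hrtop2⟩) hwQ'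
  rw [ENNReal.toReal_add hrtop hrtop2, ENNReal.toReal_mul, ENNReal.toReal_mul, ENNReal.toReal_mul,
    toReal_sum_sobolevSeminormSq_sphereCoord, ENNReal.toReal_ofReal (by positivity),
    ENNReal.toReal_ofReal (by positivity),
    ENNReal.toReal_ofReal (Finset.sum_nonneg fun i _ => sq_nonneg _), hbsum, ← hσ, ← hL, ← hQr]
    at hreal
  rw [← hL, hw2] at hgap
  have hδm : 0 ≤ δ * m := by
    have : 0 ≤ δ * σ * m := (sq_nonneg I).trans h0
    have h3 : 0 ≤ σ * (δ * m) := by linarith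
    exact nonneg_of_mul_nonneg_right h3 hσ0
  have k1 : m - (1 + n ^ 2) * (δ * m) ≤ m - I ^ 2 / σ - n / σ * ∑ i, J i ^ 2 := by
    have a1 : I ^ 2 / σ ≤ δ * m := by
      rw [div_le_iff₀ hσ0]
      linarith
    have a2 : n / σ * ∑ i, J i ^ 2 ≤ n ^ 2 * (δ * m) := by
      calc n / σ * ∑ i, J i ^ 2 ≤ n / σ * (n * (δ * σ * m)) := by gcongr
        _ = _ := by field_simp
    linarith
  have k2 : (n : ℝ) ^ 2 / σ ^ 2 * (∑ i, J i ^ 2) * (σ * L) ≤ n ^ 3 * (δ * m) * L := by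
    calc (n : ℝ) ^ 2 / σ ^ 2 * (∑ i, J i ^ 2) * (σ * L)
        ≤ n ^ 2 / σ ^ 2 * (n * (δ * σ * m)) * (σ * L) := by gcongr
      _ = _ := by field_simp
  have k3 : (1 + 2 / n) * L * (m - (1 + n ^ 2) * (δ * m))
      ≤ (1 + 1 / (4 * n)) * Q + (1 + 4 * n) * (n ^ 3 * (δ * m) * L) := by
    refine (mul_le_mul_of_nonneg_left k1 (by positivity)).trans (hgap.trans (hreal.trans ?_))
    gcongr
  -- The losses caused by δ total at most 8n⁴δm, which the hypothesis on δ turns into 5m/(8n).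
  have k4 : ((1 + 2 / n) * (1 + n ^ 2) + (1 + 4 * n) * n ^ 3) * (δ * m) ≤ 5 / (8 * n) * m := by
    have a1 : (1 + 2 / (n : ℝ)) * (1 + n ^ 2) + (1 + 4 * n) * n ^ 3 ≤ 8 * n ^ 4 := by
      have a2 : (2 : ℝ) / n ≤ 1 := (div_le_one (by linarith)).2 hn2
      have a3 : (1 + 2 / (n : ℝ)) * (1 + n ^ 2) ≤ 2 * (1 + n ^ 2) := by gcongr; linarith
      have a4 : (4 : ℝ) ≤ n ^ 2 := by nlinarith
      have a5 : (2 : ℝ) * n ^ 3 ≤ n * n ^ 3 := by gcongr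
      nlinarith
    calc _ ≤ 8 * n ^ 4 * (δ * m) := by gcongr
      _ = 64 * n ^ 5 * δ * m / (8 * n) := by field_simp; ring
      _ ≤ 5 * m / (8 * n) := by gcongr
      _ = _ := by ring
  -- Removing the loss 5/(8n) from 1+2/n leaves 1+11/(8n), which dominates (1+1/(4n))(1+1/n) because
  -- n ≥ 2.
  have k5 : (1 + 1 / (4 * n)) * ((1 + 1 / n) * L * m) ≤ (1 + 1 / (4 * n)) * Q := by
    have a1 : (1 + 1 / (4 * (n : ℝ))) * (1 + 1 / n) ≤ 1 + 11 / (8 * n) := by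
      have : 1 + 11 / (8 * (n : ℝ)) - (1 + 1 / (4 * (n : ℝ))) * (1 + 1 / n)
          = (n - 2) / (8 * n ^ 2) := by
        field_simp
        ring
      have h3 : 0 ≤ ((n : ℝ) - 2) / (8 * n ^ 2) := div_nonneg (by linarith) (by positivity)
      linarith
    have a2 := mul_le_mul_of_nonneg_left k4 hL0
    have a3 := mul_le_mul_of_nonneg_right a1 (mul_nonneg hL0 hm0)
    have a4 : (1 + 11 / (8 * (n : ℝ))) * (L * m) = (1 + 2 / n) * (L * m) - 5 / (8 * n) * (L * m) := by
      field_simp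
      ring
    linarith
  exact le_of_mul_le_mul_left k5 (by positivity)

end LinearPart

/-! ### Choice of the smallness parameter and estimates for u. -/

section NearlySpherical

open Set Filter Topology

variable {n : ℕ}

/-- As ε → 0 the three quantities tend to 1, 0 and 0, and none involves s. They control the ratio of
the square term to [u]², the cubic Taylor error and the failure of orthogonality. -/
lemma exists_small_parameter (n : ℕ) (hn : 2 ≤ n) :
    ∃ ε : ℝ, 0 < ε ∧ ε < 1 / 2 ∧
      1 - 1 / (4 * ((n : ℝ) + 1)) ≤ (1 - ε) ^ (2 * (n - 1)) / (1 + 3 * ε) ^ (n + 1) ∧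
      2 * (n * (n + 2) * 2 ^ n) * ε ≤ 1 / (4 * ((n : ℝ) + 1)) ∧
      64 * (n : ℝ) ^ 5 * ((((n : ℝ) + 1) * 2 ^ (n + 1)) ^ 2 * ε ^ 2) ≤ 5 := by
  have hpos : (0 : ℝ) < 1 / (4 * ((n : ℝ) + 1)) := by positivity
  have t1 : Tendsto (fun ε : ℝ => (1 - ε) ^ (2 * (n - 1)) / (1 + 3 * ε) ^ (n + 1)) (𝓝[>] 0)
      (𝓝 1) := by
    have h : ContinuousAt (fun ε : ℝ => (1 - ε) ^ (2 * (n - 1)) / (1 + 3 * ε) ^ (n + 1)) 0 := by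
      have : (1 + 3 * (0 : ℝ)) ^ (n + 1) ≠ 0 := by simp
      fun_prop (disch := assumption)
    simpa [ContinuousAt] using h.tendsto.mono_left nhdsWithin_le_nhds
  have t2 : Tendsto (fun ε : ℝ => 2 * (n * (n + 2) * 2 ^ n) * ε) (𝓝[>] 0) (𝓝 0) :=
    Continuous.tendsto' (by fun_prop) _ _ (by simp) |>.mono_left nhdsWithin_le_nhds
  have t3 : Tendsto (fun ε : ℝ => 64 * (n : ℝ) ^ 5 * ((((n : ℝ) + 1) * 2 ^ (n + 1)) ^ 2 * ε ^ 2))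
      (𝓝[>] 0) (𝓝 0) :=
    Continuous.tendsto' (by fun_prop) _ _ (by simp) |>.mono_left nhdsWithin_le_nhds
  have ev := ((t1.eventually_const_le (sub_lt_self 1 hpos)).and
    ((t2.eventually_le_const hpos).and (t3.eventually_le_const (by norm_num : (0 : ℝ) < 5)))).and
    (Ioo_mem_nhdsGT (show (0 : ℝ) < 1 / 2 by norm_num))
  obtain ⟨ε, ⟨h1, h2, h3⟩, h4⟩ := ev.exists
  exact ⟨ε, h4.1, h4.2, h1, h2, h3⟩

/-- The function describing a nearly spherical set with the volume and the barycenter of the unit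
ball satisfies the hypotheses of the spectral gap estimate. -/
lemma linearEnergy_mul_le_sobolevSeminormSq [NeZero n] (hn : 2 ≤ n) {s : ℝ} (hs : 0 < s)
    (hs1 : s < 1) {u : UnitSphere n → ℝ} (hu : Continuous u) {ε : ℝ} (hε1 : ε ≤ 1)
    (hε : 64 * (n : ℝ) ^ 5 * ((((n : ℝ) + 1) * 2 ^ (n + 1)) ^ 2 * ε ^ 2) ≤ 5)
    (huε : ∀ x, |u x| ≤ ε) (hQ : sobolevSeminormSq s u ≠ ∞)
    (hvol : ∫ x, (1 + u x) ^ n ∂(surfaceMeasure n) = (surfaceMeasure n).real univ)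
    (hbar : ∀ i, ∫ x, sphereCoord i x * (1 + u x) ^ (n + 1) ∂(surfaceMeasure n) = 0) :
    (1 + 1 / n) * linearEnergy n s * sphereL2NormSq u ≤ (sobolevSeminormSq s u).toReal := by
  have hu1 : ∀ x, |u x| ≤ 1 := fun x => (huε x).trans hε1
  have hm0 : 0 ≤ sphereL2NormSq u := integral_nonneg fun x => sq_nonneg _
  have hmσ : sphereL2NormSq u ≤ ε ^ 2 * (surfaceMeasure n).real univ := by
    calc sphereL2NormSq u ≤ ∫ _ : UnitSphere n, ε ^ 2 ∂(surfaceMeasure n) := by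
          refine integral_mono (integrable_sphere (by fun_prop)) (integrable_const _) fun x => ?_
          simp only [← sq_abs (u x)]
          exact pow_le_pow_left₀ (abs_nonneg _) (huε x) 2
      _ = _ := by rw [integral_const, smul_eq_mul, mul_comm]
  -- A bound |I| ≤ C‖u‖² becomes I² ≤ C²ε²σ‖u‖², because ‖u‖² ≤ ε²σ; this is the form with δ = C²ε².
  have hsq : ∀ I : ℝ, |I| ≤ ((n : ℝ) + 1) * 2 ^ (n + 1) * sphereL2NormSq u →
      I ^ 2 ≤ (((n : ℝ) + 1) * 2 ^ (n + 1)) ^ 2 * ε ^ 2 * (surfaceMeasure n).real univ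
        * sphereL2NormSq u := fun I hI => by
    calc I ^ 2 = |I| ^ 2 := (sq_abs I).symm
      _ ≤ (((n : ℝ) + 1) * 2 ^ (n + 1) * sphereL2NormSq u) ^ 2 := by gcongr
      _ = (((n : ℝ) + 1) * 2 ^ (n + 1)) ^ 2 * sphereL2NormSq u * sphereL2NormSq u := by ring
      _ ≤ (((n : ℝ) + 1) * 2 ^ (n + 1)) ^ 2 * (ε ^ 2 * (surfaceMeasure n).real univ)
        * sphereL2NormSq u := by gcongr
      _ = _ := by ring
  refine spectral_gap_of_nearly_orthogonal hn hs hs1 hu hQ hε (hsq _ ?_) fun i => hsq _ ?_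
  · have h := abs_integral_mul_le (f := fun _ => 1) continuous_const (by simp) hu hu1 (k := n)
      (by omega) (by
        simp only [one_mul]
        rw [integral_sub (integrable_sphere (by fun_prop)) (integrable_const _), hvol]
        simp)
    simp only [one_mul] at h
    refine h.trans ?_
    gcongr
    · linarith
    · norm_num
    · omega
  · have h := abs_integral_mul_le (continuous_sphereCoord i) (abs_sphereCoord_le i) hu hu1
      (k := n + 1) (by omega) (by
        simp only [mul_sub, mul_one]
        rw [integral_sub (integrable_sphere (by fun_prop)) (integrable_sphere (by fun_prop)), hbar,
          integral_sphereCoord, sub_zero])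
    exact_mod_cast h

lemma integral_powerDefect_ge [NeZero n] {s : ℝ} (hs : 0 < s) (hs1 : s < 1)
    {u : UnitSphere n → ℝ} (hu : Continuous u) {ε : ℝ} (hε : ε ≤ 1 / 2) (huε : ∀ x, |u x| ≤ ε) :
    -(s * (n - s) / 2 + n * (n + 2) * 2 ^ n * s * ε) * sphereL2NormSq u
      ≤ ∫ x, powerDefect n s (u x) ∂(surfaceMeasure n) := by
  have hcont : Continuous fun x => powerDefect n s (u x) := by
    unfold powerDefect
    have : Continuous fun x => (1 + u x) ^ ((n : ℝ) - s) :=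
      Continuous.rpow_const (by fun_prop) fun x => .inl (by
        linarith [(abs_le.1 (huε x)).1])
    fun_prop
  rw [sphereL2NormSq, ← integral_const_mul]
  refine integral_mono (integrable_sphere (by fun_prop)) (integrable_sphere hcont) fun x => ?_
  have h := (abs_le.1 (abs_powerDefect_add_le (n := n) NeZero.one_le hs hs1
    ((huε x).trans hε))).1
  have h3 : n * (n + 2) * 2 ^ n * s * |u x| ^ 3 ≤ n * (n + 2) * 2 ^ n * s * (ε * u x ^ 2) := by
    rw [pow_succ', sq_abs]
    gcongr
    exact huε x
  simp only
  linarith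

end NearlySpherical

/-! ### Conclusion. -/

theorem theorem2p1 (n : ℕ) (hn : 2 ≤ n) :
    ∃ ε₀ c₀ : ℝ, 0 < ε₀ ∧ ε₀ < 1 / 2 ∧ 0 < c₀ ∧
      ∀ (E : Set (Rn n)) (u : UnitSphere n → ℝ), IsNearlySpherical E u →
        volume E = volume (ball (0 : Rn n) 1) →
        (∫ x in E, x) = 0 →
        sphereC1Norm u < ENNReal.ofReal ε₀ →
        ∀ s : ℝ, 0 < s → s < 1 →
          sPerimeter s E ≠ ∞ ∧ sPerimeter s (ball (0 : Rn n) 1) ≠ ∞ ∧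
          sobolevSeminormSq s u ≠ ∞ ∧
          (sPerimeter s E).toReal - (sPerimeter s (ball (0 : Rn n) 1)).toReal ≥
            c₀ * ((sobolevSeminormSq s u).toReal +
              s * (sPerimeter s (ball (0 : Rn n) 1)).toReal * sphereL2NormSq u) := by
  have : NeZero n := ⟨by omega⟩
  have hn2 : (2 : ℝ) ≤ n := by exact_mod_cast hn
  obtain ⟨ε, hε0, hε2, hc, hC, hδ⟩ := exists_small_parameter n hn
  obtain ⟨σ, hσ⟩ : ∃ σ, σ = (surfaceMeasure n).real Set.univ := ⟨_, rfl⟩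
  have hσ0 : 0 < σ := hσ ▸ surfaceMeasure_real_univ_pos
  -- Since P_s(B) = σκ, the second term to be bounded carries the factor σ; μ absorbs it, as μ ≤ 1
  -- and μσ ≤ 1.
  obtain ⟨μ, hμ⟩ : ∃ μ, μ = min 1 (1 / σ) := ⟨_, rfl⟩
  have hμ0 : 0 < μ := hμ ▸ lt_min one_pos (by positivity)
  have hμ1 : μ ≤ 1 := hμ ▸ min_le_left _ _
  have hμσ : μ * σ ≤ 1 := by
    have := mul_le_mul_of_nonneg_right (hμ ▸ min_le_right _ _ : μ ≤ 1 / σ) hσ0.le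
    rwa [one_div_mul_cancel hσ0.ne'] at this
  refine ⟨ε, μ / (8 * (n + 1)), hε0, hε2, by positivity, ?_⟩
  intro E u hE hvol hbar hnorm s hs hs1
  have huε : ∀ x, |u x| ≤ ε := fun x => (abs_lt_of_sphereC1Norm_lt hnorm x).le
  have hu2 : ∀ x, |u x| ≤ 1 / 2 := fun x => (huε x).trans hε2.le
  have hu := hE.isC1.continuous
  have hLip := abs_sub_le_of_sphereC1Norm_lt hE.isC1 hnorm
  have hne : E.Nonempty := by
    refine nonempty_of_measure_ne_zero (μ := volume) ?_
    rw [hvol]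
    exact (measure_ball_pos _ _ one_pos).ne'
  have hER := hE.smul_mem_iff hne fun x => (hu2 x).trans_lt (by norm_num)
  have hEm := hE.isOpen.measurableSet
  have hR0 : ∀ x, 0 < 1 + u x := fun x => by linarith [(abs_le.1 (hu2 x)).1]
  have hPB := (sPerimeter_ball_lt_top (n := n) hs hs1).ne
  have hQ : sobolevSeminormSq s u ≠ ∞ := by
    refine ne_top_of_le_ne_top (ENNReal.mul_ne_top ENNReal.ofReal_ne_top
      (sum_sobolevSeminormSq_sphereCoord_ne_top (n := n) hs hs1))
      (sobolevSeminormSq_le_of_lipschitz s (L := (2 * ε) ^ 2) (fun x y => ?_) (sq_nonneg _))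
    rw [← sq_abs (u x - u y), ← mul_pow]
    exact pow_le_pow_left₀ (abs_nonneg _) (hLip x y) 2
  have hup := lintegral_radialSquare_le hs hs1 (by linarith) huε
  have hlow := le_lintegral_radialSquare hs hs1 (by linarith) huε hLip
  rw [← radialInteraction] at hup hlow
  have hD : radialInteraction s u ≠ ∞ :=
    ne_top_of_le_ne_top (ENNReal.mul_ne_top ENNReal.ofReal_ne_top hQ) hup
  obtain ⟨hfin, hexp⟩ := sPerimeter_sub_ball hs hs1 hEm hu hu2 hER hvol
  refine ⟨hfin.2 hD, hPB, hQ, ?_⟩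
  have hgap := linearEnergy_mul_le_sobolevSeminormSq hn hs hs1 hu (by linarith) hδ huε hQ
    (integral_pow_of_volume_eq hEm hu hu2 hER hvol)
    (integral_coord_mul_pow_eq_zero hEm hE.isBounded (by fun_prop) hR0 hER hbar)
  have hψ := integral_powerDefect_ge hs hs1 hu hε2.le huε
  have hκL := mul_perimeterDensity_le_linearEnergy (n := n) hs hs1
  have hlow' := ENNReal.toReal_mono hD hlow
  rw [ENNReal.toReal_mul, ENNReal.toReal_ofReal (by
    have : 0 < 1 - ε := by linarith
    positivity)] at hlow'
  rw [ge_iff_le, hexp hD, sPerimeter_ball, ENNReal.toReal_mul, ← measureReal_def, ← hσ]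
  obtain ⟨κ, hκ⟩ : ∃ κ, κ = (perimeterDensity n s).toReal := ⟨_, rfl⟩
  obtain ⟨m, hm⟩ : ∃ m, m = sphereL2NormSq u := ⟨_, rfl⟩
  obtain ⟨Q, hQr⟩ : ∃ Q, Q = (sobolevSeminormSq s u).toReal := ⟨_, rfl⟩
  obtain ⟨D, hDr⟩ : ∃ D, D = (radialInteraction s u).toReal := ⟨_, rfl⟩
  obtain ⟨Ψ, hΨ⟩ : ∃ Ψ, Ψ = ∫ x, powerDefect n s (u x) ∂(surfaceMeasure n) := ⟨_, rfl⟩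
  have hκ0 : 0 ≤ κ := hκ ▸ ENNReal.toReal_nonneg
  have hQ0 : 0 ≤ Q := hQr ▸ ENNReal.toReal_nonneg
  have hm0 : 0 ≤ m := hm ▸ integral_nonneg fun x => sq_nonneg _
  rw [← hκ] at hκL ⊢
  rw [← hΨ, ← hDr, ← hQr, ← hm]
  rw [← hΨ, ← hm] at hψ
  rw [← hm, ← hQr] at hgap
  rw [← hQr, ← hDr] at hlow'
  obtain ⟨C, hCr⟩ : ∃ C : ℝ, C = n * (n + 2) * 2 ^ n := ⟨_, rfl⟩
  rw [← hCr] at hψ hC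
  have hC0 : 0 ≤ C := by rw [hCr]; positivity
  -- With this value 1 - 4η = (1+1/n)⁻¹, so 4η is the relative margin that the spectral gap leaves
  -- between Λ and Q.
  obtain ⟨η, hη⟩ : ∃ η : ℝ, η = 1 / (4 * ((n : ℝ) + 1)) := ⟨_, rfl⟩
  rw [← hη] at hc hC
  obtain ⟨Λ, hΛ⟩ : ∃ Λ, Λ = s * (n - s) * κ * m := ⟨_, rfl⟩
  have hsκm : s * κ * m ≤ Λ := by
    rw [hΛ]
    have h1 : 0 ≤ s * κ * m := by positivity
    have h2 := mul_le_mul_of_nonneg_right (show 1 ≤ (n : ℝ) - s by linarith) h1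
    linarith
  have hsκm0 : 0 ≤ s * κ * m := by positivity
  have hΛQ : (1 + 1 / n) * Λ ≤ Q := by
    refine le_trans ?_ hgap
    rw [hΛ, mul_assoc (1 + 1 / (n : ℝ))]
    gcongr
  have hΛη : Λ ≤ (1 - 4 * η) * Q := by
    have e : 1 - 4 * η = (1 + 1 / (n : ℝ))⁻¹ := by
      rw [hη]
      field_simp
      ring
    rw [e, ← div_eq_inv_mul, le_div_iff₀ (by positivity)]
    linarith
  have hη0 : 0 < η := by rw [hη]; positivity
  have hDQ : (1 - η) * Q ≤ D := (mul_le_mul_of_nonneg_right hc hQ0).trans hlow'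
  have hκΨ : -(1 + η) * Λ / 2 ≤ κ * Ψ := by
    have h1 := mul_le_mul_of_nonneg_left hψ hκ0
    have h2 : C * ε * (s * κ * m) ≤ η / 2 * Λ :=
      mul_le_mul (by linarith) hsκm hsκm0 (by positivity)
    rw [hΛ] at h2 ⊢
    linarith
  -- Twice the deficit is at least (1-η)Q - (1+η)(1-4η)Q = (2η + 4η²)Q.
  have hfinal : η * Q ≤ κ * Ψ + D / 2 := by
    have h1 : (1 + η) * Λ ≤ (1 + η) * ((1 - 4 * η) * Q) := by gcongr
    have h2 := mul_nonneg (sq_nonneg η) hQ0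
    linarith
  have hΛQ' : s * κ * m ≤ Q :=
    hsκm.trans (hΛη.trans (mul_le_of_le_one_left hQ0 (by linarith)))
  have e : μ / (8 * ((n : ℝ) + 1)) = η / 2 * μ := by
    rw [hη]
    field_simp
    ring
  rw [e]
  refine le_trans ?_ hfinal
  have h3 : μ * Q ≤ Q := mul_le_of_le_one_left hQ0 hμ1
  have h4 : μ * (s * (σ * κ) * m) ≤ Q := by
    calc μ * (s * (σ * κ) * m) = (μ * σ) * (s * κ * m) := by ring
      _ ≤ s * κ * m := mul_le_of_le_one_left hsκm0 hμσ
      _ ≤ Q := hΛQ'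
  calc η / 2 * μ * (Q + s * (σ * κ) * m) = η / 2 * (μ * Q + μ * (s * (σ * κ) * m)) := by ring
    _ ≤ η / 2 * (Q + Q) := by gcongr
    _ = η * Q := by ring
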